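/- Fix $s>0$, $\lambda_L,\lambda_R>0$ and set $T_L=1/\lambda_L$, $T_R=1/\lambda_R$, $\mathbb R_+=(0,\infty)$. For $N\ge 1$ consider the Markov process $y(t)=(y_1(t),\dots,y_N(t))$ on $\mathbb R_+^N$ with generator, acting on polynomial functions $f$ of $y$ (that is, $\frac{d}{dt}\mathbb E_y[f(y(t))]=\mathbb E_y[(\mathscr Lf)(y(t))]$ for all $t\ge 0$ and all starting points $y$, where all polynomials are integrable), $$\mathscr L=\mathscr L_1+\sum_{i=1}^{N-1}\mathscr L_{i,i+1}+\mathscr L_N ,$$ $$\begin{aligned}\mathscr L_{i,i+1}f(y)&=\int_0^{y_i}\frac{d\alpha}{\alpha}\Big(1-\frac{\alpha}{y_i}\Big)^{2s-1}\big[f(y-\alpha\delta_i+\alpha\delta_{i+1})-f(y)\big]\\&\quad+\int_0^{y_{i+1}}\frac{d\alpha}{\alpha}\Big(1-\frac{\alpha}{y_{i+1}}\Big)^{2s-1}\big[f(y+\alpha\delta_i-\alpha\delta_{i+1})-f(y)\big],\end{aligned}$$ $$\mathscr L_1f(y)=\int_0^{y_1}\frac{d\alpha}{\alpha}\Big(1-\frac{\alpha}{y_1}\Big)^{2s-1}\big[f(y-\alpha\delta_1)-f(y)\big]+\int_0^{\infty}\frac{d\alpha}{\alpha}e^{-\lambda_L\alpha}\big[f(y+\alpha\delta_1)-f(y)\big],$$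 $$\mathscr L_Nf(y)=\int_0^{y_N}\frac{d\alpha}{\alpha}\Big(1-\frac{\alpha}{y_N}\Big)^{2s-1}\big[f(y-\alpha\delta_N)-f(y)\big]+\int_0^{\infty}\frac{d\alpha}{\alpha}e^{-\lambda_R\alpha}\big[f(y+\alpha\delta_N)-f(y)\big],$$ where $\delta_i$ is the $i$-th unit vector. Let $\mu_N$ be an invariant probability measure of this process. Let $T(u)=T_L+(T_R-T_L)u$. (i) (Local equilibrium.) For every $u\in(0,1)$ and every bounded continuous function $f:\mathbb R_+^{\mathbb N}\to\mathbb R$, $\mathbb N=\{1,2,\dots\}$, that depends on finitely many coordinates only, $$\lim_{N\to\infty}\int f\big(y_{[uN]+1},y_{[uN]+2},\dots\big)\,\mu_N(dy)=\int f\,d\nu_{1/T(u)},$$ where $[\cdot]$ is the integer part (for $N$ large all the coordinates that $f$ depends on lie in the chain; coordinates beyond its end may be given any fixed value) and $\nu_\lambda$ is the product measure on $\mathbb R_+^{\mathbb N}$ whose marginals are the Gamma distribution with shape parameter $2s$ and rate parameter $\lambda$, with density $\frac{\lambda^{2s}}{\Gamma(2s)}x^{2s-1}e^{-\lambda x}$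 on $\mathbb R_+$. (ii) (Fourier's law.) The energies $y_i$ are $\mu_N$-integrable, and with the stationary flux $J_{i,i+1}=\int(y_i-y_{i+1})\,\mu_N(dy)$ the limit $J=\lim_{N\to\infty}\sum_{i=1}^{N-1}J_{i,i+1}$ exists and satisfies $$J=-2s\,\frac{dT(u)}{du}\qquad\text{for all }u\in(0,1).$$ -/

import Mathlib

open MeasureTheory ProbabilityTheory Filter Topology

namespace HeatConduction

/-- The half line `ℝ₊ = (0, ∞)` of energies. -/
abbrev PosReal : Type := Set.Ioi (0 : ℝ)

/-- The configuration space `ℝ₊ᴺ` of a chain of `N` sites; the index `i : Fin N` is the site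
`i + 1` in the labelling `1, …, N`. -/
abbrev Config (N : ℕ) : Type := Fin N → PosReal

/-- The vector of the (real) energies of a configuration. -/
def Config.toReal {N : ℕ} (y : Config N) : Fin N → ℝ := fun i => (y i : ℝ)

section Generator

variable {N : ℕ}

/-- Movement of energy from site `i` to site `j`:
`∫₀^{yᵢ} (dα/α) (1 - α/yᵢ)^{2s-1} [f(y - α δᵢ + α δⱼ) - f(y)]`. -/
noncomputable def transfer (s : ℝ) (i j : Fin N) (f : (Fin N → ℝ) → ℝ) (y : Fin N → ℝ) : ℝ :=
  ∫ α in (0 : ℝ)..(y i),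
    (1 / α) * (1 - α / y i) ^ (2 * s - 1) * (f (y - Pi.single i α + Pi.single j α) - f y)

/-- Coupling of site `i` to a reservoir with parameter `lam`:
`∫₀^{yᵢ} (dα/α) (1 - α/yᵢ)^{2s-1} [f(y - α δᵢ) - f(y)] + ∫₀^∞ (dα/α) e^{-lam α} [f(y + α δᵢ) - f(y)]`. -/
noncomputable def reservoir (s lam : ℝ) (i : Fin N) (f : (Fin N → ℝ) → ℝ) (y : Fin N → ℝ) : ℝ :=
  (∫ α in (0 : ℝ)..(y i),
    (1 / α) * (1 - α / y i) ^ (2 * s - 1) * (f (y - Pi.single i α) - f y)) +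
  ∫ α in Set.Ioi (0 : ℝ), (1 / α) * Real.exp (-lam * α) * (f (y + Pi.single i α) - f y)

/-- The generator of the boundary driven chain: the sum over the bonds `(i, i+1)` of the energy
exchange in both directions, and the two reservoirs at the first and at the last site. -/
noncomputable def generator (s lamL lamR : ℝ) (f : (Fin N → ℝ) → ℝ) (y : Fin N → ℝ) : ℝ :=
  (∑ i : Fin N, if (i : ℕ) = 0 then reservoir s lamL i f y else 0) +
  (∑ i : Fin N, ∑ j : Fin N,
    if (i : ℕ) + 1 = (j : ℕ) then transfer s i j f y + transfer s j i f y else 0) +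
  (∑ i : Fin N, if (i : ℕ) + 1 = N then reservoir s lamR i f y else 0)

end Generator

/-- `P` is the transition semigroup of the Markov process on `ℝ₊ᴺ` whose generator acts on
polynomial functions as `generator s lamL lamR`: the `P t` are Markov kernels with the semigroup
property, the polynomials `p` are integrable under them, and
`d/dt E_y[p(y(t))] = E_y[(L p)(y(t))]` for all `t ≥ 0` and all starting points `y`. -/
structure IsHeatSemigroup {N : ℕ} (s lamL lamR : ℝ)
    (P : NNReal → Kernel (Config N) (Config N)) : Prop where
  markov : ∀ t, IsMarkovKernel (P t)
  zero : P 0 = Kernel.id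
  add : ∀ t u, P (t + u) = (P u).comp (P t)
  integrable : ∀ (p : MvPolynomial (Fin N) ℝ) (t : NNReal) (y : Config N),
    Integrable (fun z : Config N => MvPolynomial.eval z.toReal p) (P t y)
  forward : ∀ (p : MvPolynomial (Fin N) ℝ) (t : NNReal) (y : Config N),
    HasDerivWithinAt
      (fun r : ℝ => ∫ z : Config N, MvPolynomial.eval z.toReal p ∂(P r.toNNReal y))
      (∫ z : Config N, generator s lamL lamR (fun x => MvPolynomial.eval x p) z.toReal ∂(P t y))
      (Set.Ici 0) (t : ℝ)

/-- `μ` is an invariant probability measure of the process with transition semigroup `P`. -/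
def IsStationary {N : ℕ} (P : NNReal → Kernel (Config N) (Config N))
    (μ : Measure (Config N)) : Prop :=
  IsProbabilityMeasure μ ∧ ∀ t, Kernel.Invariant (P t) μ

/-- The configuration `(y_{k+1}, y_{k+2}, …) ∈ ℝ₊^ℕ` seen to the right of the site `k` of a chain
of length `N`. The entries beyond the end of the chain are irrelevant for a given cylinder function
as soon as `N - k` is large; they are set to `1`. -/
def seenFrom {N : ℕ} (k : ℕ) (y : Config N) : ℕ → PosReal :=
  fun j => if h : k + j < N then y ⟨k + j, h⟩ else ⟨1, Set.mem_Ioi.mpr one_pos⟩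

/-- The Gamma distribution with shape `a` and rate `r` on `(0, ∞)`. -/
noncomputable def gammaPos (a r : ℝ) : Measure PosReal :=
  (gammaMeasure a r).comap Subtype.val

/-- The product measure on `ℝ₊^ℕ` whose marginals are Gamma distributions with shape `2 s` and
rate `lam`. -/
noncomputable def gammaProduct (s lam : ℝ) : Measure (ℕ → PosReal) :=
  Measure.infinitePi fun _ => gammaPos (2 * s) lam

theorem isProbabilityMeasure_gammaPos {a r : ℝ} (ha : 0 < a) (hr : 0 < r) :
    IsProbabilityMeasure (gammaPos a r) := by
  have := isProbabilityMeasure_gammaMeasure ha hr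
  refine (MeasurableEmbedding.subtype_coe measurableSet_Ioi).isProbabilityMeasure_comap ?_
  rw [Subtype.range_coe, gammaMeasure, ae_withDensity_iff (by
    exact (measurable_gammaPDFReal a r).ennreal_ofReal)]
  have h0 : ∀ᵐ x : ℝ, x ≠ 0 := by simp [ae_iff]
  filter_upwards [h0] with x hx hpdf
  rcases lt_or_ge x 0 with h | h
  · exact absurd (gammaPDF_of_neg h) hpdf
  · exact lt_of_le_of_ne h (Ne.symm hx)

/-- The linear macroscopic temperature profile. -/
noncomputable def temperature (TL TR u : ℝ) : ℝ := TL + (TR - TL) * u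

/-- The stationary energy flux `J_{i,j} = ∫ (yᵢ - yⱼ) dμ` between the sites `i` and `j`. -/
noncomputable def flux {N : ℕ} (μ : Measure (Config N)) (i j : Fin N) : ℝ :=
  ∫ y : Config N, ((y i : ℝ) - (y j : ℝ)) ∂μ

/-- The total stationary current: the sum of `J_{i,i+1}` over all bonds of the chain. -/
noncomputable def totalCurrent {N : ℕ} (μ : Measure (Config N)) : ℝ :=
  ∑ i : Fin N, ∑ j : Fin N, if (i : ℕ) + 1 = (j : ℕ) then flux μ i j else 0

end HeatConduction

namespace HeatConduction

open Polynomial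

/-! ### One-dimensional jump functionals -/

theorem intervalIntegrable_one_sub_rpow {s : ℝ} (hs : 0 < s) (q : ℝ[X]) :
    IntervalIntegrable (fun b : ℝ => (1 - b) ^ (2 * s - 1) * q.eval b) volume 0 1 := by
  have h := (intervalIntegral.intervalIntegrable_rpow' (a := 0) (b := 1)
    (r := 2 * s - 1) (by linarith)).comp_sub_left 1
  simp only [sub_zero, sub_self] at h
  exact h.symm.mul_continuousOn q.continuous.continuousOn

theorem eval_divX (p : ℝ[X]) {a : ℝ} (ha : a ≠ 0) :
    p.divX.eval a = 1 / a * (p.eval a - p.eval 0) := by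
  conv_rhs => rw [← Polynomial.divX_mul_X_add p]
  simp only [eval_add, eval_mul, eval_X, eval_C, mul_zero, zero_add, add_sub_cancel_right]
  field_simp

theorem divX_smul (c : ℝ) (p : ℝ[X]) : (c • p).divX = c • p.divX := by
  ext n; simp [Polynomial.coeff_divX]

/-- The functional `p ↦ ∫₀¹ (dβ/β) (1 - β)^{2s-1} [p(β) - p(0)]` on polynomials. -/
noncomputable def jump {s : ℝ} (hs : 0 < s) : ℝ[X] →ₗ[ℝ] ℝ where
  toFun p := ∫ b in (0 : ℝ)..1, (1 - b) ^ (2 * s - 1) * p.divX.eval b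
  map_add' p q := by
    rw [← intervalIntegral.integral_add (intervalIntegrable_one_sub_rpow hs _)
      (intervalIntegrable_one_sub_rpow hs _)]
    simp [Polynomial.divX_add, mul_add]
  map_smul' c p := by
    rw [divX_smul, RingHom.id_apply, smul_eq_mul, ← intervalIntegral.integral_const_mul]
    simp [mul_left_comm]

theorem integrableOn_exp_mul_eval {lam : ℝ} (hl : 0 < lam) (q : ℝ[X]) :
    IntegrableOn (fun a : ℝ => Real.exp (-lam * a) * q.eval a) (Set.Ioi 0) := by
  induction q using Polynomial.induction_on' with
  | add p q hp hq =>
    refine (hp.add hq).congr_fun (fun x _ => ?_) measurableSet_Ioi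
    simp [mul_add]
  | monomial n c =>
    have h2 := integrableOn_rpow_mul_exp_neg_mul_rpow (p := 1) (s := n) (b := lam)
      (by have : (0 : ℝ) ≤ n := by positivity
          linarith) one_pos hl
    refine IntegrableOn.congr_fun (Integrable.const_mul h2 c) (fun x hx => ?_) measurableSet_Ioi
    simp only [Real.rpow_natCast, Real.rpow_one, eval_monomial]
    ring

/-- The functional `p ↦ ∫₀^∞ (dα/α) e^{-λα} [p(α) - p(0)]` on polynomials. -/
noncomputable def gain {lam : ℝ} (hl : 0 < lam) : ℝ[X] →ₗ[ℝ] ℝ where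
  toFun p := ∫ a in Set.Ioi (0 : ℝ), Real.exp (-lam * a) * p.divX.eval a
  map_add' p q := by
    rw [← integral_add (integrableOn_exp_mul_eval hl _) (integrableOn_exp_mul_eval hl _)]
    simp [Polynomial.divX_add, mul_add]
  map_smul' c p := by
    rw [divX_smul, RingHom.id_apply, smul_eq_mul, ← integral_const_mul]
    simp [mul_left_comm]

theorem jump_C {s : ℝ} (hs : 0 < s) (c : ℝ) : jump hs (C c) = 0 := by simp [jump]

theorem gain_C {lam : ℝ} (hl : 0 < lam) (c : ℝ) : gain hl (C c) = 0 := by simp [gain]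

theorem gain_X_pow {lam : ℝ} (hl : 0 < lam) (k : ℕ) :
    gain hl (X ^ (k + 1)) = Real.Gamma (k + 1) * (1 / lam) ^ (k + 1) := by
  have h : ∀ a ∈ Set.Ioi (0 : ℝ), Real.exp (-lam * a) * (X ^ (k + 1) : ℝ[X]).divX.eval a
      = a ^ (((k : ℝ) + 1) - 1) * Real.exp (-(lam * a)) := by
    intro a ha
    have ha' : a ≠ 0 := ne_of_gt ha
    rw [eval_divX _ ha']
    simp only [eval_pow, eval_X, add_sub_cancel_right, Real.rpow_natCast, neg_mul]
    rw [zero_pow (Nat.succ_ne_zero k)]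
    field_simp
    ring
  change ∫ a in Set.Ioi (0 : ℝ), _ = _
  rw [setIntegral_congr_fun measurableSet_Ioi h,
    Real.integral_rpow_mul_exp_neg_mul_Ioi (by positivity) hl, mul_comm]
  norm_cast

theorem integral_beta {a b : ℝ} (ha : 0 < a) (hb : 0 < b) :
    ∫ x in (0 : ℝ)..1, x ^ (a - 1) * (1 - x) ^ (b - 1)
      = Real.Gamma a * Real.Gamma b / Real.Gamma (a + b) := by
  have h := beta_eq_betaIntegralReal a b ha hb
  rw [ProbabilityTheory.beta, Complex.betaIntegral] at h
  rw [h, ← Complex.ofReal_re (∫ x in (0 : ℝ)..1, x ^ (a - 1) * (1 - x) ^ (b - 1)),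
    ← intervalIntegral.integral_ofReal]
  congr 1
  refine intervalIntegral.integral_congr fun x hx => ?_
  rw [Set.uIcc_of_le zero_le_one] at hx
  simp only [Complex.ofReal_mul]
  rw [Complex.ofReal_cpow hx.1, Complex.ofReal_cpow (sub_nonneg.2 hx.2)]
  norm_num

/-- The moments `∫₀¹ β^{k-1} (1 - β)^{2s-1+m} dβ`. -/
noncomputable def betaCoeff (s : ℝ) (k m : ℕ) : ℝ :=
  Real.Gamma k * Real.Gamma (2 * s + m) / Real.Gamma (2 * s + m + k)

theorem jump_X_pow_mul {s : ℝ} (hs : 0 < s) (k m : ℕ) :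
    jump hs (X ^ (k + 1) * (1 - X) ^ m) = betaCoeff s (k + 1) m := by
  have h1 : (X ^ (k + 1) * (1 - X) ^ m : ℝ[X]).divX = X ^ k * (1 - X) ^ m := by
    rw [pow_succ, mul_right_comm, mul_comm _ X]
    ext n
    simp [Polynomial.coeff_divX]
  change ∫ b in (0 : ℝ)..1, _ = _
  rw [h1, betaCoeff]
  have h2 := integral_beta (a := k + 1) (b := 2 * s + m) (by positivity) (by positivity)
  rw [show ((k + 1 : ℕ) : ℝ) = (k : ℝ) + 1 by push_cast; ring,
    show 2 * s + m + ((k : ℝ) + 1) = k + 1 + (2 * s + m) by ring, ← h2]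
  refine intervalIntegral.integral_congr_ae ?_
  have h3 : ∀ᵐ x : ℝ, x ≠ 1 := by simp [ae_iff]
  filter_upwards [h3] with x hx1 hx
  rw [Set.uIoc_of_le zero_le_one] at hx
  have hx2 : 0 < 1 - x := by
    rcases lt_or_eq_of_le hx.2 with h | h
    · linarith
    · exact absurd h hx1
  simp only [eval_mul, eval_pow, eval_X, eval_sub, eval_one, add_sub_cancel_right,
    Real.rpow_natCast]
  rw [show 2 * s + m - 1 = 2 * s - 1 + m by ring, Real.rpow_add hx2, Real.rpow_natCast]
  ring

/-- The rate at which `k` out of `n` particles jump in the dual process. -/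
noncomputable def dualRate (s : ℝ) (k n : ℕ) : ℝ := n.choose k * betaCoeff s k (n - k)

/-- The total rate at which particles jump off a site holding `n` particles. -/
noncomputable def exitRate (s : ℝ) (n : ℕ) : ℝ := ∑ k ∈ Finset.range n, dualRate s (k + 1) n

theorem betaCoeff_pos {s : ℝ} (hs : 0 < s) (k m : ℕ) : 0 < betaCoeff s (k + 1) m := by
  unfold betaCoeff
  have h1 := Real.Gamma_pos_of_pos (s := ((k + 1 : ℕ) : ℝ)) (by positivity)
  have h2 := Real.Gamma_pos_of_pos (s := 2 * s + m) (by positivity)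
  have h3 := Real.Gamma_pos_of_pos (s := 2 * s + m + ((k + 1 : ℕ) : ℝ)) (by positivity)
  positivity

theorem dualRate_pos {s : ℝ} (hs : 0 < s) {k n : ℕ} (hk : k < n) : 0 < dualRate s (k + 1) n := by
  have := Nat.choose_pos (Nat.succ_le_of_lt hk)
  exact mul_pos (by exact_mod_cast this) (betaCoeff_pos hs _ _)

theorem exitRate_pos {s : ℝ} (hs : 0 < s) {n : ℕ} (hn : 0 < n) : 0 < exitRate s n :=
  Finset.sum_pos (fun _ hk => dualRate_pos hs (Finset.mem_range.1 hk))
    (Finset.nonempty_range_iff.2 hn.ne')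

theorem jump_one_sub_pow {s : ℝ} (hs : 0 < s) (n : ℕ) :
    jump hs ((1 - X) ^ n) = - exitRate s n := by
  have h : (C 1 : ℝ[X]) = (X + (1 - X)) ^ n := by simp
  have h2 := jump_C hs 1
  rw [h, add_pow, Finset.sum_range_succ', map_add, map_sum] at h2
  simp only [pow_zero, one_mul, Nat.sub_zero, Nat.choose_zero_right, Nat.cast_one, mul_one] at h2
  rw [exitRate, eq_neg_iff_add_eq_zero, add_comm, ← h2]
  congr 1
  refine Finset.sum_congr rfl fun k _ => ?_
  rw [mul_comm, show ((n.choose (k + 1) : ℕ) : ℝ[X]) = C (n.choose (k + 1) : ℝ) by simp,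
    ← Polynomial.smul_eq_C_mul, map_smul, jump_X_pow_mul, dualRate, smul_eq_mul]

/-- Jump of the convex combination `((1-β)x + βy)^n`. -/
theorem jump_convex_pow {s : ℝ} (hs : 0 < s) (n : ℕ) (x y : ℝ) :
    jump hs ((C x + C (y - x) * X) ^ n)
      = ∑ k ∈ Finset.range n, dualRate s (k + 1) n * (x ^ (n - (k + 1)) * y ^ (k + 1) - x ^ n) := by
  have h : (C x + C (y - x) * X : ℝ[X]) = C y * X + C x * (1 - X) := by
    simp only [map_sub]; ring
  rw [h, add_pow, Finset.sum_range_succ', map_add, map_sum]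
  have h0 : (C y * X : ℝ[X]) ^ 0 * (C x * (1 - X)) ^ (n - 0) * ((n.choose 0 : ℕ) : ℝ[X])
      = x ^ n • (1 - X) ^ n := by
    simp [Polynomial.smul_eq_C_mul, mul_pow]
  rw [h0, map_smul, jump_one_sub_pow, exitRate, smul_eq_mul]
  simp only [mul_sub (dualRate _ _ _), Finset.sum_sub_distrib]
  rw [mul_neg, ← sub_eq_add_neg, Finset.mul_sum]
  congr 1
  · refine Finset.sum_congr rfl fun k _ => ?_
    have : (C y * X : ℝ[X]) ^ (k + 1) * (C x * (1 - X)) ^ (n - (k + 1))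
        * ((n.choose (k + 1) : ℕ) : ℝ[X])
        = (n.choose (k + 1) * x ^ (n - (k + 1)) * y ^ (k + 1) : ℝ) •
          (X ^ (k + 1) * (1 - X) ^ (n - (k + 1))) := by
      simp only [Polynomial.smul_eq_C_mul, mul_pow, map_mul, map_pow, map_natCast]; ring
    rw [this, map_smul, jump_X_pow_mul, dualRate, smul_eq_mul]
    ring
  · exact Finset.sum_congr rfl fun k _ => mul_comm _ _

/-- Jump of a product of powers at the two ends of a bond. -/
theorem jump_exchange {s : ℝ} (hs : 0 < s) (m n : ℕ) (x y : ℝ) :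
    jump hs ((1 - X) ^ m * (C y + C x * X) ^ n)
      = ∑ k ∈ Finset.range n, n.choose (k + 1) * betaCoeff s (k + 1) m
          * (x ^ (k + 1) * y ^ (n - (k + 1))) - exitRate s m * y ^ n := by
  rw [add_comm (C y), add_pow, Finset.mul_sum, Finset.sum_range_succ', map_add, map_sum]
  have h0 : (1 - X) ^ m * ((C x * X : ℝ[X]) ^ 0 * C y ^ (n - 0) * ((n.choose 0 : ℕ) : ℝ[X]))
      = y ^ n • (1 - X) ^ m := by
    simp only [Polynomial.smul_eq_C_mul, map_pow, pow_zero, Nat.sub_zero, Nat.choose_zero_right,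
      Nat.cast_one]
    ring
  rw [h0, map_smul, jump_one_sub_pow, smul_eq_mul, mul_neg, ← sub_eq_add_neg, mul_comm (y ^ n)]
  congr 1
  refine Finset.sum_congr rfl fun k _ => ?_
  have : (1 - X) ^ m * ((C x * X : ℝ[X]) ^ (k + 1) * C y ^ (n - (k + 1))
      * ((n.choose (k + 1) : ℕ) : ℝ[X]))
      = (n.choose (k + 1) * (x ^ (k + 1) * y ^ (n - (k + 1))) : ℝ) •
          (X ^ (k + 1) * (1 - X) ^ m) := by
    simp only [Polynomial.smul_eq_C_mul, mul_pow, map_mul, map_pow, map_natCast]; ring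
  rw [this, map_smul, jump_X_pow_mul, smul_eq_mul]
  ring

theorem gain_add_pow {lam : ℝ} (hl : 0 < lam) (n : ℕ) (x : ℝ) :
    gain hl ((C x + X) ^ n)
      = ∑ k ∈ Finset.range n, n.choose (k + 1) * Real.Gamma ((k + 1 : ℕ) : ℝ)
          * ((1 / lam) ^ (k + 1) * x ^ (n - (k + 1))) := by
  rw [add_comm (C x), add_pow, Finset.sum_range_succ', map_add, map_sum]
  have h0 : (X : ℝ[X]) ^ 0 * C x ^ (n - 0) * ((n.choose 0 : ℕ) : ℝ[X]) = C (x ^ n) := by simp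
  rw [h0, gain_C, add_zero]
  refine Finset.sum_congr rfl fun k _ => ?_
  have : (X : ℝ[X]) ^ (k + 1) * C x ^ (n - (k + 1)) * ((n.choose (k + 1) : ℕ) : ℝ[X])
      = (n.choose (k + 1) * x ^ (n - (k + 1)) : ℝ) • X ^ (k + 1) := by
    simp only [Polynomial.smul_eq_C_mul, map_mul, map_pow, map_natCast]; ring
  rw [this, map_smul, gain_X_pow, smul_eq_mul]
  push_cast
  ring

/-! ### The generator along polynomial paths -/

variable {N : ℕ}

theorem intervalIntegral_jump {s : ℝ} (hs : 0 < s) {y : ℝ} (hy : 0 < y) (p : ℝ[X]) :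
    ∫ a in (0 : ℝ)..y, (1 / a) * (1 - a / y) ^ (2 * s - 1) * (p.eval a - p.eval 0)
      = jump hs (p.comp (C y * X)) := by
  have h := intervalIntegral.integral_comp_div (a := 0) (b := y)
    (fun b => y⁻¹ * ((1 - b) ^ (2 * s - 1) * (p.comp (C y * X)).divX.eval b)) hy.ne'
  rw [zero_div, div_self hy.ne', intervalIntegral.integral_const_mul (a := 0) (b := 1),
    smul_eq_mul, mul_inv_cancel_left₀ hy.ne'] at h
  change _ = ∫ b in (0 : ℝ)..1, _
  rw [← h]
  refine intervalIntegral.integral_congr_ae ?_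
  refine ae_of_all _ fun a ha => ?_
  rw [Set.uIoc_of_le hy.le] at ha
  have ha' : a ≠ 0 := ne_of_gt ha.1
  rw [eval_divX _ (div_ne_zero ha' hy.ne')]
  simp only [eval_comp, eval_mul, eval_C, eval_X, mul_zero]
  rw [mul_div_cancel₀ _ hy.ne']
  field_simp

theorem transfer_eq_jump {s : ℝ} (hs : 0 < s) (i j : Fin N) (f : (Fin N → ℝ) → ℝ) (y : Fin N → ℝ)
    (hy : 0 < y i) (p : ℝ[X])
    (hp : ∀ a, f (y - Pi.single i a + Pi.single j a) = p.eval a) :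
    transfer s i j f y = jump hs (p.comp (C (y i) * X)) := by
  rw [← intervalIntegral_jump hs hy, transfer]
  have h0 := hp 0
  simp only [Pi.single_zero, sub_zero, add_zero] at h0
  simp only [hp, h0]

theorem reservoir_eq {s lam : ℝ} (hs : 0 < s) (hl : 0 < lam) (i : Fin N) (f : (Fin N → ℝ) → ℝ)
    (y : Fin N → ℝ) (hy : 0 < y i) (p : ℝ[X]) (hp : ∀ a, f (y + Pi.single i a) = p.eval a) :
    reservoir s lam i f y = jump hs (p.comp (C (-y i) * X)) + gain hl p := by
  have h0 := hp 0
  simp only [Pi.single_zero, add_zero] at h0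
  have hm : ∀ a, f (y - Pi.single i a) = (p.comp (-X)).eval a := by
    intro a
    rw [eval_comp, eval_neg, eval_X, ← hp (-a), Pi.single_neg, sub_eq_add_neg]
  have h1 : p.comp (C (-y i) * X) = (p.comp (-X)).comp (C (y i) * X) := by
    rw [comp_assoc]; simp
  rw [h1, ← intervalIntegral_jump hs hy, reservoir]
  congr 1
  · simp only [hm, h0]
    simp [eval_comp]
  · refine setIntegral_congr_fun measurableSet_Ioi fun a ha => ?_
    rw [eval_divX _ (ne_of_gt ha)]
    simp only [hp, h0]
    ring

/-- The polynomial `a ↦ p(y + a v)`. -/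
noncomputable def linePoly (p : MvPolynomial (Fin N) ℝ) (y v : Fin N → ℝ) : ℝ[X] :=
  MvPolynomial.aeval (fun l => C (y l) + C (v l) * X) p

theorem eval_linePoly (p : MvPolynomial (Fin N) ℝ) (y v : Fin N → ℝ) (a : ℝ) :
    (linePoly p y v).eval a = MvPolynomial.eval (y + a • v) p := by
  unfold linePoly
  induction p using MvPolynomial.induction_on with
  | C r => simp
  | add p q hp hq => simp [hp, hq]
  | mul_X p i hp => simp [hp]; ring_nf; simp

theorem transfer_eval {s : ℝ} (hs : 0 < s) (i j : Fin N) (p : MvPolynomial (Fin N) ℝ)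
    (y : Fin N → ℝ) (hy : 0 < y i) :
    transfer s i j (fun x => MvPolynomial.eval x p) y
      = jump hs ((linePoly p y (Pi.single j 1 - Pi.single i 1)).comp (C (y i) * X)) := by
  refine transfer_eq_jump hs i j _ y hy _ fun a => ?_
  rw [eval_linePoly, smul_sub, ← Pi.single_smul', ← Pi.single_smul']
  simp only [smul_eq_mul, mul_one]
  congr 1
  congr 1
  abel

theorem reservoir_eval {s lam : ℝ} (hs : 0 < s) (hl : 0 < lam) (i : Fin N)
    (p : MvPolynomial (Fin N) ℝ) (y : Fin N → ℝ) (hy : 0 < y i) :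
    reservoir s lam i (fun x => MvPolynomial.eval x p) y
      = jump hs ((linePoly p y (Pi.single i 1)).comp (C (-y i) * X))
        + gain hl (linePoly p y (Pi.single i 1)) := by
  refine reservoir_eq hs hl i _ y hy _ fun a => ?_
  rw [eval_linePoly, ← Pi.single_smul']
  simp

theorem linePoly_add (p q : MvPolynomial (Fin N) ℝ) (y v : Fin N → ℝ) :
    linePoly (p + q) y v = linePoly p y v + linePoly q y v := by simp [linePoly]

theorem linePoly_smul (c : ℝ) (p : MvPolynomial (Fin N) ℝ) (y v : Fin N → ℝ) :
    linePoly (c • p) y v = c • linePoly p y v := by simp [linePoly]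

theorem transfer_add {s : ℝ} (hs : 0 < s) (i j : Fin N) (p q : MvPolynomial (Fin N) ℝ)
    (y : Fin N → ℝ) (hy : 0 < y i) :
    transfer s i j (fun x => MvPolynomial.eval x (p + q)) y
      = transfer s i j (fun x => MvPolynomial.eval x p) y
        + transfer s i j (fun x => MvPolynomial.eval x q) y := by
  simp only [transfer_eval hs i j _ y hy]
  simp only [linePoly_add, add_comp, map_add]

theorem transfer_smul {s : ℝ} (hs : 0 < s) (i j : Fin N) (c : ℝ) (p : MvPolynomial (Fin N) ℝ)
    (y : Fin N → ℝ) (hy : 0 < y i) :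
    transfer s i j (fun x => MvPolynomial.eval x (c • p)) y
      = c * transfer s i j (fun x => MvPolynomial.eval x p) y := by
  simp only [transfer_eval hs i j _ y hy, linePoly_smul, smul_comp, map_smul, smul_eq_mul]

theorem generator_add {s lamL lamR : ℝ} (hs : 0 < s) (hL : 0 < lamL) (hR : 0 < lamR)
    (p q : MvPolynomial (Fin N) ℝ) (y : Fin N → ℝ) (hy : ∀ i, 0 < y i) :
    generator s lamL lamR (fun x => MvPolynomial.eval x (p + q)) y
      = generator s lamL lamR (fun x => MvPolynomial.eval x p) y
        + generator s lamL lamR (fun x => MvPolynomial.eval x q) y := by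
  simp only [generator, transfer_eval hs _ _ _ y (hy _), reservoir_eval hs hL _ _ y (hy _),
    reservoir_eval hs hR _ _ y (hy _)]
  simp only [linePoly_add, add_comp, map_add]
  have aux : ∀ (P : Prop) [Decidable P] (a b : ℝ),
      (if P then a + b else 0) = (if P then a else 0) + (if P then b else 0) := by
    intro P _ a b; split_ifs <;> simp
  simp only [aux, Finset.sum_add_distrib]
  ring

theorem generator_smul {s lamL lamR : ℝ} (hs : 0 < s) (hL : 0 < lamL) (hR : 0 < lamR)
    (c : ℝ) (p : MvPolynomial (Fin N) ℝ) (y : Fin N → ℝ) (hy : ∀ i, 0 < y i) :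
    generator s lamL lamR (fun x => MvPolynomial.eval x (c • p)) y
      = c * generator s lamL lamR (fun x => MvPolynomial.eval x p) y := by
  simp only [generator, transfer_eval hs _ _ _ y (hy _), reservoir_eval hs hL _ _ y (hy _),
    reservoir_eval hs hR _ _ y (hy _), linePoly_smul, smul_comp, map_smul, smul_eq_mul]
  simp only [mul_add, Finset.mul_sum, mul_ite, mul_zero]

end HeatConduction

namespace HeatConduction

open Polynomial

variable {N : ℕ}

/-! ### The dual process -/

/-- The Pochhammer symbol `(2s)_n`, the `n`-th moment of the Gamma distribution. -/
noncomputable def rising (s : ℝ) (n : ℕ) : ℝ := Real.Gamma (2 * s + n) / Real.Gamma (2 * s)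

theorem rising_pos {s : ℝ} (hs : 0 < s) (n : ℕ) : 0 < rising s n :=
  div_pos (Real.Gamma_pos_of_pos (by positivity)) (Real.Gamma_pos_of_pos (by positivity))

theorem rising_zero {s : ℝ} (hs : 0 < s) : rising s 0 = 1 := by
  have := Real.Gamma_pos_of_pos (s := 2 * s) (by positivity)
  simp [rising, this.ne']

theorem rising_succ {s : ℝ} (hs : 0 < s) (n : ℕ) :
    rising s (n + 1) = (2 * s + n) * rising s n := by
  unfold rising
  rw [show 2 * s + ((n + 1 : ℕ) : ℝ) = (2 * s + n) + 1 by push_cast; ring,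
    Real.Gamma_add_one (by positivity)]
  ring

theorem betaCoeff_rising {s : ℝ} (hs : 0 < s) {k m n : ℕ} (h : k ≤ n) :
    betaCoeff s k m * rising s (m + k) * rising s (n - k)
      = betaCoeff s k (n - k) * rising s m * rising s n := by
  obtain ⟨l, rfl⟩ := Nat.exists_eq_add_of_le h
  have h0 := Real.Gamma_pos_of_pos (s := 2 * s) (by positivity)
  have h1 := Real.Gamma_pos_of_pos (s := 2 * s + m + k) (by positivity)
  have h2 := Real.Gamma_pos_of_pos (s := 2 * s + l + k) (by positivity)
  simp only [betaCoeff, rising, Nat.add_sub_cancel_left]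
  push_cast
  rw [show 2 * s + ((m : ℝ) + k) = 2 * s + m + k by ring,
    show 2 * s + ((k : ℝ) + l) = 2 * s + l + k by ring]
  field_simp

theorem gamma_div_rising {s : ℝ} (hs : 0 < s) {k n : ℕ} (h : k ≤ n) :
    Real.Gamma k * rising s (n - k) = betaCoeff s k (n - k) * rising s n := by
  obtain ⟨l, rfl⟩ := Nat.exists_eq_add_of_le h
  have h0 := Real.Gamma_pos_of_pos (s := 2 * s) (by positivity)
  have h2 := Real.Gamma_pos_of_pos (s := 2 * s + l + k) (by positivity)
  simp only [betaCoeff, rising, Nat.add_sub_cancel_left]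
  push_cast
  rw [show 2 * s + ((k : ℝ) + l) = 2 * s + l + k by ring]
  field_simp

/-- The duality function `∏ yₗ^{ξₗ} / (2s)_{ξₗ}`. -/
noncomputable def dualFun (s : ℝ) (ξ : Fin N → ℕ) (y : Fin N → ℝ) : ℝ :=
  ∏ l, (rising s (ξ l))⁻¹ * y l ^ ξ l

/-- The duality function as a polynomial. -/
noncomputable def dualPoly (s : ℝ) (ξ : Fin N → ℕ) : MvPolynomial (Fin N) ℝ :=
  ∏ l, MvPolynomial.C (rising s (ξ l))⁻¹ * MvPolynomial.X l ^ ξ l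

theorem eval_dualPoly (s : ℝ) (ξ : Fin N → ℕ) (y : Fin N → ℝ) :
    MvPolynomial.eval y (dualPoly s ξ) = dualFun s ξ y := by
  simp [dualPoly, dualFun, map_prod]

/-- The configuration obtained from `ξ` by moving `k` particles from `j` to `i`. -/
def hop (ξ : Fin N → ℕ) (i j : Fin N) (k : ℕ) : Fin N → ℕ :=
  Function.update (Function.update ξ j (ξ j - k)) i (ξ i + k)

/-- The part of the dual generator moving particles from `j` to `i`. -/
noncomputable def dualExchange (s : ℝ) (M : (Fin N → ℕ) → ℝ) (ξ : Fin N → ℕ) (i j : Fin N) : ℝ :=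
  ∑ k ∈ Finset.range (ξ j), dualRate s (k + 1) (ξ j) * (M (hop ξ i j (k + 1)) - M ξ)

/-- The part of the dual generator absorbing particles from `i` in a reservoir with
temperature `T`. -/
noncomputable def dualAbsorb (s T : ℝ) (M : (Fin N → ℕ) → ℝ) (ξ : Fin N → ℕ) (i : Fin N) : ℝ :=
  ∑ k ∈ Finset.range (ξ i), dualRate s (k + 1) (ξ i) *
    (T ^ (k + 1) * M (Function.update ξ i (ξ i - (k + 1))) - M ξ)

/-- The generator of the dual process, with the absorbed particles replaced by powers of the
temperatures of the reservoirs. -/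
noncomputable def dualGenerator (s TL TR : ℝ) (M : (Fin N → ℕ) → ℝ) (ξ : Fin N → ℕ) : ℝ :=
  (∑ i : Fin N, if (i : ℕ) = 0 then dualAbsorb s TL M ξ i else 0) +
  (∑ i : Fin N, ∑ j : Fin N,
    if (i : ℕ) + 1 = (j : ℕ) then dualExchange s M ξ i j + dualExchange s M ξ j i else 0) +
  (∑ i : Fin N, if (i : ℕ) + 1 = N then dualAbsorb s TR M ξ i else 0)

@[to_additive]
theorem prod_split_single {ι R : Type*} [Fintype ι] [DecidableEq ι] [CommMonoid R] (g : ι → R) (i : ι) :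
    ∏ l, g l = g i * ∏ l ∈ Finset.univ.erase i, g l :=
  (Finset.mul_prod_erase _ _ (Finset.mem_univ i)).symm

@[to_additive]
theorem prod_split_two {ι R : Type*} [Fintype ι] [DecidableEq ι] [CommMonoid R] (g : ι → R)
    {i j : ι} (hij : i ≠ j) :
    ∏ l, g l = g i * (g j * ∏ l ∈ (Finset.univ.erase i).erase j, g l) := by
  rw [Finset.mul_prod_erase _ _ (Finset.mem_erase.2 ⟨hij.symm, Finset.mem_univ j⟩),
    Finset.mul_prod_erase _ _ (Finset.mem_univ i)]

theorem hop_apply_target (ξ : Fin N → ℕ) (i j : Fin N) (k : ℕ) : hop ξ i j k i = ξ i + k := by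
  simp [hop]

theorem hop_apply_source (ξ : Fin N → ℕ) {i j : Fin N} (hij : i ≠ j) (k : ℕ) :
    hop ξ i j k j = ξ j - k := by
  simp [hop, Function.update_of_ne hij.symm]

theorem hop_apply_of_ne (ξ : Fin N → ℕ) {i j l : Fin N} (hi : l ≠ i) (hj : l ≠ j) (k : ℕ) :
    hop ξ i j k l = ξ l := by
  simp [hop, hi, hj]

theorem transfer_dualFun {s : ℝ} (hs : 0 < s) {i j : Fin N} (hij : i ≠ j) (ξ : Fin N → ℕ)
    (y : Fin N → ℝ) (hy : 0 < y i) :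
    transfer s i j (dualFun s ξ) y
      = ∑ k ∈ Finset.range (ξ j), dualRate s (k + 1) (ξ j) * dualFun s (hop ξ i j (k + 1)) y
        - exitRate s (ξ i) * dualFun s ξ y := by
  set rest : ℝ := ∏ l ∈ (Finset.univ.erase i).erase j, (rising s (ξ l))⁻¹ * y l ^ ξ l with hrest
  have hoff : ∀ l ∈ (Finset.univ.erase i).erase j, l ≠ i ∧ l ≠ j := fun l hl => by
    simp only [Finset.mem_erase] at hl
    exact ⟨hl.2.1, hl.1⟩
  set c : ℝ := rest * (rising s (ξ i))⁻¹ * (rising s (ξ j))⁻¹ with hc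
  have hp : ∀ a, dualFun s ξ (y - Pi.single i a + Pi.single j a)
      = (C c * ((C (y i) - X) ^ ξ i * (C (y j) + X) ^ ξ j)).eval a := by
    intro a
    rw [dualFun, prod_split_two _ hij]
    have : ∏ l ∈ (Finset.univ.erase i).erase j, ((rising s (ξ l))⁻¹ *
        (y - Pi.single i a + Pi.single j a : Fin N → ℝ) l ^ ξ l) = rest := by
      refine Finset.prod_congr rfl fun l hl => ?_
      obtain ⟨h1, h2⟩ := hoff l hl
      simp [Pi.single_eq_of_ne h1, Pi.single_eq_of_ne h2]
    rw [this]
    simp only [Pi.add_apply, Pi.sub_apply, Pi.single_eq_same, Pi.single_eq_of_ne hij,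
      Pi.single_eq_of_ne hij.symm, eval_mul, eval_C, eval_pow, eval_sub, eval_add, eval_X, hc]
    ring
  rw [transfer_eq_jump hs i j _ y hy _ hp]
  have h1 : (C c * ((C (y i) - X) ^ ξ i * (C (y j) + X) ^ ξ j)).comp (C (y i) * X)
      = (c * y i ^ ξ i) • ((1 - X) ^ ξ i * (C (y j) + C (y i) * X) ^ ξ j) := by
    simp only [mul_comp, C_comp, pow_comp, sub_comp, add_comp, X_comp, Polynomial.smul_eq_C_mul,
      map_mul, map_pow]
    rw [show C (y i) - C (y i) * X = C (y i) * (1 - X : ℝ[X]) by ring, mul_pow]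
    ring
  rw [h1, map_smul, jump_exchange, smul_eq_mul, mul_sub, Finset.mul_sum]
  congr 1
  · refine Finset.sum_congr rfl fun k hk => ?_
    have hk' : k + 1 ≤ ξ j := Finset.mem_range.1 hk
    have hD : dualFun s (hop ξ i j (k + 1)) y = (rising s (ξ i + (k + 1)))⁻¹ * y i ^ (ξ i + (k + 1))
        * ((rising s (ξ j - (k + 1)))⁻¹ * y j ^ (ξ j - (k + 1)) * rest) := by
      rw [dualFun, prod_split_two _ hij, hop_apply_target, hop_apply_source _ hij]
      congr 2
      refine Finset.prod_congr rfl fun l hl => ?_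
      obtain ⟨h1, h2⟩ := hoff l hl
      rw [hop_apply_of_ne _ h1 h2]
    have hb := betaCoeff_rising hs (m := ξ i) hk'
    have r1 := rising_pos hs (ξ i)
    have r2 := rising_pos hs (ξ j)
    have r3 := rising_pos hs (ξ i + (k + 1))
    have r4 := rising_pos hs (ξ j - (k + 1))
    have hb' : betaCoeff s (k + 1) (ξ i) * (rising s (ξ i))⁻¹ * (rising s (ξ j))⁻¹
        = betaCoeff s (k + 1) (ξ j - (k + 1)) * (rising s (ξ i + (k + 1)))⁻¹
          * (rising s (ξ j - (k + 1)))⁻¹ := by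
      field_simp
      linear_combination hb
    rw [hD, dualRate, hc]
    linear_combination ((ξ j).choose (k + 1) : ℝ) * y i ^ (ξ i + (k + 1)) * y j ^ (ξ j - (k + 1))
      * rest * hb'
  · rw [dualFun, prod_split_two _ hij, ← hrest, hc]
    ring

theorem reservoir_dualFun {s lam : ℝ} (hs : 0 < s) (hl : 0 < lam) (i : Fin N) (ξ : Fin N → ℕ)
    (y : Fin N → ℝ) (hy : 0 < y i) :
    reservoir s lam i (dualFun s ξ) y = dualAbsorb s (1 / lam) (fun η => dualFun s η y) ξ i := by
  set rest : ℝ := ∏ l ∈ Finset.univ.erase i, (rising s (ξ l))⁻¹ * y l ^ ξ l with hrest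
  set c : ℝ := rest * (rising s (ξ i))⁻¹ with hc
  have hp : ∀ a, dualFun s ξ (y + Pi.single i a) = (C c * (C (y i) + X) ^ ξ i).eval a := by
    intro a
    rw [dualFun, prod_split_single _ i]
    have : ∏ l ∈ Finset.univ.erase i, ((rising s (ξ l))⁻¹ *
        (y + Pi.single i a : Fin N → ℝ) l ^ ξ l) = rest := by
      refine Finset.prod_congr rfl fun l hl => ?_
      simp [Pi.single_eq_of_ne (Finset.ne_of_mem_erase hl)]
    rw [this]
    simp only [Pi.add_apply, Pi.single_eq_same, eval_mul, eval_C, eval_pow, eval_add, eval_X, hc]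
    ring
  rw [reservoir_eq hs hl i _ y hy _ hp]
  have h1 : (C c * (C (y i) + X) ^ ξ i).comp (C (-y i) * X)
      = (c * y i ^ ξ i) • (1 - X) ^ ξ i := by
    simp only [mul_comp, C_comp, pow_comp, add_comp, X_comp, Polynomial.smul_eq_C_mul,
      map_mul, map_pow, map_neg]
    rw [show C (y i) + -C (y i) * X = C (y i) * (1 - X : ℝ[X]) by ring, mul_pow]
    ring
  have hD0 : dualFun s ξ y = c * y i ^ ξ i := by
    rw [dualFun, prod_split_single _ i, ← hrest, hc]; ring
  rw [h1, map_smul, jump_one_sub_pow, ← Polynomial.smul_eq_C_mul, map_smul, gain_add_pow,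
    dualAbsorb]
  simp only [smul_eq_mul, mul_sub, Finset.sum_sub_distrib]
  rw [← Finset.sum_mul, ← exitRate, ← hD0, mul_neg, neg_add_eq_sub, mul_comm (exitRate s _),
    Finset.mul_sum]
  congr 1
  refine Finset.sum_congr rfl fun k hk => ?_
  have hk' : k + 1 ≤ ξ i := Finset.mem_range.1 hk
  have hD : dualFun s (Function.update ξ i (ξ i - (k + 1))) y
      = (rising s (ξ i - (k + 1)))⁻¹ * y i ^ (ξ i - (k + 1)) * rest := by
    rw [dualFun, prod_split_single _ i, Function.update_self]
    congr 1
    refine Finset.prod_congr rfl fun l hl => ?_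
    rw [Function.update_of_ne (Finset.ne_of_mem_erase hl)]
  have hb := gamma_div_rising hs hk'
  have r2 := rising_pos hs (ξ i)
  have r4 := rising_pos hs (ξ i - (k + 1))
  have hb' : Real.Gamma ((k + 1 : ℕ) : ℝ) * (rising s (ξ i))⁻¹
      = betaCoeff s (k + 1) (ξ i - (k + 1)) * (rising s (ξ i - (k + 1)))⁻¹ := by
    field_simp
    linear_combination hb
  rw [hD, dualRate, hc]
  linear_combination ((ξ i).choose (k + 1) : ℝ) * (1 / lam) ^ (k + 1) * y i ^ (ξ i - (k + 1))
      * rest * hb'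

theorem transfer_add_transfer_dualFun {s : ℝ} (hs : 0 < s) {i j : Fin N} (hij : i ≠ j)
    (ξ : Fin N → ℕ) (y : Fin N → ℝ) (hy : ∀ l, 0 < y l) :
    transfer s i j (dualFun s ξ) y + transfer s j i (dualFun s ξ) y
      = dualExchange s (fun η => dualFun s η y) ξ i j
        + dualExchange s (fun η => dualFun s η y) ξ j i := by
  rw [transfer_dualFun hs hij ξ y (hy i), transfer_dualFun hs hij.symm ξ y (hy j)]
  simp only [dualExchange, mul_sub, Finset.sum_sub_distrib]
  rw [← Finset.sum_mul, ← Finset.sum_mul, ← exitRate, ← exitRate]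
  ring

/-- Duality: the generator acts on the duality functions through the dual generator. -/
theorem generator_dualFun {s lamL lamR : ℝ} (hs : 0 < s) (hL : 0 < lamL) (hR : 0 < lamR)
    (ξ : Fin N → ℕ) (y : Fin N → ℝ) (hy : ∀ l, 0 < y l) :
    generator s lamL lamR (dualFun s ξ) y
      = dualGenerator s (1 / lamL) (1 / lamR) (fun η => dualFun s η y) ξ := by
  unfold generator dualGenerator
  congr 1
  · congr 1
    · simp only [reservoir_dualFun hs hL _ ξ y (hy _)]
    · refine Finset.sum_congr rfl fun i _ => Finset.sum_congr rfl fun j _ => ?_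
      split_ifs with h
      · refine transfer_add_transfer_dualFun hs ?_ ξ y hy
        rintro rfl
        omega
      · rfl
  · simp only [reservoir_dualFun hs hR _ ξ y (hy _)]

end HeatConduction

namespace HeatConduction

variable {N : ℕ}

/-! ### Uniqueness of the solution of the dual equation -/

theorem sum_hop (w : Fin N → ℕ) (ξ : Fin N → ℕ) {i j : Fin N} (hij : i ≠ j) {k : ℕ} (hk : k ≤ ξ j) :
    ∑ l, w l * hop ξ i j k l + w j * k = ∑ l, w l * ξ l + w i * k := by
  rw [sum_split_two _ hij, sum_split_two (fun l => w l * ξ l) hij, hop_apply_target,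
    hop_apply_source _ hij]
  have : ∑ l ∈ (Finset.univ.erase i).erase j, w l * hop ξ i j k l
      = ∑ l ∈ (Finset.univ.erase i).erase j, w l * ξ l := by
    refine Finset.sum_congr rfl fun l hl => ?_
    simp only [Finset.mem_erase] at hl
    rw [hop_apply_of_ne _ hl.2.1 hl.1]
  rw [this]
  obtain ⟨r, hr⟩ := Nat.exists_eq_add_of_le hk
  rw [hr, Nat.add_sub_cancel_left]
  ring

theorem degree_hop (ξ : Fin N → ℕ) {i j : Fin N} (hij : i ≠ j) {k : ℕ} (hk : k ≤ ξ j) :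
    ∑ l, hop ξ i j k l = ∑ l, ξ l := by
  simpa using sum_hop (fun _ => 1) ξ hij hk

theorem degree_update (ξ : Fin N → ℕ) (i : Fin N) {k : ℕ} (hk : k ≤ ξ i) :
    ∑ l, Function.update ξ i (ξ i - k) l + k = ∑ l, ξ l := by
  rw [sum_split_single _ i, sum_split_single ξ i, Function.update_self]
  have : ∑ l ∈ Finset.univ.erase i, Function.update ξ i (ξ i - k) l
      = ∑ l ∈ Finset.univ.erase i, ξ l := by
    refine Finset.sum_congr rfl fun l hl => ?_
    rw [Function.update_of_ne (Finset.ne_of_mem_erase hl)]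
  omega

theorem dualGenerator_sub (s TL TR : ℝ) (M₁ M₂ : (Fin N → ℕ) → ℝ) (ξ : Fin N → ℕ) :
    dualGenerator s TL TR (M₁ - M₂) ξ = dualGenerator s TL TR M₁ ξ - dualGenerator s TL TR M₂ ξ := by
  have h1 : ∀ T i, dualAbsorb s T (M₁ - M₂) ξ i = dualAbsorb s T M₁ ξ i - dualAbsorb s T M₂ ξ i := by
    intro T i
    simp only [dualAbsorb, ← Finset.sum_sub_distrib, Pi.sub_apply]
    exact Finset.sum_congr rfl fun k _ => by ring
  have h2 : ∀ i j, dualExchange s (M₁ - M₂) ξ i j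
      = dualExchange s M₁ ξ i j - dualExchange s M₂ ξ i j := by
    intro i j
    simp only [dualExchange, ← Finset.sum_sub_distrib, Pi.sub_apply]
    exact Finset.sum_congr rfl fun k _ => by ring
  have aux : ∀ (P : Prop) [Decidable P] (a b : ℝ),
      (if P then a - b else 0) = (if P then a else 0) - (if P then b else 0) := by
    intro P _ a b; split_ifs <;> simp
  have aux2 : ∀ a b c d : ℝ, a - b + (c - d) = (a + c) - (b + d) := fun a b c d => by ring
  simp only [dualGenerator, h1, h2, aux2, aux, Finset.sum_sub_distrib]

theorem dual_maximum_principle {s TL TR : ℝ} (hs : 0 < s) (hN : 1 ≤ N) {d : ℕ} (hd : 0 < d)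
    (M : (Fin N → ℕ) → ℝ) (hlow : ∀ ξ, ∑ l, ξ l < d → M ξ = 0)
    (hM : ∀ ξ, ∑ l, ξ l = d → dualGenerator s TL TR M ξ = 0) (ξ : Fin N → ℕ) (hξ : ∑ l, ξ l = d) :
    M ξ ≤ 0 := by
  classical
  by_contra! hpos
  set A : Finset (Fin N → ℕ) := Finset.univ.piAntidiag d with hA
  have hmem : ∀ η : Fin N → ℕ, η ∈ A ↔ ∑ l, η l = d := fun η => by
    simp [hA, Finset.mem_piAntidiag]
  obtain ⟨η₀, hη₀, hmax⟩ := A.exists_max_image M ⟨ξ, (hmem ξ).2 hξ⟩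
  obtain ⟨η, hη, hmin⟩ := (A.filter fun η => M η = M η₀).exists_min_image
    (fun η => ∑ l : Fin N, (l : ℕ) * η l) ⟨η₀, by simp [hη₀]⟩
  simp only [Finset.mem_filter] at hη hmin
  have hηd : ∑ l, η l = d := (hmem η).1 hη.1
  have hm : 0 < M η := hη.2 ▸ hpos.trans_le (hmax ξ ((hmem ξ).2 hξ))
  have hle : ∀ ζ : Fin N → ℕ, ∑ l, ζ l = d → M ζ ≤ M η := fun ζ hζ =>
    hη.2 ▸ hmax ζ ((hmem ζ).2 hζ)
  have hex : ∀ i j : Fin N, i ≠ j → dualExchange s M η i j ≤ 0 := by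
    intro i j hij
    refine Finset.sum_nonpos fun k hk => ?_
    have hk' := Finset.mem_range.1 hk
    refine mul_nonpos_of_nonneg_of_nonpos (dualRate_pos hs hk').le (sub_nonpos.2 (hle _ ?_))
    rw [degree_hop _ hij (by omega), hηd]
  have hab : ∀ (T : ℝ) (i : Fin N), dualAbsorb s T M η i = - (exitRate s (η i) * M η) := by
    intro T i
    rw [dualAbsorb, exitRate, Finset.sum_mul, ← Finset.sum_neg_distrib]
    refine Finset.sum_congr rfl fun k hk => ?_
    have hk' := Finset.mem_range.1 hk
    have := degree_update η i (k := k + 1) (by omega)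
    rw [hlow _ (by omega)]
    ring
  have hex0 : ∀ n : ℕ, 0 ≤ exitRate s n := fun n => by
    rcases Nat.eq_zero_or_pos n with rfl | h
    · simp [exitRate]
    · exact (exitRate_pos hs h).le
  have hab0 : ∀ (T : ℝ) (i : Fin N), dualAbsorb s T M η i ≤ 0 := fun T i => by
    rw [hab]
    exact neg_nonpos.2 (mul_nonneg (hex0 _) hm.le)
  have hbond : ∀ i j : Fin N, (if (i : ℕ) + 1 = (j : ℕ) then
      dualExchange s M η i j + dualExchange s M η j i else 0) ≤ 0 := by
    intro i j
    split_ifs with h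
    · have hij : i ≠ j := by rintro rfl; omega
      exact add_nonpos (hex i j hij) (hex j i hij.symm)
    · exact le_rfl
  have hA0 : ∀ i : Fin N, (if (i : ℕ) = 0 then dualAbsorb s TL M η i else 0) ≤ 0 := fun i => by
    split_ifs
    exacts [hab0 _ _, le_rfl]
  have hC0 : ∀ i : Fin N, (if (i : ℕ) + 1 = N then dualAbsorb s TR M η i else 0) ≤ 0 := fun i => by
    split_ifs
    exacts [hab0 _ _, le_rfl]
  have hgen := hM η hηd
  unfold dualGenerator at hgen
  have hC := Finset.sum_nonpos fun (i : Fin N) (_ : i ∈ Finset.univ) => hC0 i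
  by_cases hz : 0 < η ⟨0, hN⟩
  · have h1 : (∑ i : Fin N, if (i : ℕ) = 0 then dualAbsorb s TL M η i else 0) < 0 := by
      refine Finset.sum_neg' (fun i _ => hA0 i) ⟨⟨0, hN⟩, Finset.mem_univ _, ?_⟩
      rw [if_pos rfl, hab]
      exact neg_neg_of_pos (mul_pos (exitRate_pos hs hz) hm)
    have h2 := Finset.sum_nonpos fun (i : Fin N) (_ : i ∈ Finset.univ) =>
      Finset.sum_nonpos fun (j : Fin N) (_ : j ∈ Finset.univ) => hbond i j
    linarith
  · obtain ⟨j, hj⟩ : ∃ j, 0 < η j := by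
      by_contra! h
      have : ∑ l, η l = 0 := Finset.sum_eq_zero fun l _ => Nat.le_zero.1 (h l)
      omega
    have hj0 : (j : ℕ) ≠ 0 := fun h => by
      have : j = ⟨0, hN⟩ := Fin.ext h
      exact hz (this ▸ hj)
    set i : Fin N := ⟨j - 1, by omega⟩ with hi
    have hij1 : (i : ℕ) + 1 = j := by simp only [hi]; omega
    have hij : i ≠ j := by
      intro h
      have := congrArg Fin.val h
      omega
    have hlt : M (hop η i j 1) < M η := by
      have hdeg : ∑ l, hop η i j 1 l = d := by rw [degree_hop _ hij (by omega), hηd]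
      refine lt_of_le_of_ne (hle _ hdeg) fun h => ?_
      have h1 := hmin (hop η i j 1) ⟨(hmem _).2 hdeg, h.trans hη.2⟩
      have h2 := sum_hop (fun l => (l : ℕ)) η hij (k := 1) (by omega)
      omega
    have h1 := Finset.sum_nonpos fun (i : Fin N) (_ : i ∈ Finset.univ) => hA0 i
    have h2 : (∑ i : Fin N, ∑ j : Fin N, if (i : ℕ) + 1 = (j : ℕ) then
        dualExchange s M η i j + dualExchange s M η j i else 0) < 0 := by
      refine Finset.sum_neg' (fun i _ => Finset.sum_nonpos fun j _ => hbond i j)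
        ⟨i, Finset.mem_univ _, Finset.sum_neg' (fun j _ => hbond i j) ⟨j, Finset.mem_univ _, ?_⟩⟩
      rw [if_pos hij1]
      refine add_neg_of_neg_of_nonpos (Finset.sum_neg' (fun k hk => ?_)
        ⟨0, Finset.mem_range.2 hj, ?_⟩) (hex j i hij.symm)
      · have hk' := Finset.mem_range.1 hk
        refine mul_nonpos_of_nonneg_of_nonpos (dualRate_pos hs hk').le (sub_nonpos.2 (hle _ ?_))
        rw [degree_hop _ hij (by omega), hηd]
      · exact mul_neg_of_pos_of_neg (dualRate_pos hs hj) (sub_neg.2 hlt)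
    linarith

/-- The solution of the dual equation is determined by its value at the empty configuration. -/
theorem dualGenerator_unique {s TL TR : ℝ} (hs : 0 < s) (hN : 1 ≤ N) {M₁ M₂ : (Fin N → ℕ) → ℝ}
    (h0 : M₁ 0 = M₂ 0) (h₁ : ∀ ξ, dualGenerator s TL TR M₁ ξ = 0)
    (h₂ : ∀ ξ, dualGenerator s TL TR M₂ ξ = 0) : M₁ = M₂ := by
  have key : ∀ d : ℕ, ∀ ξ : Fin N → ℕ, ∑ l, ξ l = d → M₁ ξ = M₂ ξ := by
    intro d
    induction d using Nat.strong_induction_on with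
    | _ d ih =>
      intro ξ hξ
      rcases Nat.eq_zero_or_pos d with rfl | hd
      · have : ξ = 0 := by
          funext l
          exact (Finset.sum_eq_zero_iff.1 hξ) l (Finset.mem_univ l)
        rw [this, h0]
      · have a := dual_maximum_principle (TL := TL) (TR := TR) hs hN hd (M₁ - M₂)
          (fun η hη => sub_eq_zero.2 (ih _ hη η rfl))
          (fun η _ => by rw [dualGenerator_sub, h₁, h₂, sub_zero]) ξ hξ
        have b := dual_maximum_principle (TL := TL) (TR := TR) hs hN hd (M₂ - M₁)
          (fun η hη => sub_eq_zero.2 (ih _ hη η rfl).symm)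
          (fun η _ => by rw [dualGenerator_sub, h₁, h₂, sub_zero]) ξ hξ
        simp only [Pi.sub_apply] at a b
        linarith
  funext ξ
  exact key _ ξ rfl

end HeatConduction

namespace HeatConduction

open Polynomial

variable {N : ℕ}

/-! ### A Lyapunov function -/

theorem jump_mono {s : ℝ} (hs : 0 < s) {p q : ℝ[X]}
    (h : ∀ b ∈ Set.Ioo (0 : ℝ) 1, p.eval b - p.eval 0 ≤ q.eval b - q.eval 0) :
    jump hs p ≤ jump hs q := by
  refine intervalIntegral.integral_mono_on_of_le_Ioo zero_le_one
    (intervalIntegrable_one_sub_rpow hs _) (intervalIntegrable_one_sub_rpow hs _) fun b hb => ?_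
  have hb0 : b ≠ 0 := ne_of_gt hb.1
  refine mul_le_mul_of_nonneg_left ?_ (Real.rpow_nonneg (by linarith [hb.2]) _)
  rw [eval_divX _ hb0, eval_divX _ hb0]
  exact mul_le_mul_of_nonneg_left (h b hb) (by have := hb.1; positivity)

theorem gain_mono {lam : ℝ} (hl : 0 < lam) {p q : ℝ[X]}
    (h : ∀ a, 0 < a → p.eval a - p.eval 0 ≤ q.eval a - q.eval 0) :
    gain hl p ≤ gain hl q := by
  refine setIntegral_mono_on (integrableOn_exp_mul_eval hl _) (integrableOn_exp_mul_eval hl _)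
    measurableSet_Ioi fun a ha => ?_
  have ha' : 0 < a := ha
  refine mul_le_mul_of_nonneg_left ?_ (Real.exp_pos _).le
  rw [eval_divX _ ha'.ne', eval_divX _ ha'.ne']
  exact mul_le_mul_of_nonneg_left (h a ha') (by positivity)

theorem jump_X {s : ℝ} (hs : 0 < s) : jump hs X = 1 / (2 * s) := by
  have h := jump_X_pow_mul hs 0 0
  have hG := Real.Gamma_pos_of_pos (s := 2 * s) (by positivity)
  simp only [zero_add, pow_one, pow_zero, mul_one] at h
  rw [h, betaCoeff]
  simp only [Nat.cast_one, Real.Gamma_one, Nat.cast_zero, add_zero, one_mul]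
  rw [Real.Gamma_add_one (by positivity)]
  field_simp

/-- The weights `(l + 1) (N - l)`, whose discrete Laplacian with zero boundary values is `-2`. -/
noncomputable def weight (N : ℕ) (l : ℕ) : ℝ := (l + 1) * (N - l)

/-- The total energy. -/
def energy (y : Fin N → ℝ) : ℝ := ∑ l, y l

/-- The weighted energy. -/
noncomputable def weightedEnergy (y : Fin N → ℝ) : ℝ := ∑ l : Fin N, weight N l * y l

/-- The Lyapunov function, a polynomial of degree `d + 1`. -/
noncomputable def lyapunov (d : ℕ) (y : Fin N → ℝ) : ℝ := energy y ^ d * weightedEnergy y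

/-- The Lyapunov function as a polynomial. -/
noncomputable def lyapunovPoly (N d : ℕ) : MvPolynomial (Fin N) ℝ :=
  (∑ l, MvPolynomial.X l) ^ d * ∑ l : Fin N, MvPolynomial.C (weight N l) * MvPolynomial.X l

theorem eval_lyapunovPoly (d : ℕ) (y : Fin N → ℝ) :
    MvPolynomial.eval y (lyapunovPoly N d) = lyapunov d y := by
  simp [lyapunovPoly, lyapunov, energy, weightedEnergy, map_sum]

theorem one_le_weight (l : Fin N) : 1 ≤ weight N l := by
  have h : ((l : ℕ) : ℝ) + 1 ≤ N := by exact_mod_cast l.2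
  have h0 : (0 : ℝ) ≤ (l : ℕ) := by positivity
  unfold weight
  nlinarith

theorem weight_le (l : Fin N) : weight N l ≤ N ^ 2 := by
  have h : ((l : ℕ) : ℝ) + 1 ≤ N := by exact_mod_cast l.2
  have h0 : (0 : ℝ) ≤ (l : ℕ) := by positivity
  unfold weight
  nlinarith

theorem energy_pos_le {y : Fin N → ℝ} (hy : ∀ l, 0 < y l) (l : Fin N) : y l ≤ energy y :=
  Finset.single_le_sum (f := y) (fun i _ => (hy i).le) (Finset.mem_univ l)

theorem energy_nonneg {y : Fin N → ℝ} (hy : ∀ l, 0 < y l) : 0 ≤ energy y :=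
  Finset.sum_nonneg fun l _ => (hy l).le

theorem energy_le_weightedEnergy {y : Fin N → ℝ} (hy : ∀ l, 0 < y l) :
    energy y ≤ weightedEnergy y :=
  Finset.sum_le_sum fun l _ => le_mul_of_one_le_left (hy l).le (one_le_weight l)

theorem weightedEnergy_le {y : Fin N → ℝ} (hy : ∀ l, 0 < y l) :
    weightedEnergy y ≤ N ^ 2 * energy y := by
  rw [energy, Finset.mul_sum]
  exact Finset.sum_le_sum fun l _ => mul_le_mul_of_nonneg_right (weight_le l) (hy l).le

theorem energy_add (y v : Fin N → ℝ) : energy (y + v) = energy y + energy v :=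
  Finset.sum_add_distrib

theorem energy_sub (y v : Fin N → ℝ) : energy (y - v) = energy y - energy v :=
  Finset.sum_sub_distrib _ _

theorem energy_single (i : Fin N) (a : ℝ) : energy (Pi.single i a : Fin N → ℝ) = a := by
  simp [energy]

theorem weightedEnergy_add (y v : Fin N → ℝ) :
    weightedEnergy (y + v) = weightedEnergy y + weightedEnergy v := by
  simp [weightedEnergy, mul_add, Finset.sum_add_distrib]

theorem weightedEnergy_sub (y v : Fin N → ℝ) :
    weightedEnergy (y - v) = weightedEnergy y - weightedEnergy v := by
  simp [weightedEnergy, mul_sub, Finset.sum_sub_distrib]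

theorem weightedEnergy_single (i : Fin N) (a : ℝ) :
    weightedEnergy (Pi.single i a : Fin N → ℝ) = weight N i * a := by
  unfold weightedEnergy
  rw [Finset.sum_eq_single i (fun l _ hl => by simp [Pi.single_eq_of_ne hl]) (by simp)]
  simp

theorem transfer_lyapunov {s : ℝ} (hs : 0 < s) (d : ℕ) (i j : Fin N) (y : Fin N → ℝ)
    (hy : 0 < y i) :
    transfer s i j (lyapunov d) y
      = energy y ^ d / (2 * s) * ((weight N j - weight N i) * y i) := by
  have hp : ∀ a, lyapunov d (y - Pi.single i a + Pi.single j a)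
      = (C (energy y ^ d * weightedEnergy y)
          + C (energy y ^ d * (weight N j - weight N i)) * X).eval a := by
    intro a
    simp only [lyapunov, energy_add, energy_sub, energy_single, weightedEnergy_add,
      weightedEnergy_sub, weightedEnergy_single, sub_add_cancel, eval_add, eval_C, eval_mul, eval_X]
    ring
  rw [transfer_eq_jump hs i j _ y hy _ hp]
  simp only [add_comp, C_comp, mul_comp, X_comp]
  rw [map_add, jump_C, ← mul_assoc, ← C_mul, ← Polynomial.smul_eq_C_mul, map_smul, jump_X,
    smul_eq_mul]
  ring

theorem add_pow_sub_pow_mul_le {E a : ℝ} (hE : 0 ≤ E) (ha : 0 ≤ a) (d : ℕ) :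
    ((E + a) ^ d - E ^ d) * E ≤ d * a * (E + a) ^ d := by
  induction d with
  | zero => simp
  | succ d ih =>
    have h1 : a * E ^ d * E ≤ a * (E + a) ^ (d + 1) := by
      rw [mul_assoc, ← pow_succ]
      gcongr
      linarith
    have h2 : (E + a) * (((E + a) ^ d - E ^ d) * E) ≤ (E + a) * (d * a * (E + a) ^ d) :=
      mul_le_mul_of_nonneg_left ih (by positivity)
    push_cast
    calc _ = (E + a) * (((E + a) ^ d - E ^ d) * E) + a * E ^ d * E := by ring
      _ ≤ (E + a) * (d * a * (E + a) ^ d) + a * (E + a) ^ (d + 1) := add_le_add h2 h1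
      _ = _ := by ring

theorem reservoir_lyapunov {s lam : ℝ} (hs : 0 < s) (hl : 0 < lam) (N d : ℕ) :
    ∃ K, 0 ≤ K ∧ ∀ (i : Fin N) (y : Fin N → ℝ), (∀ l, 0 < y l) →
      reservoir s lam i (lyapunov d) y
        ≤ energy y ^ d / (2 * s) * (-(weight N i * y i)) + K * (1 + energy y) ^ d := by
  set c : ℝ := (N ^ 2 : ℝ) * (d + 1) with hc
  refine ⟨|gain hl (C c * (X * (1 + X) ^ d))|, abs_nonneg _, fun i y hy => ?_⟩
  set E := energy y with hE
  set W := weightedEnergy y with hW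
  set g := weight N i with hg
  have hE0 : 0 ≤ E := energy_nonneg hy
  have hEW : E ≤ W := energy_le_weightedEnergy hy
  have hWE : W ≤ N ^ 2 * E := weightedEnergy_le hy
  have hg1 : 1 ≤ g := one_le_weight i
  have hg2 : g ≤ N ^ 2 := weight_le i
  have hgy : g * y i ≤ W :=
    Finset.single_le_sum (f := fun l : Fin N => weight N l * y l)
      (fun l _ => mul_nonneg (zero_le_one.trans (one_le_weight l)) (hy l).le) (Finset.mem_univ i)
  have hp : ∀ a, lyapunov d (y + Pi.single i a) = ((C E + X) ^ d * (C W + C g * X)).eval a := by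
    intro a
    simp [lyapunov, energy_add, energy_single, weightedEnergy_add, weightedEnergy_single, hE, hW, hg]
  rw [reservoir_eq hs hl i _ y (hy i) _ hp]
  refine add_le_add ?_ ?_
  · have h1 : jump hs (((C E + X) ^ d * (C W + C g * X)).comp (C (-y i) * X))
        ≤ jump hs (C (E ^ d * (-(g * y i))) * X) := by
      refine jump_mono hs fun b hb => ?_
      simp only [eval_comp, eval_mul, eval_add, eval_pow, eval_C, eval_X, mul_zero, add_zero,
        sub_zero]
      have h2 : 0 < y i * b := mul_pos (hy i) hb.1
      have h3 : y i * b ≤ y i := mul_le_of_le_one_right (hy i).le hb.2.le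
      have h4 : (E + -y i * b) ^ d ≤ E ^ d :=
        pow_le_pow_left₀ (by linarith [energy_pos_le hy i]) (by linarith) d
      have h5 : 0 ≤ W + g * (-y i * b) := by
        have : g * (y i * b) ≤ g * y i := mul_le_mul_of_nonneg_left h3 (by linarith)
        linarith
      have h6 := mul_le_mul_of_nonneg_right h4 h5
      linarith
    rw [← Polynomial.smul_eq_C_mul (E ^ d * _), map_smul, jump_X, smul_eq_mul] at h1
    refine h1.trans_eq ?_
    ring
  · have h1 : gain hl ((C E + X) ^ d * (C W + C g * X))
        ≤ gain hl (C ((1 + E) ^ d) * (C c * (X * (1 + X) ^ d))) := by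
      refine gain_mono hl fun a ha => ?_
      simp only [eval_mul, eval_add, eval_pow, eval_C, eval_X, eval_one, mul_zero, add_zero,
        zero_mul, sub_zero]
      have h2 := add_pow_sub_pow_mul_le hE0 ha.le d
      have h3 : 0 ≤ (E + a) ^ d - E ^ d :=
        sub_nonneg.2 (pow_le_pow_left₀ hE0 (by linarith) d)
      have h4 : ((E + a) ^ d - E ^ d) * W ≤ N ^ 2 * (d * a * (E + a) ^ d) := by
        calc _ ≤ ((E + a) ^ d - E ^ d) * (N ^ 2 * E) := mul_le_mul_of_nonneg_left hWE h3
          _ = N ^ 2 * (((E + a) ^ d - E ^ d) * E) := by ring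
          _ ≤ _ := mul_le_mul_of_nonneg_left h2 (by positivity)
      have h5 : (E + a) ^ d * (g * a) ≤ (E + a) ^ d * (N ^ 2 * a) := by gcongr
      have h6 : (E + a) ^ d ≤ ((1 + E) * (1 + a)) ^ d :=
        pow_le_pow_left₀ (by positivity) (by nlinarith) d
      calc _ = ((E + a) ^ d - E ^ d) * W + (E + a) ^ d * (g * a) := by ring
        _ ≤ N ^ 2 * (d * a * (E + a) ^ d) + (E + a) ^ d * (N ^ 2 * a) := add_le_add h4 h5
        _ = c * a * (E + a) ^ d := by rw [hc]; ring
        _ ≤ c * a * ((1 + E) * (1 + a)) ^ d := by gcongr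
        _ = _ := by rw [mul_pow]; ring
    rw [← Polynomial.smul_eq_C_mul ((1 + E) ^ d), map_smul, smul_eq_mul] at h1
    rw [mul_comm |_|]
    exact h1.trans (mul_le_mul_of_nonneg_left (le_abs_self _) (by positivity))

theorem sum_ite_succ (i : Fin N) (f : Fin N → ℝ) :
    (∑ j : Fin N, if (i : ℕ) + 1 = (j : ℕ) then f j else 0)
      = if h : (i : ℕ) + 1 < N then f ⟨i + 1, h⟩ else 0 := by
  split_ifs with h
  · rw [Finset.sum_eq_single ⟨i + 1, h⟩]
    · simp
    · intro j _ hj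
      rw [if_neg fun h' => hj (Fin.ext h'.symm)]
    · simp
  · refine Finset.sum_eq_zero fun j _ => if_neg fun h' => h ?_
    have := j.2
    omega

theorem sum_ite_pred (j : Fin N) (f : Fin N → ℝ) :
    (∑ i : Fin N, if (i : ℕ) + 1 = (j : ℕ) then f i else 0)
      = if (j : ℕ) = 0 then 0 else f ⟨j - 1, by omega⟩ := by
  split_ifs with h
  · exact Finset.sum_eq_zero fun i _ => if_neg (by omega)
  · rw [Finset.sum_eq_single ⟨j - 1, by omega⟩]
    · rw [if_pos (by simp only; omega)]
    · intro i _ hi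
      rw [if_neg fun h' => hi (Fin.ext (by simp only; omega))]
    · simp

theorem weight_laplacian (y : Fin N → ℝ) :
    (∑ i : Fin N, if (i : ℕ) = 0 then -(weight N i * y i) else 0) +
    (∑ i : Fin N, ∑ j : Fin N, if (i : ℕ) + 1 = (j : ℕ) then
      (weight N j - weight N i) * y i + (weight N i - weight N j) * y j else 0) +
    (∑ i : Fin N, if (i : ℕ) + 1 = N then -(weight N i * y i) else 0) = -2 * energy y := by
  have aux : ∀ (P : Prop) [Decidable P] (a b : ℝ),
      (if P then a + b else 0) = (if P then a else 0) + (if P then b else 0) := by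
    intro P _ a b; split_ifs <;> simp
  simp only [aux, Finset.sum_add_distrib]
  rw [Finset.sum_comm (f := fun i j : Fin N => if (i : ℕ) + 1 = (j : ℕ) then
    (weight N i - weight N j) * y j else 0)]
  have h1 : ∀ i : Fin N, (∑ j : Fin N, if (i : ℕ) + 1 = (j : ℕ) then
      (weight N j - weight N i) * y i else 0)
      = (weight N (i + 1) - weight N i) * y i + (if (i : ℕ) + 1 = N then weight N i * y i else 0) := by
    intro i
    rw [sum_ite_succ i (fun j => (weight N j - weight N i) * y i)]
    by_cases h : (i : ℕ) + 1 < N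
    · rw [dif_pos h, if_neg h.ne, add_zero]
    · have h' : (i : ℕ) + 1 = N := by have := i.2; omega
      have h0 : weight N (i + 1) = 0 := by rw [h']; simp [weight]
      rw [dif_neg h, if_pos h', h0]
      ring
  have h2 : ∀ j : Fin N, (∑ i : Fin N, if (i : ℕ) + 1 = (j : ℕ) then
      (weight N i - weight N j) * y j else 0)
      = ((j : ℝ) * (N - j + 1) - weight N j) * y j
        + (if (j : ℕ) = 0 then weight N j * y j else 0) := by
    intro j
    rw [sum_ite_pred j (fun i => (weight N i - weight N j) * y j)]
    by_cases h : (j : ℕ) = 0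
    · rw [if_pos h, if_pos h, h]
      simp
    · rw [if_neg h, if_neg h, add_zero]
      obtain ⟨k, hk⟩ := Nat.exists_eq_succ_of_ne_zero h
      simp only [hk, Nat.succ_eq_add_one, Nat.add_sub_cancel, weight]
      push_cast
      ring
  simp only [h1, h2]
  rw [← Finset.sum_add_distrib, ← Finset.sum_add_distrib, ← Finset.sum_add_distrib, energy,
    Finset.mul_sum]
  refine Finset.sum_congr rfl fun i _ => ?_
  have h3 : (weight N (i + 1) - weight N i) + ((i : ℝ) * (N - i + 1) - weight N i) = -2 := by
    simp only [weight]; push_cast; ring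
  have h4 : ∀ (P : Prop) [Decidable P] (a : ℝ), (if P then -a else 0) = -(if P then a else 0) := by
    intro P _ a; split_ifs <;> simp
  rw [h4, h4]
  linear_combination y i * h3

/-- Drift inequality for the Lyapunov function. -/
theorem lyapunov_drift {s lamL lamR : ℝ} (hs : 0 < s) (hL : 0 < lamL) (hR : 0 < lamR) (hN : 1 ≤ N)
    (d : ℕ) : ∃ c K : ℝ, 0 < c ∧ 0 ≤ K ∧ ∀ y : Fin N → ℝ, (∀ l, 0 < y l) →
      generator s lamL lamR (lyapunov d) y ≤ -c * lyapunov d y + K := by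
  obtain ⟨K₁, hK₁, h₁⟩ := reservoir_lyapunov hs hL N d
  obtain ⟨K₂, hK₂, h₂⟩ := reservoir_lyapunov hs hR N d
  have hN' : (0 : ℝ) < N := by exact_mod_cast hN
  set B := N * (K₁ + K₂) with hB
  have hB0 : 0 ≤ B := by positivity
  have hgen : ∀ y : Fin N → ℝ, (∀ l, 0 < y l) → generator s lamL lamR (lyapunov d) y
      ≤ -(energy y ^ (d + 1) / s) + B * (1 + energy y) ^ d := by
    intro y hy
    have hE0 := energy_nonneg hy
    set e := energy y ^ d / (2 * s) with he
    have hP : 0 ≤ (1 + energy y) ^ d := by positivity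
    have bd : ∀ (K lam : ℝ) (P : Fin N → Prop) [DecidablePred P], 0 ≤ K →
        (∀ (i : Fin N) (y : Fin N → ℝ), (∀ l, 0 < y l) → reservoir s lam i (lyapunov d) y
        ≤ energy y ^ d / (2 * s) * (-(weight N i * y i)) + K * (1 + energy y) ^ d) →
        (∑ i : Fin N, if P i then reservoir s lam i (lyapunov d) y else 0)
        ≤ e * (∑ i : Fin N, if P i then -(weight N i * y i) else 0)
          + N * K * (1 + energy y) ^ d := by
      intro K lam P _ hK h
      have : (N : ℝ) * K * (1 + energy y) ^ d = ∑ _i : Fin N, K * (1 + energy y) ^ d := by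
        simp [mul_assoc]
      rw [this, Finset.mul_sum, ← Finset.sum_add_distrib]
      refine Finset.sum_le_sum fun i _ => ?_
      split_ifs
      · exact h i y hy
      · simp only [mul_zero, zero_add]; positivity
    have hbond : (∑ i : Fin N, ∑ j : Fin N, if (i : ℕ) + 1 = (j : ℕ) then
        transfer s i j (lyapunov d) y + transfer s j i (lyapunov d) y else 0)
        = e * (∑ i : Fin N, ∑ j : Fin N, if (i : ℕ) + 1 = (j : ℕ) then
          (weight N j - weight N i) * y i + (weight N i - weight N j) * y j else 0) := by
      simp only [Finset.mul_sum]
      refine Finset.sum_congr rfl fun i _ => Finset.sum_congr rfl fun j _ => ?_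
      rw [transfer_lyapunov hs d i j y (hy i), transfer_lyapunov hs d j i y (hy j)]
      split_ifs
      · rw [he]; ring
      · ring
    have hQ := weight_laplacian y
    have b1 := bd K₁ lamL (fun i => (i : ℕ) = 0) hK₁ h₁
    have b2 := bd K₂ lamR (fun i => (i : ℕ) + 1 = N) hK₂ h₂
    unfold generator
    rw [hbond]
    have : -(energy y ^ (d + 1) / s) = e * (-2 * energy y) := by
      rw [he]; field_simp; ring
    rw [this, ← hQ, hB]
    linarith
  set m : ℝ := max 1 (2 ^ d * B * (2 * s)) with hm
  have hm1 : 1 ≤ m := le_max_left _ _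
  refine ⟨1 / (2 * s * N ^ 2), B * (1 + m) ^ d, by positivity, by positivity, fun y hy => ?_⟩
  have hE0 := energy_nonneg hy
  refine (hgen y hy).trans ?_
  set E := energy y with hE
  have hV : lyapunov d y ≤ N ^ 2 * E ^ (d + 1) := by
    calc lyapunov d y ≤ E ^ d * (N ^ 2 * E) :=
          mul_le_mul_of_nonneg_left (weightedEnergy_le hy) (by positivity)
      _ = _ := by ring
  have hV2 : 1 / (2 * s * N ^ 2) * lyapunov d y ≤ E ^ (d + 1) / (2 * s) := by
    calc _ ≤ 1 / (2 * s * N ^ 2) * (N ^ 2 * E ^ (d + 1)) := by gcongr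
      _ = _ := by field_simp
  have hkey : B * (1 + E) ^ d ≤ E ^ (d + 1) / (2 * s) + B * (1 + m) ^ d := by
    rcases le_total E m with h | h
    · have : B * (1 + E) ^ d ≤ B * (1 + m) ^ d := by gcongr
      have : 0 ≤ E ^ (d + 1) / (2 * s) := by positivity
      linarith
    · have h1 : (1 + E) ^ d ≤ (2 * E) ^ d := pow_le_pow_left₀ (by positivity) (by linarith) d
      have h2 : 2 ^ d * B * (2 * s) ≤ E := (le_max_right _ _).trans h
      have h3 : B * (1 + E) ^ d ≤ E ^ (d + 1) / (2 * s) := by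
        rw [le_div_iff₀ (by positivity)]
        calc B * (1 + E) ^ d * (2 * s) ≤ B * (2 * E) ^ d * (2 * s) := by gcongr
          _ = (2 ^ d * B * (2 * s)) * E ^ d := by rw [mul_pow]; ring
          _ ≤ E * E ^ d := by gcongr
          _ = _ := by ring
      have : 0 ≤ B * (1 + m) ^ d := by positivity
      linarith
  have : E ^ (d + 1) / s = 2 * (E ^ (d + 1) / (2 * s)) := by field_simp
  linarith

end HeatConduction

namespace HeatConduction

variable {N : ℕ}

/-! ### Stationarity of polynomial moments -/

/-- Functions on `Fin N → ℝ` given by a polynomial. -/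
def IsPolyFun (f : (Fin N → ℝ) → ℝ) : Prop :=
  ∃ q : MvPolynomial (Fin N) ℝ, ∀ y, f y = MvPolynomial.eval y q

theorem IsPolyFun.add {f g : (Fin N → ℝ) → ℝ} (hf : IsPolyFun f) (hg : IsPolyFun g) :
    IsPolyFun fun y => f y + g y := by
  obtain ⟨p, hp⟩ := hf
  obtain ⟨q, hq⟩ := hg
  exact ⟨p + q, fun y => by simp [hp, hq]⟩

theorem IsPolyFun.const_mul {f : (Fin N → ℝ) → ℝ} (hf : IsPolyFun f) (c : ℝ) :
    IsPolyFun fun y => c * f y := by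
  obtain ⟨p, hp⟩ := hf
  exact ⟨MvPolynomial.C c * p, fun y => by simp [hp]⟩

theorem IsPolyFun.sub {f g : (Fin N → ℝ) → ℝ} (hf : IsPolyFun f) (hg : IsPolyFun g) :
    IsPolyFun fun y => f y - g y := by
  simpa [sub_eq_add_neg] using hf.add (hg.const_mul (-1))

theorem IsPolyFun.zero : IsPolyFun fun _ : Fin N → ℝ => 0 := ⟨0, fun y => by simp⟩

theorem IsPolyFun.ite {f : (Fin N → ℝ) → ℝ} (hf : IsPolyFun f) (P : Prop) [Decidable P] :
    IsPolyFun fun y => if P then f y else 0 := by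
  split_ifs
  exacts [hf, IsPolyFun.zero]

theorem IsPolyFun.sum {ι : Type*} (t : Finset ι) {f : ι → (Fin N → ℝ) → ℝ}
    (hf : ∀ i, IsPolyFun (f i)) : IsPolyFun fun y => ∑ i ∈ t, f i y := by
  choose q hq using hf
  exact ⟨∑ i ∈ t, q i, fun y => by simp [hq, map_sum]⟩

theorem isPolyFun_dualFun (s : ℝ) (ξ : Fin N → ℕ) : IsPolyFun (dualFun s ξ) :=
  ⟨dualPoly s ξ, fun y => (eval_dualPoly s ξ y).symm⟩

theorem isPolyFun_dualGenerator (s TL TR : ℝ) (ξ : Fin N → ℕ) :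
    IsPolyFun fun y => dualGenerator s TL TR (fun η => dualFun s η y) ξ := by
  have ha : ∀ T i, IsPolyFun fun y => dualAbsorb s T (fun η => dualFun s η y) ξ i := fun T i =>
    IsPolyFun.sum _ fun k => (((isPolyFun_dualFun s _).const_mul _).sub
      (isPolyFun_dualFun s ξ)).const_mul _
  have he : ∀ i j, IsPolyFun fun y => dualExchange s (fun η => dualFun s η y) ξ i j := fun i j =>
    IsPolyFun.sum _ fun k => ((isPolyFun_dualFun s _).sub (isPolyFun_dualFun s ξ)).const_mul _
  exact ((IsPolyFun.sum _ fun i => (ha _ i).ite _).add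
    (IsPolyFun.sum _ fun i => IsPolyFun.sum _ fun j => ((he i j).add (he j i)).ite _)).add
    (IsPolyFun.sum _ fun i => (ha _ i).ite _)

theorem monomial_eq_smul_dualPoly {s : ℝ} (hs : 0 < s) (ξ : Fin N →₀ ℕ) (c : ℝ) :
    MvPolynomial.monomial ξ c = (c * ∏ l, rising s (ξ l)) • dualPoly s ξ := by
  rw [MvPolynomial.monomial_eq, dualPoly, Finset.prod_mul_distrib, MvPolynomial.smul_eq_C_mul,
    ← map_prod, ← mul_assoc, ← map_mul, Finset.prod_inv_distrib, mul_assoc, mul_inv_cancel₀, mul_one,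
    Finsupp.prod_fintype _ _ (by simp)]
  exact Finset.prod_ne_zero_iff.2 fun l _ => (rising_pos hs _).ne'

/-- The generator maps polynomials to polynomials. -/
theorem exists_generator_eq_eval {s lamL lamR : ℝ} (hs : 0 < s) (hL : 0 < lamL) (hR : 0 < lamR)
    (p : MvPolynomial (Fin N) ℝ) : ∃ q : MvPolynomial (Fin N) ℝ, ∀ y : Fin N → ℝ, (∀ l, 0 < y l) →
      generator s lamL lamR (fun x => MvPolynomial.eval x p) y = MvPolynomial.eval y q := by
  induction p using MvPolynomial.induction_on' with
  | add p q hp hq =>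
    obtain ⟨p', hp'⟩ := hp
    obtain ⟨q', hq'⟩ := hq
    exact ⟨p' + q', fun y hy => by rw [generator_add hs hL hR _ _ y hy, hp' y hy, hq' y hy, map_add]⟩
  | monomial ξ c =>
    obtain ⟨q, hq⟩ := (isPolyFun_dualGenerator s (1 / lamL) (1 / lamR) ξ).const_mul
      (c * ∏ l, rising s (ξ l))
    refine ⟨q, fun y hy => ?_⟩
    rw [monomial_eq_smul_dualPoly hs, generator_smul hs hL hR _ _ y hy, ← hq]
    simp only [eval_dualPoly]
    rw [generator_dualFun hs hL hR ξ y hy]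

theorem Config.toReal_pos (z : Config N) (l : Fin N) : 0 < z.toReal l := (z l).2

theorem Config.measurable_toReal : Measurable (Config.toReal : Config N → Fin N → ℝ) :=
  measurable_pi_lambda _ fun i => measurable_subtype_coe.comp (measurable_pi_apply i)

theorem measurable_eval (p : MvPolynomial (Fin N) ℝ) :
    Measurable fun z : Config N => MvPolynomial.eval z.toReal p :=
  (MvPolynomial.continuous_eval p).measurable.comp Config.measurable_toReal

theorem exists_abs_eval_le (p : MvPolynomial (Fin N) ℝ) : ∃ C : ℝ, ∃ d : ℕ, 0 ≤ C ∧
    ∀ y : Fin N → ℝ, (∀ l, 0 < y l) → |MvPolynomial.eval y p| ≤ C * (1 + energy y) ^ d := by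
  induction p using MvPolynomial.induction_on with
  | C r => exact ⟨|r|, 0, abs_nonneg _, fun y _ => by simp⟩
  | add p q hp hq =>
    obtain ⟨C₁, d₁, hC₁, h₁⟩ := hp
    obtain ⟨C₂, d₂, hC₂, h₂⟩ := hq
    refine ⟨C₁ + C₂, max d₁ d₂, by positivity, fun y hy => ?_⟩
    have h1 : 1 ≤ 1 + energy y := by linarith [energy_nonneg hy]
    rw [map_add, add_mul]
    refine (abs_add_le _ _).trans (add_le_add ((h₁ y hy).trans ?_) ((h₂ y hy).trans ?_))
    · exact mul_le_mul_of_nonneg_left (pow_le_pow_right₀ h1 (le_max_left _ _)) hC₁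
    · exact mul_le_mul_of_nonneg_left (pow_le_pow_right₀ h1 (le_max_right _ _)) hC₂
  | mul_X p i hp =>
    obtain ⟨C, d, hC, h⟩ := hp
    refine ⟨C, d + 1, hC, fun y hy => ?_⟩
    have hE := energy_nonneg hy
    rw [map_mul, MvPolynomial.eval_X, abs_mul, abs_of_pos (hy i), pow_succ, ← mul_assoc]
    exact mul_le_mul (h y hy) (by linarith [energy_pos_le hy i]) (hy i).le (by positivity)

theorem lyapunov_nonneg (d : ℕ) {y : Fin N → ℝ} (hy : ∀ l, 0 < y l) : 0 ≤ lyapunov d y :=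
  mul_nonneg (pow_nonneg (energy_nonneg hy) _)
    ((energy_nonneg hy).trans (energy_le_weightedEnergy hy))

theorem exists_abs_eval_le_lyapunov (p : MvPolynomial (Fin N) ℝ) : ∃ C : ℝ, ∃ d : ℕ, 0 ≤ C ∧
    ∀ y : Fin N → ℝ, (∀ l, 0 < y l) → |MvPolynomial.eval y p| ≤ C * (1 + lyapunov d y) := by
  obtain ⟨C, d, hC, h⟩ := exists_abs_eval_le p
  refine ⟨C * 2 ^ d, d, by positivity, fun y hy => (h y hy).trans ?_⟩
  have hE := energy_nonneg hy
  rw [mul_assoc]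
  refine mul_le_mul_of_nonneg_left ?_ hC
  have h1 : (1 + energy y) ^ d ≤ (1 + energy y) ^ (d + 1) :=
    pow_le_pow_right₀ (by linarith) (by omega)
  have h2 := add_pow_le (zero_le_one (α := ℝ)) hE (d + 1)
  have h3 : energy y ^ (d + 1) ≤ lyapunov d y := by
    rw [pow_succ]
    exact mul_le_mul_of_nonneg_left (energy_le_weightedEnergy hy) (by positivity)
  rw [one_pow, Nat.add_sub_cancel] at h2
  refine h1.trans (h2.trans ?_)
  gcongr

section Semigroup

variable {s lamL lamR : ℝ} {P : NNReal → Kernel (Config N) (Config N)}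

theorem IsHeatSemigroup.hasDerivWithinAt (hP : IsHeatSemigroup s lamL lamR P)
    (p : MvPolynomial (Fin N) ℝ) (y : Config N) {t : ℝ} (ht : 0 ≤ t) :
    HasDerivWithinAt
      (fun r : ℝ => ∫ z : Config N, MvPolynomial.eval z.toReal p ∂(P r.toNNReal y))
      (∫ z : Config N, generator s lamL lamR (fun x => MvPolynomial.eval x p) z.toReal
        ∂(P t.toNNReal y)) (Set.Ici 0) t := by
  have h := hP.forward p t.toNNReal y
  rwa [Real.coe_toNNReal t ht] at h

theorem IsHeatSemigroup.integral_zero (hP : IsHeatSemigroup s lamL lamR P)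
    (p : MvPolynomial (Fin N) ℝ) (y : Config N) :
    ∫ z : Config N, MvPolynomial.eval z.toReal p ∂(P (0 : ℝ).toNNReal y)
      = MvPolynomial.eval y.toReal p := by
  rw [Real.toNNReal_zero, hP.zero, Kernel.id_apply,
    integral_dirac' _ _ (measurable_eval p).stronglyMeasurable]

theorem IsHeatSemigroup.integral_lyapunov_le (hP : IsHeatSemigroup s lamL lamR P) (hs : 0 < s)
    (hL : 0 < lamL) (hR : 0 < lamR) (hN : 1 ≤ N) (d : ℕ) :
    ∃ c K : ℝ, 0 < c ∧ 0 ≤ K ∧ ∀ (y : Config N) (t : ℝ), 0 ≤ t →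
      ∫ z : Config N, lyapunov d z.toReal ∂(P t.toNNReal y)
        ≤ Real.exp (-c * t) * lyapunov d y.toReal + K := by
  obtain ⟨c, K, hc, hK, h⟩ := lyapunov_drift hs hL hR hN d
  refine ⟨c, K / c, hc, by positivity, fun y t ht => ?_⟩
  obtain ⟨q, hq⟩ := exists_generator_eq_eval hs hL hR (lyapunovPoly N d)
  set φ : ℝ → ℝ := fun r => ∫ z : Config N, MvPolynomial.eval z.toReal (lyapunovPoly N d)
    ∂(P r.toNNReal y) with hφ
  set φ' : ℝ → ℝ := fun r => ∫ z : Config N, generator s lamL lamR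
    (fun x => MvPolynomial.eval x (lyapunovPoly N d)) z.toReal ∂(P r.toNNReal y) with hφ'
  have hd : ∀ r, 0 ≤ r → HasDerivWithinAt φ (φ' r) (Set.Ici 0) r := fun r hr =>
    hP.hasDerivWithinAt _ y hr
  have hle : ∀ r, φ' r ≤ -c * φ r + K := by
    intro r
    have := hP.markov r.toNNReal
    have hi := hP.integrable (lyapunovPoly N d) r.toNNReal y
    have h1 : φ' r = ∫ z : Config N, MvPolynomial.eval z.toReal q ∂(P r.toNNReal y) :=
      integral_congr_ae (ae_of_all _ fun z => hq _ z.toReal_pos)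
    have h2 : -c * φ r + K = ∫ z : Config N, (-c * MvPolynomial.eval z.toReal (lyapunovPoly N d) + K)
        ∂(P r.toNNReal y) := by
      rw [integral_add (hi.const_mul _) (integrable_const _), integral_const_mul]
      simp [hφ]
    rw [h1, h2]
    refine integral_mono (hP.integrable q _ y) ((hi.const_mul _).add (integrable_const _))
      fun z => ?_
    have := h z.toReal z.toReal_pos
    simp only [← hq _ z.toReal_pos, eval_lyapunovPoly]
    exact this
  set ψ : ℝ → ℝ := fun r => Real.exp (c * r) * (φ r - K / c) with hψ
  have hψd : ∀ r, 0 ≤ r → HasDerivWithinAt ψ (Real.exp (c * r) * c * (φ r - K / c)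
      + Real.exp (c * r) * φ' r) (Set.Ici 0) r := by
    intro r hr
    have he : HasDerivAt (fun r => Real.exp (c * r)) (Real.exp (c * r) * c) r := by
      simpa using ((hasDerivAt_id r).const_mul c).exp
    exact he.hasDerivWithinAt.mul ((hd r hr).sub_const _)
  have hanti : AntitoneOn ψ (Set.Ici 0) := by
    have hda : ∀ r ∈ interior (Set.Ici (0 : ℝ)), HasDerivAt ψ (Real.exp (c * r) * c * (φ r - K / c)
        + Real.exp (c * r) * φ' r) r := by
      intro r hr
      rw [interior_Ici] at hr
      exact (hψd r (le_of_lt hr)).hasDerivAt (Ici_mem_nhds hr)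
    refine antitoneOn_of_deriv_nonpos (convex_Ici 0)
      (fun r hr => (hψd r hr).continuousWithinAt)
      (fun r hr => (hda r hr).differentiableAt.differentiableWithinAt) fun r hr => ?_
    rw [(hda r hr).deriv]
    have h1 := mul_le_mul_of_nonneg_left (hle r) (Real.exp_pos (c * r)).le
    have h2 : Real.exp (c * r) * c * (φ r - K / c) = - (Real.exp (c * r) * (-c * φ r + K)) := by
      field_simp
      ring
    linarith
  have h0 := hanti Set.self_mem_Ici ht ht
  have hφ0 : φ 0 = lyapunov d y.toReal := by
    simp only [hφ]
    rw [hP.integral_zero, eval_lyapunovPoly]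
  simp only [hψ, mul_zero, Real.exp_zero, one_mul, hφ0] at h0
  have h1 : φ t - K / c ≤ Real.exp (-c * t) * (lyapunov d y.toReal - K / c) := by
    have := mul_le_mul_of_nonneg_left h0 (Real.exp_pos (-c * t)).le
    rwa [← mul_assoc, ← Real.exp_add, show -c * t + c * t = 0 by ring, Real.exp_zero, one_mul] at this
  have h2 : 0 ≤ Real.exp (-c * t) * (K / c) := by positivity
  have h3 : φ t = ∫ z : Config N, lyapunov d z.toReal ∂(P t.toNNReal y) := by
    simp only [hφ, eval_lyapunovPoly]
  linarith

theorem measurable_lyapunov (d : ℕ) : Measurable fun z : Config N => lyapunov d z.toReal := by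
  simpa only [eval_lyapunovPoly] using measurable_eval (lyapunovPoly N d)

theorem integrable_lyapunov (hP : IsHeatSemigroup s lamL lamR P) (hs : 0 < s)
    (hL : 0 < lamL) (hR : 0 < lamR) (hN : 1 ≤ N) {μ : Measure (Config N)}
    (hμ : IsStationary P μ) (d : ℕ) : Integrable (fun z : Config N => lyapunov d z.toReal) μ := by
  obtain ⟨c, K, hc, hK, h⟩ := hP.integral_lyapunov_le hs hL hR hN d
  have := hμ.1
  set V : Config N → ENNReal := fun z => ENNReal.ofReal (lyapunov d z.toReal) with hV
  have hVm : Measurable V := (measurable_lyapunov d).ennreal_ofReal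
  have hlin : ∀ (y : Config N) (t : ℝ), 0 ≤ t → ∫⁻ z, V z ∂(P t.toNNReal y)
      ≤ ENNReal.ofReal (Real.exp (-c * t) * lyapunov d y.toReal + K) := by
    intro y t ht
    have hi := hP.integrable (lyapunovPoly N d) t.toNNReal y
    simp only [eval_lyapunovPoly] at hi
    rw [← ofReal_integral_eq_lintegral_ofReal hi
      (ae_of_all _ fun z => lyapunov_nonneg d z.toReal_pos)]
    exact ENNReal.ofReal_le_ofReal (h y t ht)
  have hbound : ∀ n : ℕ, ∫⁻ z, min (V z) n ∂μ ≤ ENNReal.ofReal K := by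
    intro n
    have h1 : ∀ t : ℝ, 0 ≤ t → ∫⁻ z, min (V z) n ∂μ
        ≤ ∫⁻ y, min (ENNReal.ofReal (Real.exp (-c * t) * lyapunov d y.toReal + K)) n ∂μ := by
      intro t ht
      conv_lhs => rw [← (hμ.2 t.toNNReal).def]
      have := hP.markov t.toNNReal
      rw [Measure.lintegral_bind (P t.toNNReal).aemeasurable
        (hVm.min measurable_const).aemeasurable]
      refine lintegral_mono fun y => le_min ?_ ?_
      · exact (lintegral_mono fun z => min_le_left _ _).trans (hlin y t ht)
      · refine (lintegral_mono fun z => min_le_right _ _).trans ?_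
        simp
    have h2 : Tendsto (fun t : ℝ => ∫⁻ y : Config N, min (ENNReal.ofReal
        (Real.exp (-c * t) * lyapunov d y.toReal + K)) (n : ENNReal) ∂μ) atTop
        (𝓝 (∫⁻ _ : Config N, min (ENNReal.ofReal K) n ∂μ)) := by
      refine tendsto_lintegral_filter_of_dominated_convergence (fun _ => (n : ENNReal))
        (Eventually.of_forall fun t => ?_)
        (Eventually.of_forall fun t => ae_of_all _ fun y => min_le_right _ _) (by simp)
        (ae_of_all _ fun y => ?_)
      · exact ((((measurable_lyapunov d).const_mul _).add_const _).ennreal_ofReal).min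
          measurable_const
      · have he : Tendsto (fun t : ℝ => Real.exp (-c * t)) atTop (𝓝 0) := by
          refine Real.tendsto_exp_atBot.comp ?_
          exact tendsto_id.const_mul_atTop_of_neg (by linarith)
        have h3 : Tendsto (fun t : ℝ => Real.exp (-c * t) * lyapunov d y.toReal + K) atTop (𝓝 K) := by
          simpa using (he.mul_const (lyapunov d y.toReal)).add_const K
        exact (ENNReal.tendsto_ofReal h3).min tendsto_const_nhds
    have h3 := ge_of_tendsto h2 (eventually_atTop.2 ⟨0, h1⟩)
    refine h3.trans ?_
    simp
  have hfin : ∫⁻ z, V z ∂μ ≤ ENNReal.ofReal K := by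
    refine le_of_tendsto (lintegral_tendsto_of_tendsto_of_monotone (f := fun (n : ℕ) z => min (V z) n)
      (fun n => (hVm.min measurable_const).aemeasurable) (ae_of_all _ fun z m n hmn => ?_)
      (ae_of_all _ fun z => ?_)) (Eventually.of_forall hbound)
    · exact min_le_min le_rfl (by exact_mod_cast hmn)
    · have : Tendsto (fun n : ℕ => min (V z) (n : ENNReal)) atTop (𝓝 (min (V z) ⊤)) :=
        tendsto_const_nhds.min ENNReal.tendsto_nat_nhds_top
      simpa using this
  refine ⟨(measurable_lyapunov d).aestronglyMeasurable, ?_⟩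
  rw [hasFiniteIntegral_iff_ofReal (ae_of_all _ fun z => lyapunov_nonneg d z.toReal_pos)]
  exact hfin.trans_lt ENNReal.ofReal_lt_top

/-- Polynomials are integrable with respect to invariant probability measures. -/
theorem integrable_eval_of_isStationary (hP : IsHeatSemigroup s lamL lamR P) (hs : 0 < s)
    (hL : 0 < lamL) (hR : 0 < lamR) (hN : 1 ≤ N) {μ : Measure (Config N)}
    (hμ : IsStationary P μ) (p : MvPolynomial (Fin N) ℝ) :
    Integrable (fun z : Config N => MvPolynomial.eval z.toReal p) μ := by
  obtain ⟨C, d, hC, h⟩ := exists_abs_eval_le_lyapunov p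
  have := hμ.1
  refine (((integrable_const 1).add (integrable_lyapunov hP hs hL hR hN hμ d)).const_mul C).mono'
    (measurable_eval p).aestronglyMeasurable (ae_of_all _ fun z => ?_)
  simpa using h z.toReal z.toReal_pos

/-- The generator integrates to zero against invariant probability measures. -/
theorem integral_generator_eq_zero (hP : IsHeatSemigroup s lamL lamR P) (hs : 0 < s)
    (hL : 0 < lamL) (hR : 0 < lamR) (hN : 1 ≤ N) {μ : Measure (Config N)}
    (hμ : IsStationary P μ) (p : MvPolynomial (Fin N) ℝ) :
    ∫ z : Config N, generator s lamL lamR (fun x => MvPolynomial.eval x p) z.toReal ∂μ = 0 := by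
  have := hμ.1
  obtain ⟨q, hq⟩ := exists_generator_eq_eval hs hL hR p
  obtain ⟨C, d, hC, hCq⟩ := exists_abs_eval_le_lyapunov q
  obtain ⟨c, K, hc, hK, hV⟩ := hP.integral_lyapunov_le hs hL hR hN d
  set φ : Config N → ℝ → ℝ := fun y r => ∫ z : Config N, MvPolynomial.eval z.toReal p
    ∂(P r.toNNReal y) with hφ
  set B : Config N → ℝ := fun y => C * (1 + (lyapunov d y.toReal + K)) with hB
  have hBi : Integrable B μ := ((integrable_const 1).add
    ((integrable_lyapunov hP hs hL hR hN hμ d).add (integrable_const K))).const_mul C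
  have hq' : ∀ (y : Config N) (r : ℝ), 0 ≤ r → ‖∫ z : Config N, generator s lamL lamR
      (fun x => MvPolynomial.eval x p) z.toReal ∂(P r.toNNReal y)‖ ≤ B y := by
    intro y r hr
    have := hP.markov r.toNNReal
    have hi := hP.integrable (lyapunovPoly N d) r.toNNReal y
    simp only [eval_lyapunovPoly] at hi
    have hi2 : Integrable (fun z : Config N => C * (1 + lyapunov d z.toReal)) (P r.toNNReal y) :=
      ((integrable_const 1).add hi).const_mul C
    refine (norm_integral_le_of_norm_le hi2 (ae_of_all _ fun z => ?_)).trans ?_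
    · rw [hq _ z.toReal_pos]
      exact hCq _ z.toReal_pos
    · rw [integral_const_mul, integral_add (integrable_const _) hi]
      simp only [integral_const, probReal_univ, smul_eq_mul, mul_one]
      refine mul_le_mul_of_nonneg_left (add_le_add le_rfl ((hV y r hr).trans ?_)) hC
      have h1 : Real.exp (-c * r) ≤ 1 := Real.exp_le_one_iff.2 (by nlinarith)
      have h2 := mul_le_mul_of_nonneg_right h1 (lyapunov_nonneg d y.toReal_pos)
      linarith
  have hlip : ∀ (y : Config N) (t : ℝ), 0 < t → ‖(φ y t - φ y 0) / t‖ ≤ B y := by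
    intro y t ht
    have h1 := Convex.norm_image_sub_le_of_norm_hasDerivWithin_le
      (fun r hr => hP.hasDerivWithinAt p y hr) (fun r hr => hq' y r hr) (convex_Ici 0)
      (Set.self_mem_Ici (a := (0 : ℝ))) (Set.mem_Ici.2 ht.le)
    rw [norm_div, div_le_iff₀ (by simpa using ht.ne')]
    simpa [hφ] using h1
  have hint : ∀ t : ℝ, ∫ y, φ y t ∂μ = ∫ z : Config N, MvPolynomial.eval z.toReal p ∂μ := by
    intro t
    have hc := (hμ.2 t.toNNReal).comp_const
    have hi := integrable_eval_of_isStationary hP hs hL hR hN hμ p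
    have h1 := Kernel.integral_comp (a := ()) (κ := Kernel.const Unit μ) (η := P t.toNNReal)
      (f := fun z : Config N => MvPolynomial.eval z.toReal p) (by
        rw [Kernel.comp_const, Kernel.const_apply, (hμ.2 t.toNNReal).def]; exact hi)
    rw [Kernel.comp_const, Kernel.const_apply, Kernel.const_apply, (hμ.2 t.toNNReal).def] at h1
    exact h1.symm
  have hmeas : ∀ t : ℝ, StronglyMeasurable fun y => φ y t := fun t =>
    (measurable_eval p).stronglyMeasurable.integral_kernel
  have hφ0 : ∀ y, φ y 0 = MvPolynomial.eval y.toReal p := fun y => hP.integral_zero p y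
  have hi := integrable_eval_of_isStationary hP hs hL hR hN hμ p
  have hzero : ∀ t : ℝ, 0 < t → ∫ y, (φ y t - φ y 0) / t ∂μ = 0 := by
    intro t ht
    have hdi : Integrable (fun y => φ y t - φ y 0) μ := by
      have h1 : Integrable (fun y => (φ y t - φ y 0) / t) μ :=
        hBi.mono' (((hmeas t).sub (hmeas 0)).measurable.div_const t).aestronglyMeasurable
          (ae_of_all _ fun y => hlip y t ht)
      have h2 := h1.mul_const t
      refine h2.congr (ae_of_all _ fun y => ?_)
      simp only
      rw [div_mul_cancel₀ _ ht.ne']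
    have h0i : Integrable (fun y => φ y 0) μ := by simpa only [hφ0] using hi
    have hti : Integrable (fun y => φ y t) μ := by
      refine (hdi.add h0i).congr (ae_of_all _ fun y => ?_)
      simp
    rw [integral_div, integral_sub hti h0i, hint, hint, sub_self, zero_div]
  have hlim : Tendsto (fun t : ℝ => ∫ y, (φ y t - φ y 0) / t ∂μ) (𝓝[>] 0)
      (𝓝 (∫ z : Config N, generator s lamL lamR (fun x => MvPolynomial.eval x p) z.toReal ∂μ)) := by
    refine tendsto_integral_filter_of_dominated_convergence B
      (Eventually.of_forall fun t =>
        (((hmeas t).sub (hmeas 0)).measurable.div_const t).aestronglyMeasurable)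
      (eventually_mem_nhdsWithin.mono fun t ht => ae_of_all _ fun y => hlip y t ht) hBi
      (ae_of_all _ fun y => ?_)
    have h1 := hasDerivWithinAt_iff_tendsto_slope.1 (hP.hasDerivWithinAt p y le_rfl)
    rw [Set.Ici_sdiff_left] at h1
    have h2 : ∫ z : Config N, generator s lamL lamR (fun x => MvPolynomial.eval x p) z.toReal
        ∂(P (0 : ℝ).toNNReal y)
        = generator s lamL lamR (fun x => MvPolynomial.eval x p) y.toReal := by
      have h3 : ∀ z : Config N, generator s lamL lamR (fun x => MvPolynomial.eval x p) z.toReal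
          = MvPolynomial.eval z.toReal q := fun z => hq _ z.toReal_pos
      simp only [h3]
      exact hP.integral_zero q y
    rw [h2] at h1
    refine h1.congr fun t => ?_
    simp [slope, hφ, div_eq_inv_mul]
  refine tendsto_nhds_unique (hlim.congr' ?_) tendsto_const_nhds
  exact eventually_mem_nhdsWithin.mono fun t ht => hzero t ht

end Semigroup

/-- The function `f` is integrable with integral `a`. -/
def HasMean {Ω : Type*} [MeasurableSpace Ω] (μ : Measure Ω) (f : Ω → ℝ) (a : ℝ) : Prop :=
  Integrable f μ ∧ ∫ x, f x ∂μ = a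

namespace HasMean

variable {Ω : Type*} [MeasurableSpace Ω] {μ : Measure Ω} {f g : Ω → ℝ} {a b : ℝ}

theorem add (hf : HasMean μ f a) (hg : HasMean μ g b) : HasMean μ (fun x => f x + g x) (a + b) :=
  ⟨hf.1.add hg.1, by rw [integral_add hf.1 hg.1, hf.2, hg.2]⟩

theorem sub (hf : HasMean μ f a) (hg : HasMean μ g b) : HasMean μ (fun x => f x - g x) (a - b) :=
  ⟨hf.1.sub hg.1, by rw [integral_sub hf.1 hg.1, hf.2, hg.2]⟩

theorem const_mul (hf : HasMean μ f a) (c : ℝ) : HasMean μ (fun x => c * f x) (c * a) :=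
  ⟨hf.1.const_mul c, by rw [integral_const_mul, hf.2]⟩

theorem ite (hf : HasMean μ f a) (p : Prop) [Decidable p] :
    HasMean μ (fun x => if p then f x else 0) (if p then a else 0) := by
  split_ifs
  exacts [hf, ⟨integrable_zero _ _ _, integral_zero _ _⟩]

theorem sum {ι : Type*} (t : Finset ι) {f : ι → Ω → ℝ} {a : ι → ℝ}
    (h : ∀ i, HasMean μ (f i) (a i)) : HasMean μ (fun x => ∑ i ∈ t, f i x) (∑ i ∈ t, a i) :=
  ⟨integrable_finsetSum _ fun i _ => (h i).1, by
    rw [integral_finsetSum _ fun i _ => (h i).1]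
    exact Finset.sum_congr rfl fun i _ => (h i).2⟩

end HasMean

theorem hasMean_dualExchange {Ω : Type*} [MeasurableSpace Ω] {μ : Measure Ω} {s : ℝ}
    {F : (Fin N → ℕ) → Ω → ℝ} {M : (Fin N → ℕ) → ℝ} (h : ∀ η, HasMean μ (F η) (M η))
    (ξ : Fin N → ℕ) (i j : Fin N) :
    HasMean μ (fun x => dualExchange s (fun η => F η x) ξ i j) (dualExchange s M ξ i j) :=
  HasMean.sum _ fun _ => ((h _).sub (h ξ)).const_mul _

theorem hasMean_dualGenerator {Ω : Type*} [MeasurableSpace Ω] {μ : Measure Ω} {s TL TR : ℝ}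
    {F : (Fin N → ℕ) → Ω → ℝ} {M : (Fin N → ℕ) → ℝ} (h : ∀ η, HasMean μ (F η) (M η))
    (ξ : Fin N → ℕ) :
    HasMean μ (fun x => dualGenerator s TL TR (fun η => F η x) ξ) (dualGenerator s TL TR M ξ) := by
  have ha : ∀ T i, HasMean μ (fun x => dualAbsorb s T (fun η => F η x) ξ i)
      (dualAbsorb s T M ξ i) := fun T i =>
    HasMean.sum _ fun k => (((h _).const_mul _).sub (h ξ)).const_mul _
  have he := hasMean_dualExchange (s := s) h ξ
  exact ((HasMean.sum _ fun i => (ha _ i).ite _).add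
    (HasMean.sum _ fun i => HasMean.sum _ fun j => ((he i j).add (he j i)).ite _)).add
    (HasMean.sum _ fun i => (ha _ i).ite _)

/-- The moments of an invariant probability measure solve the dual equation. -/
theorem dualGenerator_moment_eq_zero {s lamL lamR : ℝ} {P : NNReal → Kernel (Config N) (Config N)}
    (hP : IsHeatSemigroup s lamL lamR P) (hs : 0 < s)
    (hL : 0 < lamL) (hR : 0 < lamR) (hN : 1 ≤ N) {μ : Measure (Config N)}
    (hμ : IsStationary P μ) (ξ : Fin N → ℕ) :
    dualGenerator s (1 / lamL) (1 / lamR) (fun η => ∫ z : Config N, dualFun s η z.toReal ∂μ) ξ = 0 := by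
  have h := hasMean_dualGenerator (s := s) (TL := 1 / lamL) (TR := 1 / lamR) (μ := μ)
    (F := fun η (z : Config N) => dualFun s η z.toReal)
    (M := fun η => ∫ z : Config N, dualFun s η z.toReal ∂μ) (fun η => ⟨by
      simpa only [eval_dualPoly] using
        integrable_eval_of_isStationary hP hs hL hR hN hμ (dualPoly s η), rfl⟩) ξ
  refine h.2.symm.trans (Eq.trans ?_ (integral_generator_eq_zero hP hs hL hR hN hμ (dualPoly s ξ)))
  simp only [eval_dualPoly]
  exact integral_congr_ae (ae_of_all _ fun z => (generator_dualFun hs hL hR ξ _ z.toReal_pos).symm)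

end HeatConduction

namespace HeatConduction

/-! ### Gamma variables -/

theorem hasMean_of_lintegral {Ω : Type*} [MeasurableSpace Ω] {μ : Measure Ω} {f : Ω → ℝ} {a : ℝ}
    (hf : Measurable f) (h0 : ∀ x, 0 ≤ f x) (ha : 0 ≤ a)
    (h : ∫⁻ x, ENNReal.ofReal (f x) ∂μ = ENNReal.ofReal a) : HasMean μ f a := by
  refine ⟨⟨hf.aestronglyMeasurable, ?_⟩, ?_⟩
  · rw [hasFiniteIntegral_iff_ofReal (ae_of_all _ h0), h]
    exact ENNReal.ofReal_lt_top
  · rw [integral_eq_lintegral_of_nonneg_ae (ae_of_all _ h0) hf.aestronglyMeasurable, h,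
      ENNReal.toReal_ofReal ha]

theorem HasMean.lintegral_eq {Ω : Type*} [MeasurableSpace Ω] {μ : Measure Ω} {f : Ω → ℝ} {a : ℝ}
    (h : HasMean μ f a) (h0 : ∀ x, 0 ≤ f x) :
    ∫⁻ x, ENNReal.ofReal (f x) ∂μ = ENNReal.ofReal a := by
  rw [← ofReal_integral_eq_lintegral_ofReal h.1 (ae_of_all _ h0), h.2]

theorem lintegral_gammaPos (a r : ℝ) {g : ℝ → ENNReal} (hg : Measurable g) :
    ∫⁻ z : PosReal, g z ∂(gammaPos a r) = ∫⁻ x in Set.Ioi (0 : ℝ),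
      ENNReal.ofReal (r ^ a / Real.Gamma a * x ^ (a - 1) * Real.exp (-(r * x))) * g x := by
  rw [gammaPos, lintegral_subtype_comap measurableSet_Ioi, gammaMeasure,
    setLIntegral_withDensity_eq_setLIntegral_mul _
      (show Measurable (gammaPDF a r) from (measurable_gammaPDFReal a r).ennreal_ofReal) hg
      measurableSet_Ioi]
  refine setLIntegral_congr_fun measurableSet_Ioi fun x hx => ?_
  rw [Pi.mul_apply, gammaPDF_of_nonneg (le_of_lt hx)]

/-- Moments of the exponentially tilted Gamma distribution. -/
theorem hasMean_gammaPos {s : ℝ} (hs : 0 < s) (n : ℕ) {c : ℝ} (hc : -1 < c) :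
    HasMean (gammaPos (2 * s) 1) (fun z : PosReal => (z : ℝ) ^ n * Real.exp (-(c * z)))
      (rising s n * (1 / (1 + c)) ^ (2 * s + n)) := by
  have hG := Real.Gamma_pos_of_pos (s := 2 * s) (by positivity)
  have hc' : 0 < 1 + c := by linarith
  have hn : (0 : ℝ) ≤ n := by positivity
  have hr := rising_pos hs n
  have hmeas : Measurable fun x : ℝ => x ^ n * Real.exp (-(c * x)) := by fun_prop
  refine hasMean_of_lintegral (hmeas.comp measurable_subtype_coe)
    (fun z => by have : 0 < (z : ℝ) := z.2
                 positivity) (by positivity) ?_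
  rw [lintegral_gammaPos _ _ (g := fun x => ENNReal.ofReal (x ^ n * Real.exp (-(c * x))))
    hmeas.ennreal_ofReal]
  have hint : IntegrableOn (fun x : ℝ => (Real.Gamma (2 * s))⁻¹ *
      (x ^ (2 * s + n - 1) * Real.exp (-((1 + c) * x)))) (Set.Ioi 0) := by
    have h := integrableOn_rpow_mul_exp_neg_mul_rpow (p := 1) (s := 2 * s + n - 1) (b := 1 + c)
      (by linarith) one_pos hc'
    refine IntegrableOn.congr_fun (Integrable.const_mul h (Real.Gamma (2 * s))⁻¹)
      (fun x hx => ?_) measurableSet_Ioi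
    simp only [Real.rpow_one, neg_mul]
  have hval : ∫ x in Set.Ioi (0 : ℝ), (Real.Gamma (2 * s))⁻¹ *
      (x ^ (2 * s + n - 1) * Real.exp (-((1 + c) * x)))
      = rising s n * (1 / (1 + c)) ^ (2 * s + n) := by
    rw [integral_const_mul, Real.integral_rpow_mul_exp_neg_mul_Ioi (by positivity) hc', rising]
    ring
  rw [← hval, ofReal_integral_eq_lintegral_ofReal hint]
  · refine setLIntegral_congr_fun measurableSet_Ioi fun x hx => ?_
    have hx' : 0 < x := hx
    rw [← ENNReal.ofReal_mul (by positivity)]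
    congr 1
    rw [Real.one_rpow, show 2 * s + n - 1 = (2 * s - 1) + n by ring, Real.rpow_add hx',
      Real.rpow_natCast, show -((1 + c) * x) = -(1 * x) + -(c * x) by ring, Real.exp_add]
    ring
  · refine (ae_restrict_iff' measurableSet_Ioi).2 (ae_of_all _ fun x hx => ?_)
    have hx' : 0 < x := hx
    simp only [Pi.zero_apply]
    positivity

theorem HasMean.prod_pi {ι : Type*} [Fintype ι] {E : ι → Type*} [∀ i, MeasurableSpace (E i)]
    {μ : (i : ι) → Measure (E i)} [∀ i, SigmaFinite (μ i)] {f : (i : ι) → E i → ℝ} {a : ι → ℝ}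
    (h : ∀ i, HasMean (μ i) (f i) (a i)) :
    HasMean (Measure.pi μ) (fun x => ∏ i, f i (x i)) (∏ i, a i) :=
  ⟨Integrable.fintype_prod_dep fun i => (h i).1, by
    rw [integral_fintype_prod_eq_prod]
    exact Finset.prod_congr rfl fun i _ => (h i).2⟩

/-- The law of independent Gamma variables with shape `2s` and rate `1`. -/
noncomputable def gammaConfig (s : ℝ) (K : ℕ) : Measure (Config K) :=
  Measure.pi fun _ => gammaPos (2 * s) 1

theorem isProbabilityMeasure_gammaConfig {s : ℝ} (hs : 0 < s) (K : ℕ) :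
    IsProbabilityMeasure (gammaConfig s K) := by
  have := isProbabilityMeasure_gammaPos (a := 2 * s) (r := 1) (by positivity) one_pos
  unfold gammaConfig
  infer_instance

variable {K : ℕ}

theorem hasMean_dualFun_mul_exp {s : ℝ} (hs : 0 < s) (a : Fin K → ℕ) {c : ℝ} (hc : -1 < c) :
    HasMean (gammaConfig s K)
      (fun X => dualFun s a X.toReal * Real.exp (-(c * energy X.toReal)))
      ((1 / (1 + c)) ^ (2 * s * K + (∑ l, a l : ℕ))) := by
  have := isProbabilityMeasure_gammaPos (a := 2 * s) (r := 1) (by positivity) one_pos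
  have h := HasMean.prod_pi (μ := fun _ : Fin K => gammaPos (2 * s) 1) fun l =>
    (hasMean_gammaPos hs (a l) hc).const_mul (rising s (a l))⁻¹
  have hc' : 0 < 1 / (1 + c) := by have : 0 < 1 + c := by linarith
                                   positivity
  rw [gammaConfig]
  convert h using 1
  · funext X
    rw [energy, Finset.mul_sum, ← Finset.sum_neg_distrib, Real.exp_sum, dualFun,
      ← Finset.prod_mul_distrib]
    exact Finset.prod_congr rfl fun l _ => by rw [mul_assoc]; rfl
  · have h1 : ∀ l, (rising s (a l))⁻¹ * (rising s (a l) * (1 / (1 + c)) ^ (2 * s + (a l : ℝ)))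
        = (1 / (1 + c)) ^ (2 * s + (a l : ℝ)) := fun l => by
      rw [inv_mul_cancel_left₀ (rising_pos hs _).ne']
    simp only [h1]
    rw [← Real.rpow_sum_of_pos hc']
    congr 1
    simp [Finset.sum_add_distrib, mul_comm]

theorem energy_toReal_pos (hK : 0 < K) (X : Config K) : 0 < energy X.toReal :=
  lt_of_lt_of_le (X.toReal_pos ⟨0, hK⟩) (energy_pos_le X.toReal_pos _)

theorem measurable_energy : Measurable fun X : Config K => energy X.toReal :=
  Finset.measurable_sum _ fun l _ => (measurable_pi_apply l).comp Config.measurable_toReal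

theorem measurable_dualFun (s : ℝ) (a : Fin K → ℕ) :
    Measurable fun X : Config K => dualFun s a X.toReal := by
  simpa only [eval_dualPoly] using measurable_eval (dualPoly s a)

theorem dualFun_nonneg {s : ℝ} (hs : 0 < s) (a : Fin K → ℕ) {y : Fin K → ℝ} (hy : ∀ l, 0 < y l) :
    0 ≤ dualFun s a y :=
  Finset.prod_nonneg fun l _ => mul_nonneg (inv_nonneg.2 (rising_pos hs _).le)
    (pow_nonneg (hy l).le _)

theorem dualFun_le {s : ℝ} (hs : 0 < s) (a : Fin K → ℕ) {y : Fin K → ℝ} (hy : ∀ l, 0 < y l) :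
    dualFun s a y ≤ (∏ l, (rising s (a l))⁻¹) * energy y ^ (∑ l, a l) := by
  rw [dualFun, Finset.prod_mul_distrib, ← Finset.prod_pow_eq_pow_sum]
  refine mul_le_mul_of_nonneg_left ?_
    (Finset.prod_nonneg fun l _ => inv_nonneg.2 (rising_pos hs _).le)
  exact Finset.prod_le_prod (fun l _ => pow_nonneg (hy l).le _)
    fun l _ => pow_le_pow_left₀ (hy l).le (energy_pos_le hy l) _

theorem lintegral_pow_mul_exp {d : ℕ} (hd : 0 < d) {S : ℝ} (hS : 0 < S) :
    ∫⁻ c in Set.Ioi (0 : ℝ), ENNReal.ofReal (c ^ ((d : ℝ) - 1) * Real.exp (-(c * S)))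
      = ENNReal.ofReal (Real.Gamma d * (1 / S ^ d)) := by
  have hd' : (0 : ℝ) < d := by exact_mod_cast hd
  have h := integrableOn_rpow_mul_exp_neg_mul_rpow (p := 1) (s := (d : ℝ) - 1) (b := S)
      (by linarith) one_pos hS
  have hint : IntegrableOn (fun c : ℝ => c ^ ((d : ℝ) - 1) * Real.exp (-(c * S))) (Set.Ioi 0) := by
    refine IntegrableOn.congr_fun h (fun x hx => ?_) measurableSet_Ioi
    simp only [Real.rpow_one, neg_mul, mul_comm x]
  rw [← ofReal_integral_eq_lintegral_ofReal hint]
  · congr 1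
    have h1 := Real.integral_rpow_mul_exp_neg_mul_Ioi hd' hS
    rw [Real.rpow_natCast, one_div, inv_pow, mul_comm] at h1
    simpa only [one_div, mul_comm] using h1
  · refine (ae_restrict_iff' measurableSet_Ioi).2 (ae_of_all _ fun x hx => ?_)
    have hx' : 0 < x := hx
    simp only [Pi.zero_apply]
    positivity

/-- The normalized moments of Gamma variables only depend on the degree. -/
theorem hasMean_dualFun_div_energy {s : ℝ} (hs : 0 < s) (hK : 0 < K) (d : ℕ) :
    ∃ C : ℝ, ∀ a : Fin K → ℕ, ∑ l, a l = d →
      HasMean (gammaConfig s K) (fun X => dualFun s a X.toReal / energy X.toReal ^ d) C := by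
  have := isProbabilityMeasure_gammaConfig hs K
  have hi : ∀ a : Fin K → ℕ, ∑ l, a l = d →
      Integrable (fun X : Config K => dualFun s a X.toReal / energy X.toReal ^ d)
        (gammaConfig s K) := by
    intro a ha
    refine (integrable_const (∏ l, (rising s (a l))⁻¹)).mono'
      ((measurable_dualFun s a).div (measurable_energy.pow_const d)).aestronglyMeasurable
      (ae_of_all _ fun X => ?_)
    have hE := energy_toReal_pos hK X
    rw [Real.norm_of_nonneg (div_nonneg (dualFun_nonneg hs a X.toReal_pos) (by positivity)),
      div_le_iff₀ (by positivity), ← ha]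
    exact dualFun_le hs a X.toReal_pos
  rcases Nat.eq_zero_or_pos d with rfl | hd
  · refine ⟨1, fun a ha => ⟨hi a ha, ?_⟩⟩
    have ha0 : a = 0 := funext fun l => (Finset.sum_eq_zero_iff.1 ha) l (Finset.mem_univ l)
    simp [ha0, dualFun, rising_zero hs]
  have hG := Real.Gamma_pos_of_pos (s := (d : ℝ)) (by exact_mod_cast hd)
  set C : ENNReal := ∫⁻ c in Set.Ioi (0 : ℝ), ENNReal.ofReal (c ^ ((d : ℝ) - 1)) *
    ENNReal.ofReal ((1 / (1 + c)) ^ (2 * s * K + (d : ℝ))) with hC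
  refine ⟨(Real.Gamma d)⁻¹ * C.toReal, fun a ha => ⟨hi a ha, ?_⟩⟩
  have hswap : ∫⁻ X : Config K, ENNReal.ofReal
      (Real.Gamma d * (dualFun s a X.toReal / energy X.toReal ^ d)) ∂(gammaConfig s K) = C := by
    have h1 : ∀ X : Config K, ENNReal.ofReal
        (Real.Gamma d * (dualFun s a X.toReal / energy X.toReal ^ d))
        = ∫⁻ c in Set.Ioi (0 : ℝ), ENNReal.ofReal (dualFun s a X.toReal) *
          ENNReal.ofReal (c ^ ((d : ℝ) - 1) * Real.exp (-(c * energy X.toReal))) := by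
      intro X
      have hD := dualFun_nonneg hs a X.toReal_pos
      rw [lintegral_const_mul _ (by fun_prop), lintegral_pow_mul_exp hd (energy_toReal_pos hK X),
        ← ENNReal.ofReal_mul hD]
      congr 1
      ring
    simp only [h1]
    rw [lintegral_lintegral_swap]
    · refine setLIntegral_congr_fun measurableSet_Ioi fun c hc => ?_
      have hc' : 0 < c := hc
      have h2 := (hasMean_dualFun_mul_exp hs a (c := c) (by linarith)).lintegral_eq fun X =>
        mul_nonneg (dualFun_nonneg hs a X.toReal_pos) (Real.exp_pos _).le
      rw [ha] at h2
      rw [← h2, ← lintegral_const_mul _ (by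
        exact ((measurable_dualFun s a).mul
          (measurable_energy.const_mul c).neg.exp).ennreal_ofReal)]
      refine lintegral_congr fun X => ?_
      have hD := dualFun_nonneg hs a X.toReal_pos
      rw [← ENNReal.ofReal_mul hD, ← ENNReal.ofReal_mul (by positivity)]
      congr 1
      ring
    · refine Measurable.aemeasurable ?_
      have m1 : Measurable fun p : Config K × ℝ => dualFun s a p.1.toReal :=
        (measurable_dualFun s a).comp measurable_fst
      have m2 : Measurable fun p : Config K × ℝ => energy p.1.toReal :=
        measurable_energy.comp measurable_fst
      have m3 : Measurable fun p : Config K × ℝ => p.2 ^ ((d : ℝ) - 1) :=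
        measurable_snd.pow_const _
      exact m1.ennreal_ofReal.mul (m3.mul (measurable_snd.mul m2).neg.exp).ennreal_ofReal
  have h0 : ∀ X : Config K, 0 ≤ Real.Gamma d * (dualFun s a X.toReal / energy X.toReal ^ d) :=
    fun X => mul_nonneg hG.le (div_nonneg (dualFun_nonneg hs a X.toReal_pos)
      (pow_nonneg (energy_nonneg X.toReal_pos) _))
  have h3 := integral_eq_lintegral_of_nonneg_ae (ae_of_all _ h0)
    ((hi a ha).const_mul (Real.Gamma d)).1
  rw [integral_const_mul, hswap] at h3
  rw [← h3, inv_mul_cancel_left₀ hG.ne']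

/-! ### Reversibility of the exchange of energy under the Gamma law -/

theorem hasMean_transfer_dualFun {s : ℝ} (hs : 0 < s) {i j : Fin K} (hij : i ≠ j)
    (a : Fin K → ℕ) :
    HasMean (gammaConfig s K) (fun X => (transfer s i j (dualFun s a) X.toReal
      + transfer s j i (dualFun s a) X.toReal) / energy X.toReal ^ (∑ l, a l)) 0 := by
  obtain ⟨C, hC⟩ := hasMean_dualFun_div_energy hs (lt_of_le_of_lt (Nat.zero_le _) i.2) (∑ l, a l)
  have key : ∀ {i j : Fin K}, i ≠ j → HasMean (gammaConfig s K) (fun X : Config K =>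
      ∑ k ∈ Finset.range (a j), dualRate s (k + 1) (a j) *
        (if k < a j then dualFun s (hop a i j (k + 1)) X.toReal / energy X.toReal ^ (∑ l, a l)
          - dualFun s a X.toReal / energy X.toReal ^ (∑ l, a l) else 0)) 0 := by
    intro i j hij
    have := HasMean.sum (μ := gammaConfig s K) (Finset.range (a j)) (f := fun k (X : Config K) =>
      dualRate s (k + 1) (a j) *
        (if k < a j then dualFun s (hop a i j (k + 1)) X.toReal / energy X.toReal ^ (∑ l, a l)
          - dualFun s a X.toReal / energy X.toReal ^ (∑ l, a l) else 0)) (a := fun _ => 0) (by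
      intro k
      by_cases hk : k < a j
      · simp only [if_pos hk]
        simpa using ((hC _ (degree_hop a hij (by omega))).sub (hC a rfl)).const_mul
          (dualRate s (k + 1) (a j))
      · simp only [if_neg hk, mul_zero]
        exact ⟨integrable_zero _ _ _, integral_zero _ _⟩)
    simpa using this
  have h := (key hij).add (key hij.symm)
  rw [add_zero] at h
  convert h using 1
  funext X
  rw [transfer_add_transfer_dualFun hs hij a _ X.toReal_pos, add_div]
  simp only [dualExchange, Finset.sum_div]
  congr 1
  · refine Finset.sum_congr rfl fun k hk => ?_
    rw [if_pos (Finset.mem_range.1 hk)]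
    ring
  · refine Finset.sum_congr rfl fun k hk => ?_
    rw [if_pos (Finset.mem_range.1 hk)]
    ring

theorem hasMean_transfer_homogeneous {s : ℝ} (hs : 0 < s) {i j : Fin K} (hij : i ≠ j) {d : ℕ}
    {Q : MvPolynomial (Fin K) ℝ} (hQ : Q.IsHomogeneous d) :
    HasMean (gammaConfig s K) (fun X => (transfer s i j (fun x => MvPolynomial.eval x Q) X.toReal
      + transfer s j i (fun x => MvPolynomial.eval x Q) X.toReal) / energy X.toReal ^ d) 0 := by
  have key : ∀ t : Finset (Fin K →₀ ℕ), (∀ m ∈ t, ∑ l, m l = d) →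
      HasMean (gammaConfig s K) (fun X => (transfer s i j (fun x => MvPolynomial.eval x
        (∑ m ∈ t, MvPolynomial.monomial m (MvPolynomial.coeff m Q))) X.toReal
      + transfer s j i (fun x => MvPolynomial.eval x
        (∑ m ∈ t, MvPolynomial.monomial m (MvPolynomial.coeff m Q))) X.toReal)
          / energy X.toReal ^ d) 0 := by
    classical
    intro t
    induction t using Finset.induction_on with
    | empty =>
      intro _
      have h0 : ∀ (i j : Fin K) (y : Fin K → ℝ), transfer s i j (fun _ => (0 : ℝ)) y = 0 := by
        intro i j y
        simp [transfer]
      simp only [Finset.sum_empty, map_zero, h0, add_zero, zero_div]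
      exact ⟨integrable_zero _ _ _, integral_zero _ _⟩
    | insert m t hm ih =>
      intro ht
      have h1 := ih fun m' hm' => ht m' (Finset.mem_insert_of_mem hm')
      set c : ℝ := MvPolynomial.coeff m Q * ∏ l, rising s (m l) with hc
      have h2 := (hasMean_transfer_dualFun hs hij m).const_mul c
      have h3 := h2.add h1
      rw [mul_zero, add_zero] at h3
      convert h3 using 1
      funext X
      rw [Finset.sum_insert hm]
      rw [transfer_add hs i j _ _ _ (X.toReal_pos i), transfer_add hs j i _ _ _ (X.toReal_pos j),
        monomial_eq_smul_dualPoly hs, transfer_smul hs i j _ _ _ (X.toReal_pos i),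
        transfer_smul hs j i _ _ _ (X.toReal_pos j), ht m (Finset.mem_insert_self m t)]
      simp only [eval_dualPoly]
      rw [← hc]
      ring
  have h := key Q.support fun m hm => by
    have := hQ (MvPolynomial.mem_support_iff.1 hm)
    rw [← this, Finsupp.weight_apply, Finsupp.sum_fintype _ _ (by simp)]
    simp
  rwa [MvPolynomial.support_sum_monomial_coeff] at h

end HeatConduction

namespace HeatConduction

open Polynomial

variable {N : ℕ}

/-! ### The hidden temperatures -/

/-- The hidden temperatures interpolate between the temperatures of the reservoirs, with increments
proportional to the entries of `x`. -/
noncomputable def hiddenTemp (TL TR : ℝ) (x : Fin (N + 1) → ℝ) (l : ℕ) : ℝ :=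
  (∑ j : Fin (N + 1), (if (j : ℕ) < l then TR else TL) * x j) / energy x

theorem hiddenTemp_zero {TL TR : ℝ} {x : Fin (N + 1) → ℝ} (hx : energy x ≠ 0) :
    hiddenTemp TL TR x 0 = TL := by
  simp only [hiddenTemp, Nat.not_lt_zero, if_false, ← Finset.mul_sum]
  exact mul_div_cancel_right₀ _ hx

theorem hiddenTemp_last {TL TR : ℝ} {x : Fin (N + 1) → ℝ} (hx : energy x ≠ 0) :
    hiddenTemp TL TR x (N + 1) = TR := by
  simp only [hiddenTemp, Fin.is_lt, if_true, ← Finset.mul_sum]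
  exact mul_div_cancel_right₀ _ hx

theorem hiddenTemp_pos {TL TR : ℝ} (hL : 0 < TL) (hR : 0 < TR) {x : Fin (N + 1) → ℝ}
    (hx : ∀ l, 0 < x l) (l : ℕ) : 0 < hiddenTemp TL TR x l := by
  refine div_pos (Finset.sum_pos (fun j _ => mul_pos (by split_ifs <;> assumption) (hx j))
    Finset.univ_nonempty) (Finset.sum_pos (fun j _ => hx j) Finset.univ_nonempty)

theorem hiddenTemp_le {TL TR : ℝ} (hL : 0 < TL) (hR : 0 < TR) {x : Fin (N + 1) → ℝ}
    (hx : ∀ l, 0 < x l) (l : ℕ) : hiddenTemp TL TR x l ≤ TL + TR := by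
  have hE : 0 < energy x := Finset.sum_pos (fun j _ => hx j) Finset.univ_nonempty
  rw [hiddenTemp, div_le_iff₀ hE, energy, Finset.mul_sum]
  refine Finset.sum_le_sum fun j _ => mul_le_mul_of_nonneg_right ?_ (hx j).le
  split_ifs <;> linarith

theorem hiddenTemp_succ (TL TR : ℝ) (x : Fin (N + 1) → ℝ) (l : Fin (N + 1)) :
    hiddenTemp TL TR x (l + 1) = hiddenTemp TL TR x l + (TR - TL) / energy x * x l := by
  have h : ∀ j : Fin (N + 1), (if (j : ℕ) < l + 1 then TR else TL) * x j
      = (if (j : ℕ) < l then TR else TL) * x j + (if j = l then (TR - TL) * x j else 0) := by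
    intro j
    by_cases hj : j = l
    · subst hj
      simp
      ring
    · have : (j : ℕ) ≠ l := fun h => hj (Fin.ext h)
      by_cases hjl : (j : ℕ) < l
      · rw [if_pos (by omega), if_pos hjl, if_neg hj, add_zero]
      · rw [if_neg (by omega), if_neg hjl, if_neg hj, add_zero]
  simp only [hiddenTemp, h, Finset.sum_add_distrib, add_div]
  rw [Finset.sum_ite_eq' Finset.univ l, if_pos (Finset.mem_univ l)]
  ring

theorem hiddenTemp_add_single (TL TR : ℝ) (x v : Fin (N + 1) → ℝ) (hv : energy v = 0) (l : ℕ) :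
    hiddenTemp TL TR (x + v) l = hiddenTemp TL TR x l
      + (∑ j : Fin (N + 1), (if (j : ℕ) < l then TR else TL) * v j) / energy x := by
  rw [hiddenTemp, energy_add, hv, add_zero, hiddenTemp, ← add_div, ← Finset.sum_add_distrib]
  simp only [Pi.add_apply, mul_add]

/-- A product of powers of the hidden temperatures. -/
noncomputable def hiddenMono (TL TR : ℝ) (ξ : Fin N → ℕ) (x : Fin (N + 1) → ℝ) : ℝ :=
  ∏ l : Fin N, hiddenTemp TL TR x (l + 1) ^ ξ l

theorem prod_update_pow (v : Fin N → ℝ) (ξ : Fin N → ℕ) (i : Fin N) (n : ℕ) :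
    ∏ l, v l ^ Function.update ξ i n l = v i ^ n * ∏ l ∈ Finset.univ.erase i, v l ^ ξ l := by
  rw [prod_split_single _ i, Function.update_self]
  congr 1
  refine Finset.prod_congr rfl fun l hl => ?_
  rw [Function.update_of_ne (Finset.ne_of_mem_erase hl)]

/-- Jumps of a power of one factor towards a value `t` act as absorption at temperature `t`. -/
theorem jump_eq_dualAbsorb {s : ℝ} (hs : 0 < s) (v : Fin N → ℝ) (ξ : Fin N → ℕ) (i : Fin N) (t : ℝ) :
    jump hs (C (∏ l ∈ Finset.univ.erase i, v l ^ ξ l) * (C (v i) + C (t - v i) * X) ^ ξ i)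
      = dualAbsorb s t (fun η => ∏ l, v l ^ η l) ξ i := by
  rw [← Polynomial.smul_eq_C_mul, map_smul, jump_convex_pow, smul_eq_mul, Finset.mul_sum,
    dualAbsorb]
  refine Finset.sum_congr rfl fun k _ => ?_
  rw [prod_update_pow, prod_split_single _ i]
  ring

theorem hiddenMono_path (TL TR : ℝ) (ξ : Fin N → ℕ) (x : Fin (N + 1) → ℝ) (i : Fin N) (a : ℝ) :
    hiddenMono TL TR ξ (x + (Pi.single i.castSucc a - Pi.single i.succ a))
      = (∏ l ∈ Finset.univ.erase i, hiddenTemp TL TR x (l + 1) ^ ξ l)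
        * (hiddenTemp TL TR x (i + 1) + (TR - TL) / energy x * a) ^ ξ i := by
  have hv : energy (Pi.single i.castSucc a - Pi.single i.succ a : Fin (N + 1) → ℝ) = 0 := by
    rw [energy_sub, energy_single, energy_single, sub_self]
  have hsum : ∀ l : ℕ, ∑ j : Fin (N + 1), (if (j : ℕ) < l then TR else TL)
      * (Pi.single i.castSucc a - Pi.single i.succ a : Fin (N + 1) → ℝ) j
      = (if (i : ℕ) < l then TR else TL) * a - (if (i : ℕ) + 1 < l then TR else TL) * a := by
    intro l
    simp only [Pi.sub_apply, mul_sub, Finset.sum_sub_distrib, Pi.single_apply, mul_ite, mul_zero]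
    simp
  rw [hiddenMono, prod_split_single _ i, mul_comm]
  congr 1
  · refine Finset.prod_congr rfl fun l hl => ?_
    have hli : (l : ℕ) ≠ i := fun h => Finset.ne_of_mem_erase hl (Fin.ext h)
    rw [hiddenTemp_add_single _ _ _ _ hv, hsum]
    by_cases h : (i : ℕ) < l + 1
    · rw [if_pos h, if_pos (by omega), sub_self, zero_div, add_zero]
    · rw [if_neg h, if_neg (by omega), sub_self, zero_div, add_zero]
  · rw [hiddenTemp_add_single _ _ _ _ hv, hsum, if_pos (by omega), if_neg (by omega)]
    congr 1
    ring

theorem transfer_left_hiddenMono {s : ℝ} (hs : 0 < s) (TL TR : ℝ) (ξ : Fin N → ℕ)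
    (x : Fin (N + 1) → ℝ) (hx : ∀ l, 0 < x l) (i : Fin N) :
    transfer s i.succ i.castSucc (hiddenMono TL TR ξ) x
      = dualAbsorb s (hiddenTemp TL TR x (i + 2)) (fun η => hiddenMono TL TR η x) ξ i := by
  have hp : ∀ a, hiddenMono TL TR ξ (x - Pi.single i.succ a + Pi.single i.castSucc a)
      = (C (∏ l ∈ Finset.univ.erase i, hiddenTemp TL TR x (l + 1) ^ ξ l)
        * (C (hiddenTemp TL TR x (i + 1)) + C ((TR - TL) / energy x) * X) ^ ξ i).eval a := by
    intro a
    have := hiddenMono_path TL TR ξ x i a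
    rw [show x - Pi.single i.succ a + Pi.single i.castSucc a
      = x + (Pi.single i.castSucc a - Pi.single i.succ a) by abel, this]
    simp only [eval_mul, eval_C, eval_pow, eval_add, eval_X]
  rw [transfer_eq_jump hs _ _ _ x (hx _) _ hp]
  have h := jump_eq_dualAbsorb hs (fun l : Fin N => hiddenTemp TL TR x (l + 1)) ξ i
    (hiddenTemp TL TR x (i + 2))
  refine Eq.trans ?_ h
  have h2 := hiddenTemp_succ TL TR x i.succ
  simp only [Fin.val_succ] at h2
  rw [show (i : ℕ) + 2 = i + 1 + 1 by ring, h2, add_sub_cancel_left]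
  simp only [mul_comp, C_comp, pow_comp, add_comp, X_comp, map_mul, mul_assoc]

theorem transfer_right_hiddenMono {s : ℝ} (hs : 0 < s) (TL TR : ℝ) (ξ : Fin N → ℕ)
    (x : Fin (N + 1) → ℝ) (hx : ∀ l, 0 < x l) (i : Fin N) :
    transfer s i.castSucc i.succ (hiddenMono TL TR ξ) x
      = dualAbsorb s (hiddenTemp TL TR x i) (fun η => hiddenMono TL TR η x) ξ i := by
  have hp : ∀ a, hiddenMono TL TR ξ (x - Pi.single i.castSucc a + Pi.single i.succ a)
      = (C (∏ l ∈ Finset.univ.erase i, hiddenTemp TL TR x (l + 1) ^ ξ l)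
        * (C (hiddenTemp TL TR x (i + 1)) + C (-((TR - TL) / energy x)) * X) ^ ξ i).eval a := by
    intro a
    have := hiddenMono_path TL TR ξ x i (-a)
    rw [show x - Pi.single i.castSucc a + Pi.single i.succ a
      = x + (Pi.single i.castSucc (-a) - Pi.single i.succ (-a)) by
        rw [Pi.single_neg, Pi.single_neg]; abel, this]
    simp only [eval_mul, eval_C, eval_pow, eval_add, eval_X]
    ring
  rw [transfer_eq_jump hs _ _ _ x (hx _) _ hp]
  have h := jump_eq_dualAbsorb hs (fun l : Fin N => hiddenTemp TL TR x (l + 1)) ξ i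
    (hiddenTemp TL TR x i)
  refine Eq.trans ?_ h
  have h2 := hiddenTemp_succ TL TR x i.castSucc
  simp only [Fin.val_castSucc] at h2
  rw [h2, show hiddenTemp TL TR x i - (hiddenTemp TL TR x i + (TR - TL) / energy x * x i.castSucc)
    = -((TR - TL) / energy x) * x i.castSucc by ring]
  simp only [mul_comp, C_comp, pow_comp, add_comp, X_comp, C_mul, mul_assoc]

theorem dualExchange_prod_pow (s : ℝ) (v : Fin N → ℝ) (ξ : Fin N → ℕ) {i j : Fin N} (hij : i ≠ j) :
    dualExchange s (fun η => ∏ l, v l ^ η l) ξ i j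
      = dualAbsorb s (v i) (fun η => ∏ l, v l ^ η l) ξ j := by
  refine Finset.sum_congr rfl fun k _ => ?_
  congr 2
  beta_reduce
  rw [hop, prod_update_pow, prod_update_pow, pow_add,
    ← Finset.mul_prod_erase _ _ (Finset.mem_erase.2 ⟨hij.symm, Finset.mem_univ j⟩),
    ← Finset.mul_prod_erase _ _ (Finset.mem_erase.2 ⟨hij, Finset.mem_univ i⟩),
    Function.update_self, Finset.erase_right_comm]
  have : ∏ l ∈ (Finset.univ.erase j).erase i, v l ^ Function.update ξ j (ξ j - (k + 1)) l
      = ∏ l ∈ (Finset.univ.erase j).erase i, v l ^ ξ l := by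
    refine Finset.prod_congr rfl fun l hl => ?_
    rw [Function.update_of_ne (Finset.ne_of_mem_erase (Finset.mem_of_mem_erase hl))]
  rw [this]
  ring

/-- On product functions the dual generator is a sum of one-site generators. -/
theorem dualGenerator_prod_pow (s : ℝ) (w : ℕ → ℝ) (ξ : Fin N → ℕ) :
    dualGenerator s (w 0) (w (N + 1)) (fun η => ∏ l : Fin N, w (l + 1) ^ η l) ξ
      = ∑ i : Fin N, (dualAbsorb s (w i) (fun η => ∏ l : Fin N, w (l + 1) ^ η l) ξ i
        + dualAbsorb s (w (i + 2)) (fun η => ∏ l : Fin N, w (l + 1) ^ η l) ξ i) := by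
  set F : (Fin N → ℕ) → ℝ := fun η => ∏ l : Fin N, w (l + 1) ^ η l with hF
  have hb : ∀ i j : Fin N, (if (i : ℕ) + 1 = (j : ℕ) then
      dualExchange s F ξ i j + dualExchange s F ξ j i else 0)
      = (if (i : ℕ) + 1 = (j : ℕ) then dualAbsorb s (w j) F ξ j else 0)
        + (if (i : ℕ) + 1 = (j : ℕ) then dualAbsorb s (w (i + 2)) F ξ i else 0) := by
    intro i j
    split_ifs with h
    · have hij : i ≠ j := by rintro rfl; omega
      rw [hF, dualExchange_prod_pow s (fun l : Fin N => w (l + 1)) ξ hij,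
        dualExchange_prod_pow s (fun l : Fin N => w (l + 1)) ξ hij.symm]
      simp only [h, show (i : ℕ) + 2 = j + 1 by omega]
    · simp
  unfold dualGenerator
  simp only [hb, Finset.sum_add_distrib]
  rw [Finset.sum_comm (f := fun i j : Fin N => if (i : ℕ) + 1 = (j : ℕ) then
    dualAbsorb s (w j) F ξ j else 0)]
  have h1 : ∀ j : Fin N, (∑ i : Fin N, if (i : ℕ) + 1 = (j : ℕ) then
      dualAbsorb s (w j) F ξ j else 0)
      = dualAbsorb s (w j) F ξ j - (if (j : ℕ) = 0 then dualAbsorb s (w 0) F ξ j else 0) := by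
    intro j
    rw [sum_ite_pred j (fun _ => dualAbsorb s (w j) F ξ j)]
    by_cases h : (j : ℕ) = 0
    · rw [if_pos h, if_pos h, h, sub_self]
    · rw [if_neg h, if_neg h, sub_zero]
  have h2 : ∀ i : Fin N, (∑ j : Fin N, if (i : ℕ) + 1 = (j : ℕ) then
      dualAbsorb s (w (i + 2)) F ξ i else 0)
      = dualAbsorb s (w (i + 2)) F ξ i
        - (if (i : ℕ) + 1 = N then dualAbsorb s (w (N + 1)) F ξ i else 0) := by
    intro i
    rw [sum_ite_succ i (fun _ => dualAbsorb s (w (i + 2)) F ξ i)]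
    by_cases h : (i : ℕ) + 1 < N
    · rw [dif_pos h, if_neg h.ne, sub_zero]
    · have h' : (i : ℕ) + 1 = N := by have := i.2; omega
      rw [dif_neg h, if_pos h', show (i : ℕ) + 2 = N + 1 by omega, sub_self]
  simp only [h1, h2, Finset.sum_sub_distrib]
  ring

/-- The numerator of `hiddenMono` as a homogeneous polynomial. -/
noncomputable def hiddenPoly (TL TR : ℝ) (ξ : Fin N → ℕ) : MvPolynomial (Fin (N + 1)) ℝ :=
  ∏ l : Fin N, (∑ j : Fin (N + 1), MvPolynomial.C (if (j : ℕ) < l + 1 then TR else TL)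
    * MvPolynomial.X j) ^ ξ l

theorem isHomogeneous_hiddenPoly (TL TR : ℝ) (ξ : Fin N → ℕ) :
    (hiddenPoly TL TR ξ).IsHomogeneous (∑ l, ξ l) := by
  refine MvPolynomial.IsHomogeneous.prod _ _ _ fun l _ => ?_
  have h := (MvPolynomial.IsHomogeneous.sum Finset.univ (fun j : Fin (N + 1) =>
    MvPolynomial.C (if (j : ℕ) < l + 1 then TR else TL) * MvPolynomial.X j) 1 fun j _ => by
      simpa using (MvPolynomial.isHomogeneous_C (Fin (N + 1)) _).mul
        (MvPolynomial.isHomogeneous_X ℝ j)).pow (ξ l)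
  rwa [one_mul] at h

theorem eval_hiddenPoly (TL TR : ℝ) (ξ : Fin N → ℕ) {x : Fin (N + 1) → ℝ} (hx : energy x ≠ 0) :
    MvPolynomial.eval x (hiddenPoly TL TR ξ) = energy x ^ (∑ l, ξ l) * hiddenMono TL TR ξ x := by
  rw [← Finset.prod_pow_eq_pow_sum, hiddenMono, ← Finset.prod_mul_distrib, hiddenPoly, map_prod]
  refine Finset.prod_congr rfl fun l _ => ?_
  rw [← mul_pow, hiddenTemp, mul_div_cancel₀ _ hx]
  simp [map_sum]

theorem transfer_hiddenPoly {s : ℝ} (TL TR : ℝ) (ξ : Fin N → ℕ) {x : Fin (N + 1) → ℝ}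
    (hx : energy x ≠ 0) (i j : Fin (N + 1)) :
    transfer s i j (fun y => MvPolynomial.eval y (hiddenPoly TL TR ξ)) x
      = energy x ^ (∑ l, ξ l) * transfer s i j (hiddenMono TL TR ξ) x := by
  have h : ∀ a, energy (x - Pi.single i a + Pi.single j a) = energy x := fun a => by
    rw [energy_add, energy_sub, energy_single, energy_single, sub_add_cancel]
  have h2 : ∀ a, MvPolynomial.eval (x - Pi.single i a + Pi.single j a) (hiddenPoly TL TR ξ)
      = energy x ^ (∑ l, ξ l) * hiddenMono TL TR ξ (x - Pi.single i a + Pi.single j a) := fun a => by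
    rw [eval_hiddenPoly _ _ _ (by rw [h]; exact hx), h]
  unfold transfer
  simp only [h2, eval_hiddenPoly _ _ _ hx]
  rw [← intervalIntegral.integral_const_mul]
  congr 1
  funext a
  ring

theorem measurable_hiddenTemp (TL TR : ℝ) (l : ℕ) :
    Measurable fun X : Config (N + 1) => hiddenTemp TL TR X.toReal l :=
  (Finset.measurable_sum _ fun j _ => ((measurable_pi_apply j).comp
    Config.measurable_toReal).const_mul _).div measurable_energy

theorem integrable_hiddenMono {s TL TR : ℝ} (hs : 0 < s) (hL : 0 < TL) (hR : 0 < TR)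
    (ξ : Fin N → ℕ) :
    Integrable (fun X : Config (N + 1) => hiddenMono TL TR ξ X.toReal) (gammaConfig s (N + 1)) := by
  have := isProbabilityMeasure_gammaConfig hs (N + 1)
  refine (integrable_const (∏ l, (TL + TR) ^ ξ l)).mono' (Finset.measurable_prod _ fun l _ =>
    (measurable_hiddenTemp TL TR _).pow_const _).aestronglyMeasurable (ae_of_all _ fun X => ?_)
  have h0 : ∀ l, 0 < hiddenTemp TL TR X.toReal l := hiddenTemp_pos hL hR X.toReal_pos
  rw [hiddenMono, Real.norm_of_nonneg (Finset.prod_nonneg fun l _ => pow_nonneg (h0 _).le _)]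
  exact Finset.prod_le_prod (fun l _ => pow_nonneg (h0 _).le _) fun l _ =>
    pow_le_pow_left₀ (h0 _).le (hiddenTemp_le hL hR X.toReal_pos _) _

/-- The moments of the hidden temperatures solve the dual equation. -/
theorem dualGenerator_hidden_eq_zero {s TL TR : ℝ} (hs : 0 < s) (hL : 0 < TL) (hR : 0 < TR)
    (ξ : Fin N → ℕ) :
    dualGenerator s TL TR (fun η => ∫ X : Config (N + 1), hiddenMono TL TR η X.toReal
      ∂(gammaConfig s (N + 1))) ξ = 0 := by
  have h1 := hasMean_dualGenerator (s := s) (TL := TL) (TR := TR) (μ := gammaConfig s (N + 1))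
    (F := fun η (X : Config (N + 1)) => hiddenMono TL TR η X.toReal)
    (M := fun η => ∫ X : Config (N + 1), hiddenMono TL TR η X.toReal ∂(gammaConfig s (N + 1)))
    (fun η => ⟨integrable_hiddenMono hs hL hR η, rfl⟩) ξ
  have h2 : ∀ i : Fin N, HasMean (gammaConfig s (N + 1)) (fun X : Config (N + 1) =>
      (transfer s i.castSucc i.succ (fun y => MvPolynomial.eval y (hiddenPoly TL TR ξ)) X.toReal
      + transfer s i.succ i.castSucc (fun y => MvPolynomial.eval y (hiddenPoly TL TR ξ)) X.toReal)
      / energy X.toReal ^ (∑ l, ξ l)) 0 := fun i =>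
    hasMean_transfer_homogeneous hs (by simp [Fin.ext_iff]) (isHomogeneous_hiddenPoly TL TR ξ)
  have h3 := HasMean.sum Finset.univ h2
  rw [Finset.sum_const_zero] at h3
  refine h1.2.symm.trans (Eq.trans ?_ h3.2)
  refine integral_congr_ae (ae_of_all _ fun X => ?_)
  have hE := energy_toReal_pos (Nat.succ_pos N) X
  have h4 := dualGenerator_prod_pow s (hiddenTemp TL TR X.toReal) ξ
  rw [hiddenTemp_zero hE.ne', hiddenTemp_last hE.ne'] at h4
  refine h4.trans (Finset.sum_congr rfl fun i _ => ?_)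
  rw [transfer_hiddenPoly _ _ _ hE.ne', transfer_hiddenPoly _ _ _ hE.ne', ← mul_add,
    mul_div_cancel_left₀ _ (by positivity), transfer_left_hiddenMono hs TL TR ξ _ X.toReal_pos,
    transfer_right_hiddenMono hs TL TR ξ _ X.toReal_pos]
  rfl

end HeatConduction

namespace HeatConduction

/-! ### Determinacy of the moment problem -/

section Determinacy

variable {N : ℕ} {μ ν : Measure (Config N)}

theorem energy_eq_eval (y : Fin N → ℝ) :
    energy y = MvPolynomial.eval y (∑ l : Fin N, MvPolynomial.X l) := by
  simp [energy, map_sum]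

theorem lintegral_exp_energy_eq_tsum {r : ℝ} (hr : 0 ≤ r) (μ : Measure (Config N)) :
    ∫⁻ y, ENNReal.ofReal (Real.exp (r * energy y.toReal)) ∂μ
      = ∑' n : ℕ, ENNReal.ofReal (r ^ n / n.factorial) *
        ∫⁻ y, ENNReal.ofReal (energy y.toReal ^ n) ∂μ := by
  have h : ∀ y : Config N, ENNReal.ofReal (Real.exp (r * energy y.toReal))
      = ∑' n : ℕ, ENNReal.ofReal (r ^ n / n.factorial) * ENNReal.ofReal (energy y.toReal ^ n) := by
    intro y
    have hE := energy_nonneg y.toReal_pos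
    rw [Real.exp_eq_exp_ℝ, NormedSpace.exp_eq_tsum_div,
      ENNReal.ofReal_tsum_of_nonneg (fun n => by positivity)
        (Real.summable_pow_div_factorial _)]
    refine tsum_congr fun n => ?_
    rw [← ENNReal.ofReal_mul (by positivity), mul_pow]
    congr 1
    ring
  simp only [h]
  rw [lintegral_tsum fun n =>
    ((measurable_energy.pow_const n).ennreal_ofReal.const_mul _).aemeasurable]
  exact tsum_congr fun n =>
    lintegral_const_mul _ (measurable_energy.pow_const n).ennreal_ofReal

/-- Exponential integrability only depends on the moments. -/
theorem integrable_exp_energy_of_moments {r : ℝ} (hr : 0 ≤ r)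
    (h : ∀ p : MvPolynomial (Fin N) ℝ, ∃ a, HasMean μ (fun y => MvPolynomial.eval y.toReal p) a ∧
      HasMean ν (fun y => MvPolynomial.eval y.toReal p) a)
    (hν : Integrable (fun y : Config N => Real.exp (r * energy y.toReal)) ν) :
    Integrable (fun y : Config N => Real.exp (r * energy y.toReal)) μ := by
  refine ⟨(measurable_energy.const_mul r).exp.aestronglyMeasurable, ?_⟩
  have h1 := (hasFiniteIntegral_iff_ofReal (ae_of_all _ fun y => (Real.exp_pos _).le)).1 hν.2
  rw [hasFiniteIntegral_iff_ofReal (ae_of_all _ fun y => (Real.exp_pos _).le)]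
  convert h1 using 1
  rw [lintegral_exp_energy_eq_tsum hr, lintegral_exp_energy_eq_tsum hr]
  refine tsum_congr fun n => ?_
  obtain ⟨a, h2, h3⟩ := h ((∑ l : Fin N, MvPolynomial.X l) ^ n)
  have h0 : ∀ y : Config N, 0 ≤ energy y.toReal ^ n :=
    fun y => pow_nonneg (energy_nonneg y.toReal_pos) n
  simp only [map_pow, ← energy_eq_eval] at h2 h3
  rw [h2.lintegral_eq h0, h3.lintegral_eq h0]

theorem eval_linear (t y : Fin N → ℝ) :
    ∑ l, t l * y l = MvPolynomial.eval y (∑ l : Fin N, MvPolynomial.C (t l) * MvPolynomial.X l) := by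
  simp [map_sum]

theorem measurable_linear (t : Fin N → ℝ) :
    Measurable fun y : Config N => ∑ l, t l * y.toReal l := by
  simpa only [eval_linear] using measurable_eval _

theorem zero_mem_interior_integrableExpSet_linear [IsProbabilityMeasure μ] {r : ℝ} (hr : 0 < r)
    (hμ : Integrable (fun y : Config N => Real.exp (r * energy y.toReal)) μ) (t : Fin N → ℝ) :
    0 ∈ interior (integrableExpSet (fun y : Config N => ∑ l, t l * y.toReal l) μ) := by
  set B : ℝ := ∑ l, |t l| + 1 with hB
  have hB0 : 0 < B := by positivity
  rw [mem_interior]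
  refine ⟨Set.Ioo (-(r / B)) (r / B), fun z hz => ?_, isOpen_Ioo, by
    rw [Set.mem_Ioo]; constructor <;> [linarith [div_pos hr hB0]; positivity]⟩
  refine hμ.mono' ((measurable_linear t).const_mul z).exp.aestronglyMeasurable
    (ae_of_all _ fun y => ?_)
  rw [Real.norm_of_nonneg (Real.exp_pos _).le, Real.exp_le_exp]
  have hE := energy_nonneg y.toReal_pos
  have h1 : |∑ l, t l * y.toReal l| ≤ B * energy y.toReal := by
    calc |∑ l, t l * y.toReal l| ≤ ∑ l, |t l * y.toReal l| := Finset.abs_sum_le_sum_abs _ _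
      _ ≤ ∑ l, |t l| * energy y.toReal := Finset.sum_le_sum fun l _ => by
          rw [abs_mul, abs_of_pos (y.toReal_pos l)]
          exact mul_le_mul_of_nonneg_left (energy_pos_le y.toReal_pos l) (abs_nonneg _)
      _ ≤ B * energy y.toReal := by
          rw [← Finset.sum_mul]
          exact mul_le_mul_of_nonneg_right (by linarith) hE
  have h2 : |z| ≤ r / B := (abs_lt.2 hz).le
  calc z * ∑ l, t l * y.toReal l ≤ |z| * |∑ l, t l * y.toReal l| := by
        rw [← abs_mul]; exact le_abs_self _
    _ ≤ r / B * (B * energy y.toReal) :=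
        mul_le_mul h2 h1 (abs_nonneg _) (by positivity)
    _ = r * energy y.toReal := by field_simp

/-- A random variable with exponential moments is determined by its moments. -/
theorem complexMGF_I_eq_of_moments {Ω : Type*} [MeasurableSpace Ω] {μ ν : Measure Ω} {X : Ω → ℝ}
    (hμ : 0 ∈ interior (integrableExpSet X μ)) (hν : 0 ∈ interior (integrableExpSet X ν))
    (h : ∀ n : ℕ, ∫ ω, X ω ^ n ∂μ = ∫ ω, X ω ^ n ∂ν) :
    complexMGF X μ Complex.I = complexMGF X ν Complex.I := by
  have hA : AnalyticOnNhd ℂ (complexMGF X μ)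
      {z | z.re ∈ interior (integrableExpSet X μ) ∩ interior (integrableExpSet X ν)} :=
    analyticOnNhd_complexMGF.mono fun z hz => hz.1
  have hA' : AnalyticOnNhd ℂ (complexMGF X ν)
      {z | z.re ∈ interior (integrableExpSet X μ) ∩ interior (integrableExpSet X ν)} :=
    analyticOnNhd_complexMGF.mono fun z hz => hz.2
  have hpre : IsPreconnected {z : ℂ | z.re ∈ interior (integrableExpSet X μ) ∩
      interior (integrableExpSet X ν)} :=
    ((convex_integrableExpSet.interior.inter convex_integrableExpSet.interior).linear_preimage
      Complex.reLm).isPreconnected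
  have hμ' : (0 : ℂ).re ∈ interior (integrableExpSet X μ) := by simpa using hμ
  have hν' : (0 : ℂ).re ∈ interior (integrableExpSet X ν) := by simpa using hν
  have hd : ∀ n, iteratedDeriv n (complexMGF X μ) 0 = iteratedDeriv n (complexMGF X ν) 0 := by
    intro n
    rw [iteratedDeriv_complexMGF hμ', iteratedDeriv_complexMGF hν']
    simp only [zero_mul, Complex.exp_zero, mul_one]
    have h1 := congrArg (fun x : ℝ => (x : ℂ)) (h n)
    simpa only [← integral_complex_ofReal, Complex.ofReal_pow] using h1
  have h1 := (analyticAt_complexMGF hμ').hasFPowerSeriesAt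
  have h2 := (analyticAt_complexMGF hν').hasFPowerSeriesAt
  simp only [hd] at h1
  have h3 : complexMGF X μ =ᶠ[𝓝 0] complexMGF X ν := by
    filter_upwards [h1.eventually_hasSum_sub, h2.eventually_hasSum_sub] with z hz hz'
    exact hz.unique hz'
  exact hA.eqOn_of_preconnected_of_eventuallyEq hA' hpre (z₀ := 0) ⟨hμ', hν'⟩ h3
    (by simpa using ⟨hμ, hν⟩)

/-- A law on `Config N` with exponential moments is determined by its moments. -/
theorem eq_of_moments [IsProbabilityMeasure μ] [IsProbabilityMeasure ν] {r : ℝ} (hr : 0 < r)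
    (h : ∀ p : MvPolynomial (Fin N) ℝ, ∃ a, HasMean μ (fun y => MvPolynomial.eval y.toReal p) a ∧
      HasMean ν (fun y => MvPolynomial.eval y.toReal p) a)
    (hν : Integrable (fun y : Config N => Real.exp (r * energy y.toReal)) ν) : μ = ν := by
  have hμ := integrable_exp_energy_of_moments hr.le h hν
  set e : Config N → EuclideanSpace ℝ (Fin N) := fun y => WithLp.toLp 2 y.toReal with he
  have hem : Measurable e := (WithLp.measurable_toLp 2 _).comp Config.measurable_toReal
  have : StandardBorelSpace PosReal := measurableSet_Ioi.standardBorel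
  have heinj : Function.Injective e := fun y z hyz => by
    funext l
    have := congrArg (fun v : EuclideanSpace ℝ (Fin N) => v l) hyz
    exact Subtype.ext this
  have hemb : MeasurableEmbedding e := hem.measurableEmbedding heinj
  refine hemb.map_injective ?_
  have := Measure.isProbabilityMeasure_map (μ := μ) hem.aemeasurable
  have := Measure.isProbabilityMeasure_map (μ := ν) hem.aemeasurable
  refine Measure.ext_of_charFun (funext fun t => ?_)
  have hc : ∀ ρ : Measure (Config N), charFun (ρ.map e) t
      = complexMGF (fun y : Config N => ∑ l, t l * y.toReal l) ρ Complex.I := by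
    intro ρ
    rw [charFun_apply, integral_map hem.aemeasurable (by fun_prop), complexMGF]
    refine integral_congr_ae (ae_of_all _ fun y => ?_)
    simp only [he, PiLp.inner_apply, RCLike.inner_apply, conj_trivial]
    rw [mul_comm]
  rw [hc, hc]
  refine complexMGF_I_eq_of_moments (zero_mem_interior_integrableExpSet_linear hr hμ t)
    (zero_mem_interior_integrableExpSet_linear hr hν t) fun n => ?_
  obtain ⟨a, h1, h2⟩ := h ((∑ l : Fin N, MvPolynomial.C (t l) * MvPolynomial.X l) ^ n)
  simp only [map_pow, ← eval_linear] at h1 h2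
  rw [h1.2, h2.2]

theorem exists_hasMean_eval_of_dualFun {s : ℝ} (hs : 0 < s) {M : (Fin N → ℕ) → ℝ}
    (hμ : ∀ ξ, HasMean μ (fun y => dualFun s ξ y.toReal) (M ξ))
    (hν : ∀ ξ, HasMean ν (fun y => dualFun s ξ y.toReal) (M ξ)) (p : MvPolynomial (Fin N) ℝ) :
    ∃ a, HasMean μ (fun y => MvPolynomial.eval y.toReal p) a ∧
      HasMean ν (fun y => MvPolynomial.eval y.toReal p) a := by
  induction p using MvPolynomial.induction_on' with
  | add p q hp hq =>
    obtain ⟨a, h1, h2⟩ := hp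
    obtain ⟨b, h3, h4⟩ := hq
    simp only [map_add]
    exact ⟨a + b, h1.add h3, h2.add h4⟩
  | monomial ξ c =>
    rw [monomial_eq_smul_dualPoly hs]
    simp only [MvPolynomial.smul_eval, eval_dualPoly]
    exact ⟨_, (hμ ξ).const_mul _, (hν ξ).const_mul _⟩

end Determinacy

end HeatConduction

namespace HeatConduction

/-! ### The stationary measure as a mixture of products of Gamma laws -/

theorem HasMean.map {Ω Ω' : Type*} [MeasurableSpace Ω] [MeasurableSpace Ω'] {μ : Measure Ω}
    {g : Ω → Ω'} {f : Ω' → ℝ} {a : ℝ} (hg : Measurable g) (hf : Measurable f)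
    (h : HasMean μ (fun x => f (g x)) a) : HasMean (μ.map g) f a :=
  ⟨(integrable_map_measure hf.aestronglyMeasurable hg.aemeasurable).2 h.1, by
    rw [integral_map hg.aemeasurable hf.aestronglyMeasurable, h.2]⟩

theorem HasMean.of_map {Ω Ω' : Type*} [MeasurableSpace Ω] [MeasurableSpace Ω'] {μ : Measure Ω}
    {g : Ω → Ω'} {f : Ω' → ℝ} {a : ℝ} (hg : Measurable g) (hf : Measurable f)
    (h : HasMean (μ.map g) f a) : HasMean μ (fun x => f (g x)) a :=
  ⟨(integrable_map_measure hf.aestronglyMeasurable hg.aemeasurable).1 h.1, by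
    rw [← h.2, integral_map hg.aemeasurable hf.aestronglyMeasurable]⟩

theorem isProbabilityMeasure_gammaProduct {s lam : ℝ} (hs : 0 < s) (hlam : 0 < lam) :
    IsProbabilityMeasure (gammaProduct s lam) := by
  have := isProbabilityMeasure_gammaPos (a := 2 * s) (r := lam) (by positivity) hlam
  unfold gammaProduct
  infer_instance

theorem gammaProduct_map_fin {s : ℝ} (hs : 0 < s) (N : ℕ) :
    (gammaProduct s 1).map (fun z (i : Fin N) => z i) = gammaConfig s N := by
  have := isProbabilityMeasure_gammaPos (a := 2 * s) (r := 1) (by positivity) one_pos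
  have h := (iIndepFun_infinitePi (P := fun _ : ℕ => gammaPos (2 * s) 1) (X := fun _ z => z)
    fun _ => measurable_id).precomp (g := fun i : Fin N => (i : ℕ)) Fin.val_injective
  rw [iIndepFun_iff_map_fun_eq_pi_map fun i => (measurable_pi_apply _).aemeasurable] at h
  rw [gammaProduct, h, gammaConfig]
  congr 1
  funext i
  exact Measure.infinitePi_map_eval _ _

theorem gammaProduct_map_shift {s lam : ℝ} (hs : 0 < s) (hlam : 0 < lam) (k : ℕ) :
    (gammaProduct s lam).map (fun z j => z (k + j)) = gammaProduct s lam := by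
  have := isProbabilityMeasure_gammaPos (a := 2 * s) (r := lam) (by positivity) hlam
  have h := (iIndepFun_infinitePi (P := fun _ : ℕ => gammaPos (2 * s) lam) (X := fun _ z => z)
    fun _ => measurable_id).precomp (g := fun j : ℕ => k + j) (add_right_injective k)
  rw [iIndepFun_iff_map_fun_eq_infinitePi_map fun i => measurable_pi_apply _] at h
  rw [gammaProduct, h]
  congr 1
  funext i
  exact Measure.infinitePi_map_eval _ _

/-- Multiplication of positive reals. -/
def posMul (a b : PosReal) : PosReal := ⟨a * b, Set.mem_Ioi.2 (mul_pos a.2 b.2)⟩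

theorem continuous_posMul : Continuous fun p : PosReal × PosReal => posMul p.1 p.2 :=
  (by fun_prop : Continuous fun p : PosReal × PosReal => (p.1 : ℝ) * p.2).subtype_mk _

theorem measurable_posMul {Ω : Type*} [MeasurableSpace Ω] {f g : Ω → PosReal} (hf : Measurable f)
    (hg : Measurable g) : Measurable fun x => posMul (f x) (g x) :=
  ((measurable_subtype_coe.comp hf).mul (measurable_subtype_coe.comp hg)).subtype_mk

section Mixture

variable {N : ℕ} {s TL TR : ℝ}

/-- The hidden temperatures as positive reals. -/
noncomputable def hiddenTempPos (hL : 0 < TL) (hR : 0 < TR) (X : Config (N + 1)) (l : ℕ) : PosReal :=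
  ⟨hiddenTemp TL TR X.toReal l, hiddenTemp_pos hL hR X.toReal_pos l⟩

theorem measurable_hiddenTempPos (hL : 0 < TL) (hR : 0 < TR) (l : ℕ) :
    Measurable fun X : Config (N + 1) => hiddenTempPos hL hR X l :=
  (measurable_hiddenTemp TL TR l).subtype_mk

/-- The energies with hidden temperatures built from `p.1` and fluctuations `p.2`. -/
noncomputable def mixtureMap (hL : 0 < TL) (hR : 0 < TR) (p : Config (N + 1) × (ℕ → PosReal)) :
    Config N :=
  fun i => posMul (hiddenTempPos hL hR p.1 (i + 1)) (p.2 i)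

theorem measurable_mixtureMap (hL : 0 < TL) (hR : 0 < TR) :
    Measurable (mixtureMap hL hR : Config (N + 1) × (ℕ → PosReal) → Config N) :=
  measurable_pi_lambda _ fun _ => measurable_posMul
    ((measurable_hiddenTempPos hL hR _).comp measurable_fst)
    ((measurable_pi_apply _).comp measurable_snd)

/-- The mixture of products of Gamma laws with random hidden temperatures. -/
noncomputable def mixture (s : ℝ) (hL : 0 < TL) (hR : 0 < TR) (N : ℕ) : Measure (Config N) :=
  ((gammaConfig s (N + 1)).prod (gammaProduct s 1)).map (mixtureMap hL hR)

theorem isProbabilityMeasure_mixture (hs : 0 < s) (hL : 0 < TL) (hR : 0 < TR) (N : ℕ) :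
    IsProbabilityMeasure (mixture s hL hR N) := by
  have := isProbabilityMeasure_gammaConfig hs (N + 1)
  have := isProbabilityMeasure_gammaProduct hs one_pos
  exact Measure.isProbabilityMeasure_map (measurable_mixtureMap hL hR).aemeasurable

theorem dualFun_mixtureMap (hL : 0 < TL) (hR : 0 < TR) (ξ : Fin N → ℕ)
    (p : Config (N + 1) × (ℕ → PosReal)) :
    dualFun s ξ (mixtureMap hL hR p).toReal
      = hiddenMono TL TR ξ p.1.toReal * dualFun s ξ (fun i : Fin N => (p.2 i : ℝ)) := by
  rw [hiddenMono, dualFun, dualFun, ← Finset.prod_mul_distrib]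
  refine Finset.prod_congr rfl fun l _ => ?_
  have : (mixtureMap hL hR p).toReal l = hiddenTemp TL TR p.1.toReal (l + 1) * p.2 l := rfl
  rw [this, mul_pow]
  ring

theorem measurable_restrict_fin (N : ℕ) :
    Measurable fun (z : ℕ → PosReal) (i : Fin N) => z i :=
  measurable_pi_lambda _ fun _ => measurable_pi_apply _

theorem hasMean_dualFun_mixture (hs : 0 < s) (hL : 0 < TL) (hR : 0 < TR) (ξ : Fin N → ℕ) :
    HasMean (mixture s hL hR N) (fun y => dualFun s ξ y.toReal)
      (∫ X : Config (N + 1), hiddenMono TL TR ξ X.toReal ∂(gammaConfig s (N + 1))) := by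
  have := isProbabilityMeasure_gammaConfig hs (N + 1)
  have := isProbabilityMeasure_gammaProduct hs one_pos
  refine HasMean.map (measurable_mixtureMap hL hR) (measurable_dualFun s ξ) ?_
  have h := hasMean_dualFun_mul_exp (K := N) hs ξ (c := 0) (by norm_num)
  simp only [zero_mul, neg_zero, Real.exp_zero, mul_one, add_zero, div_one, Real.one_rpow] at h
  rw [← gammaProduct_map_fin hs] at h
  have h' := h.of_map (measurable_restrict_fin N) (measurable_dualFun s ξ)
  simp only [dualFun_mixtureMap]
  exact ⟨(integrable_hiddenMono hs hL hR ξ).mul_prod h'.1, by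
    rw [integral_prod_mul (fun X : Config (N + 1) => hiddenMono TL TR ξ X.toReal)
      (fun z : ℕ → PosReal => dualFun s ξ fun i : Fin N => (z i : ℝ))]
    exact (congrArg _ h'.2).trans (mul_one _)⟩

theorem integrable_exp_energy_mixture (hs : 0 < s) (hL : 0 < TL) (hR : 0 < TR) (N : ℕ) :
    Integrable (fun y : Config N => Real.exp ((2 * (TL + TR))⁻¹ * energy y.toReal))
      (mixture s hL hR N) := by
  have := isProbabilityMeasure_gammaConfig hs (N + 1)
  have := isProbabilityMeasure_gammaProduct hs one_pos
  have hm : Measurable fun y : Config N => Real.exp ((2 * (TL + TR))⁻¹ * energy y.toReal) :=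
    (measurable_energy.const_mul _).exp
  refine (integrable_map_measure hm.aestronglyMeasurable
    (measurable_mixtureMap hL hR).aemeasurable).2 ?_
  have h := hasMean_dualFun_mul_exp (K := N) hs 0 (c := -(1 / 2)) (by norm_num)
  simp only [dualFun, Pi.zero_apply, rising_zero hs, pow_zero, inv_one, mul_one,
    Finset.prod_const_one, one_mul] at h
  rw [← gammaProduct_map_fin hs] at h
  have h' := h.of_map (measurable_restrict_fin N) (measurable_energy.const_mul _).neg.exp
  refine (h'.1.comp_snd (gammaConfig s (N + 1))).mono'
    (hm.comp (measurable_mixtureMap hL hR)).aestronglyMeasurable (ae_of_all _ fun p => ?_)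
  change ‖Real.exp ((2 * (TL + TR))⁻¹ * energy (mixtureMap hL hR p).toReal)‖
    ≤ Real.exp (-(-(1 / 2) * energy (Config.toReal fun i : Fin N => p.2 i)))
  rw [Real.norm_of_nonneg (Real.exp_pos _).le]
  refine Real.exp_le_exp.2 ?_
  rw [neg_mul, neg_neg, energy, energy, Finset.mul_sum, Finset.mul_sum]
  refine Finset.sum_le_sum fun l _ => ?_
  have h1 : (mixtureMap hL hR p).toReal l = hiddenTemp TL TR p.1.toReal (l + 1) * p.2 l := rfl
  have h2 : Config.toReal (fun i : Fin N => p.2 i) l = (p.2 l : ℝ) := rfl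
  have h3 := hiddenTemp_le hL hR p.1.toReal_pos (l + 1)
  have h4 : 0 < (p.2 l : ℝ) := (p.2 l).2
  rw [h1, h2, ← mul_assoc]
  refine mul_le_mul_of_nonneg_right ?_ h4.le
  rw [inv_mul_le_iff₀ (by positivity)]
  linarith

/-- The stationary measure is the mixture of products of Gamma laws. -/
theorem eq_mixture_of_isStationary {lamL lamR : ℝ}
    {P : NNReal → Kernel (Config N) (Config N)} (hP : IsHeatSemigroup s lamL lamR P) (hs : 0 < s)
    (hL : 0 < lamL) (hR : 0 < lamR) (hN : 1 ≤ N) {μ : Measure (Config N)}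
    (hμ : IsStationary P μ) :
    μ = mixture s (one_div_pos.2 hL) (one_div_pos.2 hR) N := by
  have := hμ.1
  have := isProbabilityMeasure_gammaConfig hs (N + 1)
  have := isProbabilityMeasure_mixture hs (one_div_pos.2 hL) (one_div_pos.2 hR) N
  have hM := dualGenerator_unique hs hN
    (M₁ := fun η => ∫ z : Config N, dualFun s η z.toReal ∂μ)
    (M₂ := fun η => ∫ X : Config (N + 1), hiddenMono (1 / lamL) (1 / lamR) η X.toReal
      ∂(gammaConfig s (N + 1)))
    (by simp [dualFun, hiddenMono, rising_zero hs])
    (dualGenerator_moment_eq_zero hP hs hL hR hN hμ)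
    (dualGenerator_hidden_eq_zero hs (one_div_pos.2 hL) (one_div_pos.2 hR))
  refine eq_of_moments (r := (2 * (1 / lamL + 1 / lamR))⁻¹) (by positivity)
    (exists_hasMean_eval_of_dualFun hs (fun ξ => ⟨?_, congrFun hM ξ⟩)
      (hasMean_dualFun_mixture hs (one_div_pos.2 hL) (one_div_pos.2 hR)))
    (integrable_exp_energy_mixture hs _ _ N)
  simpa only [eval_dualPoly] using
    integrable_eval_of_isStationary hP hs hL hR hN hμ (dualPoly s ξ)

end Mixture

end HeatConduction

namespace HeatConduction

/-! ### Concentration of the hidden temperatures -/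

section Concentration

variable {K : ℕ} {s : ℝ}

theorem rising_one (hs : 0 < s) : rising s 1 = 2 * s := by
  simpa [rising_zero hs] using rising_succ hs 0

theorem rising_two (hs : 0 < s) : rising s 2 = (2 * s) ^ 2 + 2 * s := by
  rw [rising_succ hs 1, rising_one hs]
  push_cast
  ring

theorem dualFun_single (hs : 0 < s) (j : Fin K) (n : ℕ) (y : Fin K → ℝ) :
    dualFun s (Pi.single j n) y = (rising s n)⁻¹ * y j ^ n := by
  rw [dualFun, Finset.prod_eq_single j]
  · rw [Pi.single_eq_same]
  · intro l _ hl
    rw [Pi.single_eq_of_ne hl, rising_zero hs, pow_zero, inv_one, one_mul]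
  · simp

theorem mul_eq_dualFun (hs : 0 < s) (j k : Fin K) (y : Fin K → ℝ) :
    y j * y k = ((2 * s) ^ 2 + if j = k then 2 * s else 0)
      * dualFun s (Pi.single j 1 + Pi.single k 1) y := by
  split_ifs with h
  · subst h
    rw [← Pi.single_add, one_add_one_eq_two, dualFun_single hs, rising_two hs,
      mul_inv_cancel_left₀ (by positivity), sq]
  · rw [dualFun, Finset.prod_eq_mul j k h]
    · simp only [Pi.add_apply, Pi.single_eq_same, Pi.single_eq_of_ne h,
        Pi.single_eq_of_ne (Ne.symm h), add_zero, zero_add, rising_one hs, pow_one]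
      field_simp
    · intro l _ hl
      rw [Pi.add_apply, Pi.single_eq_of_ne hl.1, Pi.single_eq_of_ne hl.2, add_zero, rising_zero hs,
        pow_zero, inv_one, one_mul]
    · simp
    · simp

theorem hasMean_linear_div_energy (hs : 0 < s) (hK : 0 < K) (c : Fin K → ℝ) :
    HasMean (gammaConfig s K) (fun X => (∑ j, c j * X.toReal j) / energy X.toReal)
      ((∑ j, c j) / K) := by
  have := isProbabilityMeasure_gammaConfig hs K
  have hK' : (K : ℝ) ≠ 0 := by positivity
  obtain ⟨C, hC⟩ := hasMean_dualFun_div_energy hs hK 1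
  have key : ∀ c : Fin K → ℝ, HasMean (gammaConfig s K)
      (fun X => (∑ j, c j * X.toReal j) / energy X.toReal) ((∑ j, c j) * (2 * s * C)) := by
    intro c
    have h := HasMean.sum (μ := gammaConfig s K) Finset.univ
      (f := fun j (X : Config K) => c j * (2 * s) *
        (dualFun s (Pi.single j 1) X.toReal / energy X.toReal ^ 1))
      (a := fun j => c j * (2 * s) * C)
      fun j => (hC (Pi.single j 1) (by simp)).const_mul _
    convert h using 1
    · funext X
      rw [Finset.sum_div]
      refine Finset.sum_congr rfl fun j _ => ?_
      rw [dualFun_single hs, rising_one hs]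
      field_simp
    · rw [Finset.sum_mul]
      exact Finset.sum_congr rfl fun j _ => by ring
  have h1 := (key fun _ => 1).2
  have h2 : ∀ X : Config K, (∑ j, 1 * X.toReal j) / energy X.toReal = 1 := fun X => by
    simp only [one_mul]
    exact div_self (energy_toReal_pos hK X).ne'
  simp only [h2, integral_const, probReal_univ, smul_eq_mul, Finset.sum_const, Finset.card_univ,
    Fintype.card_fin, nsmul_eq_mul, mul_one] at h1
  have h3 : 2 * s * C = 1 / K := by
    rw [eq_div_iff hK', mul_comm]
    exact h1.symm
  have h4 := key c
  rwa [h3, mul_one_div] at h4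

theorem hasMean_sq_linear_div_energy (hs : 0 < s) (hK : 0 < K) (c : Fin K → ℝ) :
    HasMean (gammaConfig s K) (fun X => ((∑ j, c j * X.toReal j) / energy X.toReal) ^ 2)
      (((2 * s) ^ 2 * (∑ j, c j) ^ 2 + 2 * s * ∑ j, c j ^ 2) / ((2 * s) ^ 2 * K ^ 2 + 2 * s * K)) := by
  have := isProbabilityMeasure_gammaConfig hs K
  have hK' : (0 : ℝ) < K := by positivity
  obtain ⟨C, hC⟩ := hasMean_dualFun_div_energy hs hK 2
  have key : ∀ c : Fin K → ℝ, HasMean (gammaConfig s K)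
      (fun X => ((∑ j, c j * X.toReal j) / energy X.toReal) ^ 2)
      (((2 * s) ^ 2 * (∑ j, c j) ^ 2 + 2 * s * ∑ j, c j ^ 2) * C) := by
    intro c
    have h := HasMean.sum (μ := gammaConfig s K) Finset.univ
      (f := fun j (X : Config K) => ∑ k, c j * c k * ((2 * s) ^ 2 + if j = k then 2 * s else 0) *
        (dualFun s (Pi.single j 1 + Pi.single k 1) X.toReal / energy X.toReal ^ 2))
      (a := fun j => ∑ k, c j * c k * ((2 * s) ^ 2 + if j = k then 2 * s else 0) * C)
      fun j => HasMean.sum Finset.univ fun k =>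
        (hC (Pi.single j 1 + Pi.single k 1) (by simp [Finset.sum_add_distrib])).const_mul _
    convert h using 1
    · funext X
      rw [div_pow, sq (∑ j, _), Finset.sum_mul_sum, Finset.sum_div]
      refine Finset.sum_congr rfl fun j _ => ?_
      rw [Finset.sum_div]
      refine Finset.sum_congr rfl fun k _ => ?_
      rw [mul_mul_mul_comm, mul_eq_dualFun hs j k X.toReal]
      ring
    · simp only [mul_add, add_mul, Finset.sum_add_distrib, mul_ite, mul_zero, ite_mul, zero_mul,
        Finset.sum_ite_eq, Finset.mem_univ, if_true]
      congr 1
      · rw [sq (∑ j, _), Finset.sum_mul_sum, Finset.mul_sum, Finset.sum_mul]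
        refine Finset.sum_congr rfl fun j _ => ?_
        rw [Finset.mul_sum, Finset.sum_mul]
        exact Finset.sum_congr rfl fun k _ => by ring
      · rw [Finset.mul_sum, Finset.sum_mul]
        exact Finset.sum_congr rfl fun k _ => by ring
  have h1 := (key fun _ => 1).2
  have h2 : ∀ X : Config K, ((∑ j, 1 * X.toReal j) / energy X.toReal) ^ 2 = 1 := fun X => by
    simp only [one_mul]
    rw [← energy, div_self (energy_toReal_pos hK X).ne', one_pow]
  simp only [h2, integral_const, probReal_univ, smul_eq_mul, Finset.sum_const, Finset.card_univ,
    Fintype.card_fin, nsmul_eq_mul, mul_one, one_pow] at h1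
  have h3 : C = 1 / ((2 * s) ^ 2 * K ^ 2 + 2 * s * K) := by
    rw [eq_div_iff (by positivity), mul_comm]
    exact h1.symm
  have h4 := key c
  rwa [h3, mul_one_div] at h4

variable {N : ℕ} {TL TR : ℝ}

theorem sum_reservoir_coeff (TL TR : ℝ) {l : ℕ} (hl : l ≤ N + 1) :
    ∑ j : Fin (N + 1), (if (j : ℕ) < l then TR else TL) = TL * (N + 1) + (TR - TL) * l := by
  obtain ⟨m, hm⟩ := Nat.exists_eq_add_of_le hl
  rw [Fin.sum_univ_eq_sum_range (fun j => if j < l then TR else TL), hm, Finset.sum_range_add,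
    Finset.sum_congr rfl fun j hj => if_pos (Finset.mem_range.1 hj)]
  simp only [Finset.sum_const, Finset.card_range, nsmul_eq_mul, Nat.not_lt.2 (Nat.le_add_right l _),
    if_false]
  have : (N : ℝ) + 1 = l + m := by exact_mod_cast hm
  rw [this]
  ring

theorem hasMean_hiddenTemp (hs : 0 < s) (TL TR : ℝ) {l : ℕ} (hl : l ≤ N + 1) :
    HasMean (gammaConfig s (N + 1)) (fun X => hiddenTemp TL TR X.toReal l)
      (TL + (TR - TL) * l / (N + 1)) := by
  have h := hasMean_linear_div_energy hs (Nat.succ_pos N)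
    (fun j : Fin (N + 1) => if (j : ℕ) < l then TR else TL)
  rw [sum_reservoir_coeff TL TR hl] at h
  convert h using 1
  · rfl
  · push_cast
    field_simp

/-- Concentration of the hidden temperatures around the linear profile. -/
theorem integral_sq_hiddenTemp_sub_le (hs : 0 < s) (TL TR : ℝ) {u : ℝ} (hu : u ∈ Set.Icc (0 : ℝ) 1)
    {l : ℕ} (hl : l ≤ N + 1) :
    ∫ X : Config (N + 1), (hiddenTemp TL TR X.toReal l - temperature TL TR u) ^ 2
        ∂(gammaConfig s (N + 1))
      ≤ (TR - TL) ^ 2 * (((l - u * (N + 1)) / (N + 1)) ^ 2 + 1 / (2 * s * (N + 1))) := by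
  set c : Fin (N + 1) → ℝ := fun j => (if (j : ℕ) < l then TR else TL) - temperature TL TR u with hc
  have h1 : ∀ X : Config (N + 1), hiddenTemp TL TR X.toReal l - temperature TL TR u
      = (∑ j, c j * X.toReal j) / energy X.toReal := fun X => by
    have hE := energy_toReal_pos (Nat.succ_pos N) X
    simp only [hc, sub_mul, Finset.sum_sub_distrib, ← Finset.mul_sum]
    rw [show ∑ j, X.toReal j = energy X.toReal from rfl, sub_div, mul_div_cancel_right₀ _ hE.ne', hiddenTemp]
  have hsum : ∑ j, c j = (TR - TL) * (l - u * (N + 1)) := by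
    rw [hc, Finset.sum_sub_distrib, sum_reservoir_coeff TL TR hl]
    simp [temperature]
    ring
  have hsq : ∑ j, c j ^ 2 ≤ (N + 1) * (TR - TL) ^ 2 := by
    calc ∑ j, c j ^ 2 ≤ ∑ j : Fin (N + 1), (TR - TL) ^ 2 := Finset.sum_le_sum fun j _ => by
          simp only [hc, temperature]
          have h1 : (1 - u) ^ 2 ≤ 1 := by nlinarith [hu.1, hu.2]
          have h2 : u ^ 2 ≤ 1 := by nlinarith [hu.1, hu.2]
          split_ifs
          · calc _ = (1 - u) ^ 2 * (TR - TL) ^ 2 := by ring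
              _ ≤ _ := mul_le_of_le_one_left (sq_nonneg _) h1
          · calc _ = u ^ 2 * (TR - TL) ^ 2 := by ring
              _ ≤ _ := mul_le_of_le_one_left (sq_nonneg _) h2
      _ = _ := by simp
  simp only [h1]
  rw [(hasMean_sq_linear_div_energy hs (Nat.succ_pos N) c).2, hsum]
  have hK : (0 : ℝ) < N + 1 := by positivity
  push_cast
  calc _ ≤ ((2 * s) ^ 2 * ((TR - TL) * (l - u * (N + 1))) ^ 2
        + 2 * s * ((N + 1) * (TR - TL) ^ 2)) / ((2 * s) ^ 2 * (N + 1) ^ 2) := by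
        have : 0 ≤ ∑ j, c j ^ 2 := Finset.sum_nonneg fun j _ => sq_nonneg _
        gcongr
        exact le_add_of_nonneg_right (by positivity)
    _ = _ := by field_simp

end Concentration

/-- Concentration in mean square implies convergence in law to a point mass. -/
theorem tendsto_integral_of_tendsto_integral_sq {Ω : ℕ → Type*} [∀ n, MeasurableSpace (Ω n)]
    {μ : (n : ℕ) → Measure (Ω n)} [∀ n, IsProbabilityMeasure (μ n)]
    {Y : (n : ℕ) → Ω n → ℕ → PosReal} (hY : ∀ n, Measurable (Y n)) {c : ℕ → PosReal}
    (hi : ∀ j n, Integrable (fun ω => ((Y n ω j : ℝ) - c j) ^ 2) (μ n))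
    (h : ∀ j, Tendsto (fun n => ∫ ω, ((Y n ω j : ℝ) - c j) ^ 2 ∂(μ n)) atTop (𝓝 0))
    {G : (ℕ → PosReal) → ℝ} (hG : Continuous G) {B : ℝ} (hB : ∀ τ, |G τ| ≤ B) :
    Tendsto (fun n => ∫ ω, G (Y n ω) ∂(μ n)) atTop (𝓝 (G c)) := by
  have hB0 : 0 ≤ B := (abs_nonneg _).trans (hB c)
  rw [Metric.tendsto_atTop']
  intro ε hε
  have hnhds : {τ | |G τ - G c| < ε / 2} ∈ 𝓝 c :=
    hG.continuousAt.eventually (Metric.ball_mem_nhds (G c) (half_pos hε))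
  rw [nhds_pi, Filter.mem_pi] at hnhds
  obtain ⟨I, hI, t, ht, hsub⟩ := hnhds
  have hδ : ∀ j, ∃ δ > 0, ∀ x : PosReal, |(x : ℝ) - c j| < δ → x ∈ t j := fun j => by
    obtain ⟨δ, hδ, hb⟩ := Metric.mem_nhds_iff.1 (ht j)
    exact ⟨δ, hδ, fun x hx => hb hx⟩
  choose δ hδ hδt using hδ
  lift I to Finset ℕ using hI
  have hbound : ∀ τ : ℕ → PosReal,
      |G τ - G c| ≤ ε / 2 + ∑ j ∈ I, 2 * B / δ j ^ 2 * ((τ j : ℝ) - c j) ^ 2 := by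
    intro τ
    have hnn : ∀ j ∈ I, 0 ≤ 2 * B / δ j ^ 2 * ((τ j : ℝ) - c j) ^ 2 := fun j _ => by positivity
    by_cases hτ : τ ∈ (I : Set ℕ).pi t
    · have h1 : |G τ - G c| < ε / 2 := hsub hτ
      linarith [Finset.sum_nonneg hnn]
    · simp only [Set.mem_pi, not_forall] at hτ
      obtain ⟨j, hj, hjt⟩ := hτ
      have h1 : δ j ≤ |(τ j : ℝ) - c j| := not_lt.1 fun h => hjt (hδt j _ h)
      have h2 : δ j ^ 2 ≤ ((τ j : ℝ) - c j) ^ 2 := by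
        rw [← sq_abs ((τ j : ℝ) - c j)]
        exact pow_le_pow_left₀ (hδ j).le h1 2
      have h3 : 2 * B ≤ 2 * B / δ j ^ 2 * ((τ j : ℝ) - c j) ^ 2 := by
        have := hδ j
        rw [div_mul_eq_mul_div, le_div_iff₀ (by positivity)]
        exact mul_le_mul_of_nonneg_left h2 (by positivity)
      have h4 := Finset.single_le_sum hnn (Finset.mem_coe.1 hj)
      have h5 : |G τ - G c| ≤ B + B := (abs_sub _ _).trans (add_le_add (hB _) (hB _))
      linarith
  have hlim : Tendsto (fun n => ∑ j ∈ I, 2 * B / δ j ^ 2 * ∫ ω, ((Y n ω j : ℝ) - c j) ^ 2 ∂(μ n))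
      atTop (𝓝 0) := by
    have := tendsto_finsetSum I fun j _ => (h j).const_mul (2 * B / δ j ^ 2)
    simpa using this
  obtain ⟨n₀, hn₀⟩ := eventually_atTop.1 (hlim.eventually_lt_const (half_pos hε))
  refine ⟨n₀, fun n hn => ?_⟩
  have hGi : Integrable (fun ω => G (Y n ω)) (μ n) :=
    (integrable_const B).mono' (hG.measurable.comp (hY n)).aestronglyMeasurable
      (ae_of_all _ fun ω => hB _)
  have hsi : Integrable (fun ω => ∑ j ∈ I, 2 * B / δ j ^ 2 * ((Y n ω j : ℝ) - c j) ^ 2) (μ n) :=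
    integrable_finsetSum _ fun j _ => (hi j n).const_mul _
  rw [Real.dist_eq]
  calc |∫ ω, G (Y n ω) ∂(μ n) - G c| = |∫ ω, (G (Y n ω) - G c) ∂(μ n)| := by
        rw [integral_sub hGi (integrable_const _)]
        simp
    _ ≤ ∫ ω, |G (Y n ω) - G c| ∂(μ n) := abs_integral_le_integral_abs
    _ ≤ ∫ ω, (ε / 2 + ∑ j ∈ I, 2 * B / δ j ^ 2 * ((Y n ω j : ℝ) - c j) ^ 2) ∂(μ n) :=
        integral_mono (hGi.sub (integrable_const _)).abs ((integrable_const _).add hsi)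
          fun ω => hbound _
    _ = ε / 2 + ∑ j ∈ I, 2 * B / δ j ^ 2 * ∫ ω, ((Y n ω j : ℝ) - c j) ^ 2 ∂(μ n) := by
        rw [integral_add (integrable_const _) hsi,
          integral_finsetSum _ fun j _ => (hi j n).const_mul _]
        simp only [integral_const_mul]
        simp
    _ < ε := by linarith [hn₀ n hn.le]

end HeatConduction

namespace HeatConduction

/-! ### Local equilibrium -/

section LocalEquilibrium

variable {s TL TR : ℝ}

theorem temperature_pos (hL : 0 < TL) (hR : 0 < TR) {u : ℝ} (hu : u ∈ Set.Ioo (0 : ℝ) 1) :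
    0 < temperature TL TR u := by
  have h1 := mul_pos hL (sub_pos.2 hu.2)
  have h2 := mul_pos hR hu.1
  rw [temperature]
  linarith

/-- Rescaling a Gamma variable with rate `1`. -/
theorem gammaPos_map_posMul (a : ℝ) (T : PosReal) :
    (gammaPos a 1).map (posMul T) = gammaPos a (1 / T) := by
  have hT : (0 : ℝ) < T := T.2
  have hm : Measurable (posMul T) := measurable_posMul measurable_const measurable_id
  refine (MeasurableEmbedding.subtype_coe measurableSet_Ioi).map_injective ?_
  refine Measure.ext_of_lintegral _ fun g hg => ?_
  rw [lintegral_map hg measurable_subtype_coe, lintegral_map hg measurable_subtype_coe,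
    lintegral_map (f := fun z : PosReal => g z) (hg.comp measurable_subtype_coe) hm,
    lintegral_gammaPos _ _ hg]
  change ∫⁻ z : PosReal, g (T * z) ∂(gammaPos a 1) = _
  rw [lintegral_gammaPos _ _ (g := fun x => g (T * x)) (hg.comp (measurable_const_mul (T : ℝ)))]
  have himg : (fun x : ℝ => (T : ℝ) * x) '' Set.Ioi 0 = Set.Ioi 0 := by
    rw [Set.image_mul_left_Ioi hT, mul_zero]
  have hcv := lintegral_image_eq_lintegral_abs_deriv_mul measurableSet_Ioi
    (f := fun x : ℝ => (T : ℝ) * x) (f' := fun _ => (T : ℝ)) (s := Set.Ioi 0)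
    (fun x _ => by simpa using ((hasDerivAt_id x).const_mul (T : ℝ)).hasDerivWithinAt)
    (mul_right_injective₀ hT.ne').injOn
    (fun x => ENNReal.ofReal ((1 / (T : ℝ)) ^ a / Real.Gamma a * x ^ (a - 1)
      * Real.exp (-(1 / T * x))) * g x)
  rw [himg] at hcv
  rw [hcv]
  refine setLIntegral_congr_fun measurableSet_Ioi fun x hx => ?_
  have hx' : 0 < x := hx
  rw [← mul_assoc, ← ENNReal.ofReal_mul (abs_nonneg _), abs_of_pos hT]
  congr 2
  rw [Real.mul_rpow hT.le hx'.le, Real.one_rpow, Real.div_rpow zero_le_one hT.le, Real.one_rpow,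
    Real.rpow_sub_one hT.ne', show 1 / (T : ℝ) * (T * x) = 1 * x by field_simp]
  have : (T : ℝ) ^ a ≠ 0 := (Real.rpow_pos_of_pos hT a).ne'
  field_simp

theorem measurable_posMul_seq (τ : ℕ → PosReal) :
    Measurable fun (z : ℕ → PosReal) j => posMul (τ j) (z j) :=
  measurable_pi_lambda _ fun _ => measurable_posMul measurable_const (measurable_pi_apply _)

theorem gammaProduct_map_posMul (hs : 0 < s) (T : PosReal) :
    (gammaProduct s 1).map (fun z j => posMul T (z j)) = gammaProduct s (1 / T) := by
  have := isProbabilityMeasure_gammaPos (a := 2 * s) (r := 1) (by positivity) one_pos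
  rw [gammaProduct, Measure.infinitePi_map_pi (f := fun _ : ℕ => posMul T) _ fun _ =>
    measurable_posMul measurable_const measurable_id]
  simp only [gammaPos_map_posMul]
  rfl

/-- The mean of `f` under independent Gamma variables with scales `τ`. -/
noncomputable def scaledMean (s : ℝ) (f : (ℕ → PosReal) → ℝ) (τ : ℕ → PosReal) : ℝ :=
  ∫ z, f (fun j => posMul (τ j) (z j)) ∂(gammaProduct s 1)

variable (f : BoundedContinuousFunction (ℕ → PosReal) ℝ)

theorem continuous_scaledMean (hs : 0 < s) : Continuous (scaledMean s f) := by
  have := isProbabilityMeasure_gammaProduct hs one_pos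
  refine continuous_of_dominated (bound := fun _ => ‖f‖)
    (fun τ => (f.continuous.measurable.comp (measurable_posMul_seq τ)).aestronglyMeasurable)
    (fun τ => ae_of_all _ fun z => f.norm_coe_le_norm _) (integrable_const _)
    (ae_of_all _ fun z => f.continuous.comp (continuous_pi fun j =>
      continuous_posMul.comp (f := fun τ : ℕ → PosReal => (τ j, z j))
        ((continuous_apply j).prodMk continuous_const)))

theorem abs_scaledMean_le (hs : 0 < s) (τ : ℕ → PosReal) : |scaledMean s f τ| ≤ ‖f‖ := by
  have := isProbabilityMeasure_gammaProduct hs one_pos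
  have h := norm_integral_le_of_norm_le_const (μ := gammaProduct s 1)
    (f := fun z => f fun j => posMul (τ j) (z j)) (C := ‖f‖)
    (ae_of_all _ fun z => f.norm_coe_le_norm _)
  simpa [scaledMean] using h

theorem scaledMean_const (hs : 0 < s) (T : PosReal) :
    scaledMean s f (fun _ => T) = ∫ z, f z ∂(gammaProduct s (1 / T)) := by
  rw [← gammaProduct_map_posMul hs T, integral_map (measurable_posMul_seq _).aemeasurable
    f.continuous.measurable.aestronglyMeasurable, scaledMean]

theorem measurable_seenFrom {N : ℕ} (k : ℕ) :
    Measurable (seenFrom k : Config N → ℕ → PosReal) := by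
  refine measurable_pi_lambda _ fun j => ?_
  unfold seenFrom
  split_ifs
  · exact measurable_pi_apply _
  · exact measurable_const

theorem integral_seenFrom_mixture (hs : 0 < s) (hL : 0 < TL) (hR : 0 < TR) {S : Finset ℕ}
    (hS : DependsOn (f : (ℕ → PosReal) → ℝ) (S : Set ℕ)) {N k : ℕ} (hk : ∀ j ∈ S, k + j < N) :
    ∫ y, f (seenFrom k y) ∂(mixture s hL hR N)
      = ∫ X : Config (N + 1), scaledMean s f (fun j => hiddenTempPos hL hR X (k + j + 1))
          ∂(gammaConfig s (N + 1)) := by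
  have := isProbabilityMeasure_gammaConfig hs (N + 1)
  have := isProbabilityMeasure_gammaProduct hs one_pos
  have hfm := f.continuous.measurable
  rw [mixture, integral_map (f := fun y => f (seenFrom k y))
    (measurable_mixtureMap hL hR).aemeasurable (hfm.comp (measurable_seenFrom k)).aestronglyMeasurable, integral_prod]
  · refine integral_congr_ae (ae_of_all _ fun X => ?_)
    simp only
    rw [scaledMean]
    conv_rhs => rw [← gammaProduct_map_shift hs one_pos k]
    have hshift : Measurable fun (z : ℕ → PosReal) (j : ℕ) => z (k + j) :=
      measurable_pi_lambda _ fun j => measurable_pi_apply _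
    rw [integral_map hshift.aemeasurable (f := fun z : ℕ → PosReal =>
      f fun j => posMul (hiddenTempPos hL hR X (k + j + 1)) (z j))
      (hfm.comp (measurable_posMul_seq _)).aestronglyMeasurable]
    refine integral_congr_ae (ae_of_all _ fun z => hS fun j hj => ?_)
    rw [seenFrom, dif_pos (hk j hj)]
    rfl
  · exact (integrable_const ‖f‖).mono' ((hfm.comp (measurable_seenFrom k)).comp
      (measurable_mixtureMap hL hR)).aestronglyMeasurable (ae_of_all _ fun p =>
        f.norm_coe_le_norm _)

theorem tendsto_integral_sq_hiddenTemp (hs : 0 < s) (TL TR : ℝ) {u : ℝ}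
    (hu : u ∈ Set.Ioo (0 : ℝ) 1) (j : ℕ) :
    Tendsto (fun N : ℕ => ∫ X : Config (N + 1), (hiddenTemp TL TR X.toReal (⌊u * (N : ℝ)⌋₊ + j + 1)
      - temperature TL TR u) ^ 2 ∂(gammaConfig s (N + 1))) atTop (𝓝 0) := by
  have hlim : Tendsto (fun N : ℕ => (TR - TL) ^ 2 *
      ((((j : ℝ) + 1) * (1 / ((N : ℝ) + 1))) ^ 2 + 1 / (2 * s) * (1 / ((N : ℝ) + 1)))) atTop (𝓝 0) := by
    have h := tendsto_one_div_add_atTop_nhds_zero_nat (𝕜 := ℝ)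
    have := (((h.const_mul ((j : ℝ) + 1)).pow 2).add (h.const_mul (1 / (2 * s)))).const_mul
      ((TR - TL) ^ 2)
    simpa using this
  refine tendsto_of_tendsto_of_tendsto_of_le_of_le' tendsto_const_nhds hlim
    (Eventually.of_forall fun N => integral_nonneg fun X => sq_nonneg _) ?_
  filter_upwards [eventually_gt_atTop ⌈(j : ℝ) / (1 - u)⌉₊] with N hN
  have hu1 : 0 < 1 - u := sub_pos.2 hu.2
  have hf1 : (⌊u * (N : ℝ)⌋₊ : ℝ) ≤ u * N := Nat.floor_le (mul_nonneg hu.1.le (Nat.cast_nonneg N))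
  have hf2 : u * N < ⌊u * (N : ℝ)⌋₊ + 1 := Nat.lt_floor_add_one _
  have hjN : (j : ℝ) < (1 - u) * N := by
    have := (Nat.le_ceil _).trans_lt (Nat.cast_lt.2 hN : ((⌈(j : ℝ) / (1 - u)⌉₊ : ℕ) : ℝ) < N)
    rwa [div_lt_iff₀ hu1, mul_comm] at this
  have hl : ⌊u * (N : ℝ)⌋₊ + j + 1 ≤ N + 1 := by
    have : ((⌊u * (N : ℝ)⌋₊ + j + 1 : ℕ) : ℝ) ≤ (N + 1 : ℕ) := by
      push_cast
      linarith
    exact_mod_cast this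
  refine (integral_sq_hiddenTemp_sub_le hs TL TR ⟨hu.1.le, hu.2.le⟩ hl).trans ?_
  refine mul_le_mul_of_nonneg_left (add_le_add ?_ (le_of_eq ?_)) (sq_nonneg _)
  · rw [mul_one_div, div_pow, div_pow]
    refine div_le_div_of_nonneg_right (sq_le_sq' ?_ ?_) (by positivity)
    · push_cast
      linarith [hu.2]
    · push_cast
      linarith [hu.1]
  · rw [one_div_mul_one_div]

theorem tendsto_integral_seenFrom_mixture (hs : 0 < s) (hL : 0 < TL) (hR : 0 < TR) {u : ℝ}
    (hu : u ∈ Set.Ioo (0 : ℝ) 1) {S : Finset ℕ}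
    (hS : DependsOn (f : (ℕ → PosReal) → ℝ) (S : Set ℕ)) :
    Tendsto (fun N : ℕ => ∫ y, f (seenFrom ⌊u * (N : ℝ)⌋₊ y) ∂(mixture s hL hR N)) atTop
      (𝓝 (∫ z, f z ∂(gammaProduct s (1 / temperature TL TR u)))) := by
  have hT := temperature_pos hL hR hu
  have hprob : ∀ N : ℕ, IsProbabilityMeasure (gammaConfig s (N + 1)) := fun N =>
    isProbabilityMeasure_gammaConfig hs (N + 1)
  have key := tendsto_integral_of_tendsto_integral_sq (μ := fun N : ℕ => gammaConfig s (N + 1))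
    (Y := fun N X j => hiddenTempPos hL hR X (⌊u * (N : ℝ)⌋₊ + j + 1))
    (c := fun _ => ⟨temperature TL TR u, hT⟩)
    (fun N => measurable_pi_lambda _ fun j => measurable_hiddenTempPos hL hR _)
    (fun j N => ?_) (tendsto_integral_sq_hiddenTemp hs TL TR hu)
    (continuous_scaledMean f hs) (abs_scaledMean_le f hs)
  · rw [scaledMean_const f hs] at key
    refine key.congr' ?_
    filter_upwards [eventually_gt_atTop ⌈((S.sup id : ℕ) : ℝ) / (1 - u)⌉₊] with N hN
    refine (integral_seenFrom_mixture f hs hL hR hS fun j hj => ?_).symm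
    have hu1 : 0 < 1 - u := sub_pos.2 hu.2
    have hf1 : (⌊u * (N : ℝ)⌋₊ : ℝ) ≤ u * N :=
      Nat.floor_le (mul_nonneg hu.1.le (Nat.cast_nonneg N))
    have h1 := (Nat.le_ceil _).trans_lt
      (Nat.cast_lt.2 hN : ((⌈((S.sup id : ℕ) : ℝ) / (1 - u)⌉₊ : ℕ) : ℝ) < N)
    rw [div_lt_iff₀ hu1] at h1
    have h2 : (j : ℝ) ≤ (S.sup id : ℕ) := Nat.cast_le.2 (Finset.le_sup (f := id) hj)
    have h3 : ((⌊u * (N : ℝ)⌋₊ + j : ℕ) : ℝ) < N := by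
      push_cast
      linarith
    exact_mod_cast h3
  · refine (integrable_const ((TL + TR + temperature TL TR u) ^ 2)).mono'
      (((measurable_hiddenTemp TL TR _).sub_const _).pow_const 2).aestronglyMeasurable
      (ae_of_all _ fun X => ?_)
    have h1 := hiddenTemp_pos hL hR X.toReal_pos (⌊u * (N : ℝ)⌋₊ + j + 1)
    have h2 := hiddenTemp_le hL hR X.toReal_pos (⌊u * (N : ℝ)⌋₊ + j + 1)
    rw [Real.norm_of_nonneg (sq_nonneg _)]
    refine sq_le_sq' ?_ ?_
    · change _ ≤ hiddenTemp TL TR X.toReal _ - temperature TL TR u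
      linarith
    · change hiddenTemp TL TR X.toReal _ - temperature TL TR u ≤ _
      linarith

end LocalEquilibrium

/-! ### Fourier's law -/

section Fourier

variable {N : ℕ} {s TL TR : ℝ}

theorem hasMean_energy_mixture (hs : 0 < s) (hL : 0 < TL) (hR : 0 < TR) (i : Fin N) :
    HasMean (mixture s hL hR N) (fun y => (y i : ℝ))
      (2 * s * (TL + (TR - TL) * (i + 1) / (N + 1))) := by
  have h := (hasMean_dualFun_mixture hs hL hR (Pi.single i 1)).const_mul (2 * s)
  have h1 : ∀ X : Config (N + 1), hiddenMono TL TR (Pi.single i 1) X.toReal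
      = hiddenTemp TL TR X.toReal (i + 1) := fun X => by
    rw [hiddenMono, Finset.prod_eq_single i]
    · simp
    · intro l _ hl
      rw [Pi.single_eq_of_ne hl, pow_zero]
    · simp
  simp only [h1] at h
  rw [(hasMean_hiddenTemp hs TL TR (by omega : (i : ℕ) + 1 ≤ N + 1)).2] at h
  convert h using 1
  · funext y
    rw [dualFun_single hs, rising_one hs, pow_one, mul_inv_cancel_left₀ (by positivity)]
    rfl
  · push_cast
    ring

theorem totalCurrent_mixture (hs : 0 < s) (hL : 0 < TL) (hR : 0 < TR) (hN : 1 ≤ N) :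
    totalCurrent (mixture s hL hR N) = -(2 * s) * (TR - TL) * ((N - 1) / (N + 1)) := by
  have hflux : ∀ i j : Fin N, (if (i : ℕ) + 1 = (j : ℕ) then flux (mixture s hL hR N) i j else 0)
      = if (i : ℕ) + 1 = (j : ℕ) then -(2 * s) * (TR - TL) / (N + 1) else 0 := by
    intro i j
    split_ifs with h
    · rw [flux, ((hasMean_energy_mixture hs hL hR i).sub (hasMean_energy_mixture hs hL hR j)).2, ← h]
      push_cast
      field_simp
      ring
    · rfl
  obtain ⟨M, rfl⟩ : ∃ M, N = M + 1 := ⟨N - 1, by omega⟩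
  have hrow : ∀ i : Fin (M + 1), (∑ j : Fin (M + 1), if (i : ℕ) + 1 = (j : ℕ) then
      -(2 * s) * (TR - TL) / ((M + 1 : ℕ) + 1) else 0)
      = if (i : ℕ) + 1 < M + 1 then -(2 * s) * (TR - TL) / ((M + 1 : ℕ) + 1) else 0 := fun i => by
    rw [sum_ite_succ i (fun _ => -(2 * s) * (TR - TL) / (((M + 1 : ℕ) : ℝ) + 1))]
    split_ifs <;> rfl
  rw [totalCurrent]
  simp only [hflux, hrow]
  rw [Fin.sum_univ_castSucc]
  simp
  ring

theorem tendsto_totalCurrent_mixture (hs : 0 < s) (hL : 0 < TL) (hR : 0 < TR) :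
    Tendsto (fun N : ℕ => totalCurrent (mixture s hL hR N)) atTop (𝓝 (-(2 * s) * (TR - TL))) := by
  have h1 : Tendsto (fun N : ℕ => -(2 * s) * (TR - TL) * (1 - 2 * (1 / ((N : ℝ) + 1)))) atTop
      (𝓝 (-(2 * s) * (TR - TL))) := by
    have h := tendsto_one_div_add_atTop_nhds_zero_nat (𝕜 := ℝ)
    simpa using ((h.const_mul 2).const_sub 1).const_mul (-(2 * s) * (TR - TL))
  refine h1.congr' ?_
  filter_upwards [eventually_ge_atTop 1] with N hN
  rw [totalCurrent_mixture hs hL hR hN]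
  congr 1
  field_simp
  ring

theorem deriv_temperature (TL TR u : ℝ) : deriv (temperature TL TR) u = TR - TL := by
  have h := ((hasDerivAt_id u).const_mul (TR - TL)).const_add TL
  rw [mul_one] at h
  exact h.deriv

end Fourier

end HeatConduction

theorem theorem3 (s lamL lamR : ℝ) (hs : 0 < s) (hL : 0 < lamL) (hR : 0 < lamR)
    (TL TR : ℝ) (hTL : TL = 1 / lamL) (hTR : TR = 1 / lamR)
    (P : (N : ℕ) → NNReal → Kernel (HeatConduction.Config N) (HeatConduction.Config N))
    (hP : ∀ N, 1 ≤ N → HeatConduction.IsHeatSemigroup s lamL lamR (P N))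
    (μ : (N : ℕ) → Measure (HeatConduction.Config N))
    (hμ : ∀ N, 1 ≤ N → HeatConduction.IsStationary (P N) (μ N)) :
    (∀ u ∈ Set.Ioo (0 : ℝ) 1,
      ∀ f : BoundedContinuousFunction (ℕ → HeatConduction.PosReal) ℝ,
        (∃ S : Finset ℕ, DependsOn (f : (ℕ → HeatConduction.PosReal) → ℝ) (S : Set ℕ)) →
        Tendsto (fun N : ℕ => ∫ y, f (HeatConduction.seenFrom ⌊u * (N : ℝ)⌋₊ y) ∂(μ N)) atTop
          (𝓝 (∫ z, f z
            ∂(HeatConduction.gammaProduct s (1 / HeatConduction.temperature TL TR u))))) ∧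
    (∀ N, 1 ≤ N → ∀ i : Fin N,
      Integrable (fun y : HeatConduction.Config N => (y i : ℝ)) (μ N)) ∧
    (∃ J : ℝ, Tendsto (fun N : ℕ => HeatConduction.totalCurrent (μ N)) atTop (𝓝 J) ∧
      ∀ u ∈ Set.Ioo (0 : ℝ) 1, J = -(2 * s) * deriv (HeatConduction.temperature TL TR) u) := by
  subst hTL hTR
  have hmix : ∀ N, 1 ≤ N →
      μ N = HeatConduction.mixture s (one_div_pos.2 hL) (one_div_pos.2 hR) N := fun N hN =>
    HeatConduction.eq_mixture_of_isStationary (hP N hN) hs hL hR hN (hμ N hN)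
  refine ⟨fun u hu f ⟨S, hS⟩ => ?_, fun N hN i => ?_,
    -(2 * s) * (1 / lamR - 1 / lamL), ?_, fun u _ => ?_⟩
  · refine (HeatConduction.tendsto_integral_seenFrom_mixture f hs (one_div_pos.2 hL)
      (one_div_pos.2 hR) hu hS).congr' ?_
    filter_upwards [eventually_ge_atTop 1] with N hN
    rw [hmix N hN]
  · rw [hmix N hN]
    exact (HeatConduction.hasMean_energy_mixture hs (one_div_pos.2 hL) (one_div_pos.2 hR) i).1
  · refine (HeatConduction.tendsto_totalCurrent_mixture hs (one_div_pos.2 hL)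
      (one_div_pos.2 hR)).congr' ?_
    filter_upwards [eventually_ge_atTop 1] with N hN
    rw [hmix N hN]
  · rw [HeatConduction.deriv_temperature]
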